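/- **Proposition 2.1.** Let $(M,g)$ be a compact (smooth, Hausdorff, boundaryless) Riemannian surface. *Notation.* For $\delta,\Lambda>0$ and $p_0\in M$, a $(\delta,\Lambda)$-adapted chart at $p_0$ is a smooth system of local coordinates $x=(x^1,x^2)$ of $M$ centred at $p_0$ whose range contains the closed ball $B_\delta\subset\mathbb R^2$, such that $g_{ij}(0)=\delta_{ij}$, $\partial_kg_{ij}(0)=0$ and, on $B_\delta$, $\Lambda^{-1}|\xi|^2\le g_{ij}\xi^i\xi^j\le\Lambda|\xi|^2$ for all $\xi\in\mathbb R^2$ and $|\nabla g_{ij}|\le\Lambda$. For $c>0$, a $(\delta,c)$-cut-off function is a $C^2$ function $\phi:\mathbb R^2\to[0,1]$ with $\phi=1$ on $B_{\delta/2}$, $\phi=0$ off $B_\delta$, $|\nabla\phi|\le c\,\delta^{-1}$ and $|\nabla^2\phi|\le c\,\delta^{-2}$. Let $N$ be a smooth embedded submanifold (without boundary) of some $\mathbb R^k$ with second fundamental form $A_q(X,Y)=(D_X\tilde Y)^\perp$, let $0<\omega<\infty$, and let $u:M\times[0,\omega)\to N$ be a smooth solution of the harmonic heat flow $u_t=\Delta_gu-A_u(\nabla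 u,\nabla u)$ with initial value $u_0=u(\cdot,0)$. Put $E(u_0)=\frac12\int_M|\nabla u_0|_g^2\,dV_g$. In an adapted chart at $p_0$ set, for $s\ge-\log\omega$, $$w(y,s)=u\big(e^{-s/2}y,\ \omega-e^{-s}\big),\quad \tilde g_{ij}(y,s)=g_{ij}(e^{-s/2}y),\quad \varphi(y,s)=\phi(e^{-s/2}y),\quad \rho(y)=e^{-|y|^2/4},$$ $$\mathcal E(w(s))=\frac12\int_{\mathbb R^2}\rho\,|\nabla w|_{\tilde g}^2\,\varphi^2\,dV_{\tilde g},\qquad |\nabla w|^2_{\tilde g}=\tilde g^{ij}\,\partial_iw\cdot\partial_jw,\quad dV_{\tilde g}=\sqrt{\det\tilde g}\,dy$$ (integrands vanish where $\varphi$ does). *Claim.* (a) There are $\delta,\Lambda>0$, depending only on $(M,g)$, such that every $p_0\in M$ has a $(\delta,\Lambda)$-adapted chart. (b) For all $\delta,\Lambda,c>0$ and $\kappa>1$ there are constants $C>0$ and $s_0$, depending only on $(M,g),\delta,\Lambda,c$ and $\kappa$ (so only on $(M,g)$ and $\kappa$ once $\delta,\Lambda$ are fixed as in (a) and $c$ is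 a universal constant), such that for every $p_0\in M$, every $(\delta,\Lambda)$-adapted chart at $p_0$, every $(\delta,c)$-cut-off function $\phi$, and all $N,\omega,u$ as above, $$\mathcal E(w(s))\le(1+\kappa^{-1})\,\mathcal E(w(s'))+Ce^{-\kappa s'}E(u_0)\qquad\text{for all } s>s'\ge\max\{s_0,-\log\omega\},$$ and $$\int_{-\log\omega}^{\infty}\int_{\mathbb R^2}\rho\,|w_s|^2\varphi^2\,dV_{\tilde g}\,ds\le C\,E(u_0)<\infty .$$ -/

import Mathlib

open Set MeasureTheory
open scoped Manifold ContDiff ENNReal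

namespace HarmonicFlow

noncomputable section

/-- Euclidean space `ℝᵏ`. -/
abbrev Euc (k : ℕ) : Type := EuclideanSpace ℝ (Fin k)

/-- The coordinate plane, on which surfaces are modelled. -/
abbrev Plane : Type := Euc 2

/-- The `i`-th standard basis vector of the plane. -/
def basisVec (i : Fin 2) : Plane := EuclideanSpace.single i (1 : ℝ)

/-- The partial derivative `∂f/∂xⁱ`. -/
def partialD {F : Type*} [NormedAddCommGroup F] [NormedSpace ℝ F]
    (i : Fin 2) (f : Plane → F) (x : Plane) : F :=
  fderiv ℝ f x (basisVec i)

/-! ### Riemannian surfaces -/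

section Surface

variable {M : Type*} [TopologicalSpace M] [ChartedSpace Plane M] [IsManifold 𝓘(ℝ, Plane) ∞ M]

/-- Smooth Riemannian metrics on a smooth surface `M`. -/
abbrev Metric (M : Type*) [TopologicalSpace M] [ChartedSpace Plane M]
    [IsManifold 𝓘(ℝ, Plane) ∞ M] :=
  Bundle.ContMDiffRiemannianMetric 𝓘(ℝ, Plane) ∞ Plane (fun p : M => TangentSpace 𝓘(ℝ, Plane) p)

/-- The coefficients `g_ij(x) = g(∂_i, ∂_j)` of the metric at the point with coordinate `x` in the
local coordinates `Φ`. -/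
def metricMatrix (g : Metric M) (Φ : OpenPartialHomeomorph M Plane) (x : Plane) :
    Matrix (Fin 2) (Fin 2) ℝ :=
  Matrix.of fun i j =>
    g.inner (Φ.symm x)
      (mfderiv 𝓘(ℝ, Plane) 𝓘(ℝ, Plane) Φ.symm x (basisVec i))
      (mfderiv 𝓘(ℝ, Plane) 𝓘(ℝ, Plane) Φ.symm x (basisVec j))

/-- The density `√(det g_ij)` of the volume element in the local coordinates `Φ`. -/
def volDensity (g : Metric M) (Φ : OpenPartialHomeomorph M Plane) (x : Plane) : ℝ :=
  Real.sqrt (metricMatrix g Φ x).det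

/-- `|∇f|²_g = g^{ij} ⟨∂_i f, ∂_j f⟩` for a vector-valued function `f` of the coordinate `x`. -/
def gradSq {k : ℕ} (g : Metric M) (Φ : OpenPartialHomeomorph M Plane) (f : Plane → Euc k)
    (x : Plane) : ℝ :=
  ∑ i, ∑ j, (metricMatrix g Φ x)⁻¹ i j * inner ℝ (partialD i f x) (partialD j f x)

/-- The Laplace-Beltrami operator `(1/√g) ∂_i (√g g^{ij} ∂_j f)` in the local coordinates `Φ`. -/
def laplaceBeltrami {k : ℕ} (g : Metric M) (Φ : OpenPartialHomeomorph M Plane)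
    (f : Plane → Euc k) (x : Plane) : Euc k :=
  (volDensity g Φ x)⁻¹ • ∑ i, partialD i
    (fun z => ∑ j, (volDensity g Φ z * (metricMatrix g Φ z)⁻¹ i j) • partialD j f z) x

/-- The measure `√(det g_ij) dx` on the coordinate domain of `Φ`, transported to `M`. -/
def chartVolume [MeasurableSpace M] (g : Metric M) (Φ : OpenPartialHomeomorph M Plane) :
    Measure M :=
  ((volume.restrict Φ.target).withDensity
    (fun x => ENNReal.ofReal (volDensity g Φ x))).map Φ.symm

/-- The Riemannian volume measure. The measures `chartVolume g Φ` agree on the overlaps of the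
coordinate domains; the volume is the smallest measure which dominates all of them, i.e. the measure
which restricts to `√(det g_ij) dx` on each coordinate domain. -/
def riemannianVolume [MeasurableSpace M] (g : Metric M) : Measure M :=
  ⨆ Φ ∈ IsManifold.maximalAtlas 𝓘(ℝ, Plane) ∞ M, chartVolume g Φ

/-- The energy density `e(u) = |∇u|²_g` of a map `u : M → ℝᵏ`. It does not depend on the
coordinates; at the point `p` those of the preferred chart at `p` are used. -/
def energyDensity {k : ℕ} (g : Metric M) (u : M → Euc k) (p : M) : ℝ :=
  gradSq g (chartAt Plane p) (u ∘ (chartAt Plane p).symm) (chartAt Plane p p)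

/-- The Dirichlet energy `E(u) = ½ ∫_M |∇u|²_g dV_g`. -/
def energy [MeasurableSpace M] {k : ℕ} (g : Metric M) (u : M → Euc k) : ℝ :=
  (1 / 2) * ∫ p, energyDensity g u p ∂(riemannianVolume g)

end Surface

/-! ### Submanifolds of Euclidean space -/

/-- `N` is an embedded smooth `n`-dimensional submanifold (without boundary) of `ℝᵏ`: near each of
its points there is a smooth diffeomorphism between open sets which straightens `N` to the
coordinate subspace `ℝⁿ × {0}`. -/
def IsSubmanifold (n k : ℕ) (N : Set (Euc k)) : Prop :=
  n ≤ k ∧ ∀ q ∈ N, ∃ Ψ : OpenPartialHomeomorph (Euc k) (Euc k), q ∈ Ψ.source ∧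
    ContDiffOn ℝ ∞ Ψ Ψ.source ∧ ContDiffOn ℝ ∞ Ψ.symm Ψ.target ∧
    ∀ z ∈ Ψ.source, (z ∈ N ↔ ∀ i : Fin k, n ≤ (i : ℕ) → Ψ z i = 0)

/-- The tangent space `T_q N`, as a subspace of `ℝᵏ`. -/
def tangentSpaceAt {k : ℕ} (N : Set (Euc k)) (q : Euc k) : Submodule ℝ (Euc k) :=
  Submodule.span ℝ (tangentConeAt ℝ N q)

/-- The second fundamental form of `N ⊆ ℝᵏ`, `A_q(X, Y) = (D_X Ỹ)^⊥` for `X, Y ∈ T_q N`, where the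
tangential extension `Ỹ` of `Y` is the orthogonal projection of `Y` to the tangent spaces of `N`. -/
def secondFundamentalForm {k : ℕ} (N : Set (Euc k)) (q X Y : Euc k) : Euc k :=
  (tangentSpaceAt N q)ᗮ.starProjection
    (fderivWithin ℝ (fun z => (tangentSpaceAt N z).starProjection Y) N q X)

/-! ### The harmonic map heat flow -/

section Flow

variable {M : Type*} [TopologicalSpace M] [ChartedSpace Plane M] [IsManifold 𝓘(ℝ, Plane) ∞ M]

/-- `A_u(∇u, ∇u) = g^{ij} A_u(∂_i u, ∂_j u)` in the local coordinates `Φ`. -/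
def secondFormTrace {k : ℕ} (g : Metric M) (N : Set (Euc k)) (Φ : OpenPartialHomeomorph M Plane)
    (f : Plane → Euc k) (x : Plane) : Euc k :=
  ∑ i, ∑ j, (metricMatrix g Φ x)⁻¹ i j •
    secondFundamentalForm N (f x) (partialD i f x) (partialD j f x)

/-- `u(p, t)` is a smooth solution `M × [0, T) → N` of the harmonic heat flow
`u_t = Δ_g u - A_u(∇u, ∇u)`; the equation is required in all local coordinates of `M`. -/
structure IsHarmonicHeatFlow {k : ℕ} (g : Metric M) (N : Set (Euc k)) (T : ℝ)
    (u : M → ℝ → Euc k) : Prop where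
  smooth : ContMDiffOn (𝓘(ℝ, Plane).prod 𝓘(ℝ, ℝ)) 𝓘(ℝ, Euc k) ∞
    (fun z : M × ℝ => u z.1 z.2) (univ ×ˢ Ico 0 T)
  mem : ∀ p, ∀ t ∈ Ico 0 T, u p t ∈ N
  equation : ∀ Φ ∈ IsManifold.maximalAtlas 𝓘(ℝ, Plane) ∞ M, ∀ x ∈ Φ.target, ∀ t ∈ Ioo 0 T,
    deriv (fun τ => u (Φ.symm x) τ) t =
      laplaceBeltrami g Φ (fun z => u (Φ.symm z) t) x -
        secondFormTrace g N Φ (fun z => u (Φ.symm z) t) x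

/-- `Φ` is a smooth system of local coordinates of `M`, centred at `p₀`, whose range contains the
ball `B_δ`, with `g_ij(0) = δ_ij`, `∂_k g_ij(0) = 0` and with the bounds
`Λ⁻¹ |ξ|² ≤ g_ij ξⁱ ξʲ ≤ Λ |ξ|²` and `|∇g_ij| ≤ Λ` on `B_δ`. -/
structure IsAdaptedChart (g : Metric M) (p₀ : M) (δ Λ : ℝ)
    (Φ : OpenPartialHomeomorph M Plane) : Prop where
  mem_atlas : Φ ∈ IsManifold.maximalAtlas 𝓘(ℝ, Plane) ∞ M
  mem_source : p₀ ∈ Φ.source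
  map_center : Φ p₀ = 0
  ball_subset : Metric.closedBall (0 : Plane) δ ⊆ Φ.target
  metric_zero : metricMatrix g Φ 0 = 1
  fderiv_metric_zero : ∀ i j, fderiv ℝ (fun x => metricMatrix g Φ x i j) 0 = 0
  metric_bounds : ∀ x ∈ Metric.closedBall (0 : Plane) δ, ∀ ξ : Plane,
    Λ⁻¹ * ‖ξ‖ ^ 2 ≤ ∑ i, ∑ j, metricMatrix g Φ x i j * ξ i * ξ j ∧
      ∑ i, ∑ j, metricMatrix g Φ x i j * ξ i * ξ j ≤ Λ * ‖ξ‖ ^ 2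
  fderiv_metric_bound : ∀ x ∈ Metric.closedBall (0 : Plane) δ, ∀ i j,
    ‖fderiv ℝ (fun z => metricMatrix g Φ z i j) x‖ ≤ Λ

/-- `φ` is a cut-off function with `φ = 1` on `B_{δ/2}`, `φ = 0` off `B_δ`, `0 ≤ φ ≤ 1`,
`|∇φ| ≤ c / δ` and `|∇²φ| ≤ c / δ²`. -/
structure IsCutoff (δ c : ℝ) (φ : Plane → ℝ) : Prop where
  contDiff : ContDiff ℝ 2 φ
  eq_one : ∀ x ∈ Metric.closedBall (0 : Plane) (δ / 2), φ x = 1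
  eq_zero : ∀ x ∉ Metric.closedBall (0 : Plane) δ, φ x = 0
  mem_Icc : ∀ x, φ x ∈ Icc (0 : ℝ) 1
  fderiv_le : ∀ x, ‖fderiv ℝ φ x‖ ≤ c / δ
  fderiv_fderiv_le : ∀ x, ‖fderiv ℝ (fderiv ℝ φ) x‖ ≤ c / δ ^ 2

/-- The rescaled solution `w(y, s) = u(x, t)`, `x = e^{-s/2} y`, `t = T - e^{-s}`, where `x` is the
coordinate given by `Φ`. -/
def rescaled {k : ℕ} (Φ : OpenPartialHomeomorph M Plane) (T : ℝ) (u : M → ℝ → Euc k)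
    (y : Plane) (s : ℝ) : Euc k :=
  u (Φ.symm (Real.exp (-s / 2) • y)) (T - Real.exp (-s))

/-- The Gaussian weight `ρ(y) = e^{-|y|²/4}`. -/
def gaussianWeight (y : Plane) : ℝ := Real.exp (-‖y‖ ^ 2 / 4)

/-- `|∇w|²_{g̃} = g̃^{ij} ⟨∂_i w, ∂_j w⟩` at `(y, s)`, for the metric
`g̃_ij(y, s) = g_ij(e^{-s/2} y)`. -/
def rescaledGradSq {k : ℕ} (g : Metric M) (Φ : OpenPartialHomeomorph M Plane)
    (w : Plane → ℝ → Euc k) (y : Plane) (s : ℝ) : ℝ :=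
  ∑ i, ∑ j, (metricMatrix g Φ (Real.exp (-s / 2) • y))⁻¹ i j *
    inner ℝ (partialD i (fun z => w z s) y) (partialD j (fun z => w z s) y)

/-- The local energy `𝓔(w(s)) = ½ ∫ ρ |∇w|²_{g̃} φ² dV_{g̃}` with the expanding cut-off function
`φ(e^{-s/2} y)` and the volume element `dV_{g̃} = √(det g̃) dy`. -/
def localEnergy {k : ℕ} (g : Metric M) (Φ : OpenPartialHomeomorph M Plane) (φ : Plane → ℝ)
    (w : Plane → ℝ → Euc k) (s : ℝ) : ℝ :=
  (1 / 2) * ∫ y : Plane, gaussianWeight y * rescaledGradSq g Φ w y s *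
    φ (Real.exp (-s / 2) • y) ^ 2 * volDensity g Φ (Real.exp (-s / 2) • y)

/-- The weighted dissipation `∫_{s₁}^∞ ∫ ρ |w_s|² φ² dV_{g̃} ds`, a priori possibly infinite. -/
def localDissipation {k : ℕ} (g : Metric M) (Φ : OpenPartialHomeomorph M Plane) (φ : Plane → ℝ)
    (w : Plane → ℝ → Euc k) (s₁ : ℝ) : ℝ≥0∞ :=
  ∫⁻ s in Ioi s₁, ∫⁻ y : Plane, ENNReal.ofReal
    (gaussianWeight y * ‖deriv (fun σ => w y σ) s‖ ^ 2 *
      φ (Real.exp (-s / 2) • y) ^ 2 * volDensity g Φ (Real.exp (-s / 2) • y))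

end Flow

end

end HarmonicFlow

/-! The estimate is Struwe's monotonicity formula, localized in a chart. Let `τ = T - t`, `Q =
a^{ij}⟨∂_i u, ∂_j u⟩` with `a^{ij} = √g g^{ij}`, `m = √g`, and `η = e^{-|x|²/4τ} φ²`. In dimension
two the Dirichlet energy is scale invariant, so the rescaled energy is exactly `F(t) = ½ ∫ η Q dx`
at `t = T - e^{-s}` (`localEnergy_eq`), and `w_s = τ (u_t - x·∇u / 2τ)`
(`IsHarmonicHeatFlow.deriv_rescaled`).

Two integral identities produce the square of `w_s`. Testing the equation with `η u_t` gives `F'`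
(`IsLocalFlow.hasDerivAt_energy`); testing it with `η x·∇u / 2τ` gives a Pohozaev identity whose
integral is zero (`integral_pohozaev`). The nonlinear term is normal to `N`, while `u_t` and `∂_i u`
are tangential, so it drops out of both. In the sum (`integrand_identity`) the terms form `-η m |u_t
- x·∇u/2τ|²` plus errors that vanish for a flat metric without cut-off.

The errors are of two kinds. Those from the metric are at most a multiple of `(|x|/τ + |x|⁴/τ²) η
Q`, because `a^{ij} - m δ_ij = O(|x|)` and `x·∇a^{ij} = O(|x|)`. For `|x| ≤ τ^{3/8}` the factor is
at most `2 τ^{-5/8}`, which is integrable in time; for larger `|x|` the Gaussian is smaller than any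
power of `τ`. Those from `∇φ` live where `|x| ≥ δ/2` and are again smaller than any power of `τ`
(`gaussian_tail_bounds`). Since the global energy decreases (`energy_antitoneOn`), this gives `F' ≤
-½ D + A τ^{-5/8} F + B τ^{κ-1} E(u_0)`, with `D = ∫ η m |u_t - x·∇u/2τ|²`. Hence `exp((8/3) A
τ^{3/8}) F + K E(u_0) τ^κ` is nonincreasing (`exists_hasDerivAt_correctedEnergy`). The exponential
tends to 1 as `τ → 0`, so it is below `1 + κ⁻¹` for `τ ≤ τ₀`; this fixes `s₀ = -log τ₀` and yields
the first inequality.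

The same corrected energy bounds the dissipation for `τ ≤ τ₀`. For earlier times the global energy
identity controls `u_t`, and the radial part is bounded crudely, with a constant depending on `τ₀`
but not on `T` (`lintegral_Ioc_dissipation_le`).

Claim (a) is independent of the flow. At a point `z` of a chart, a Gram-Schmidt frame followed by
the quadratic correction `x - ½ Γ(x, x)` with the Christoffel symbols makes the metric Euclidean to
first order (`matrixD_quadPull_zero`). Everything depends smoothly on `(z, x)`, so one radius serves
all nearby `z` (`IsPlanarMetric.exists_uniform_coordinates`), and compactness of `M` finishes the
argument. -/

namespace HarmonicFlow

noncomputable section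

/-! ### Metric coefficients in charts and their transformation laws. -/

section ChartAlgebra

variable {M : Type*} [TopologicalSpace M] [ChartedSpace Plane M] [IsManifold 𝓘(ℝ, Plane) ∞ M]

/-- The coordinate fields are constant sections pushed through the tangent map of `Φ.symm`, hence
smooth; the bundle metric applied to two smooth sections is smooth. -/
theorem metricMatrix_contDiffOn (g : Metric M) {Φ : OpenPartialHomeomorph M Plane}
    (hΦ : Φ ∈ IsManifold.maximalAtlas 𝓘(ℝ, Plane) ∞ M) (i j : Fin 2) :
    ContDiffOn ℝ ∞ (fun x => metricMatrix g Φ x i j) Φ.target := by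
  have hs := contMDiffOn_symm_of_mem_maximalAtlas hΦ
  have hT : ContMDiffOn 𝓘(ℝ, Plane).tangent 𝓘(ℝ, Plane).tangent ∞
      (tangentMapWithin 𝓘(ℝ, Plane) 𝓘(ℝ, Plane) Φ.symm Φ.target)
      (Bundle.TotalSpace.proj ⁻¹' Φ.target) :=
    hs.contMDiffOn_tangentMapWithin (by simp) Φ.open_target.uniqueMDiffOn
  have hV : ∀ i : Fin 2, ContMDiffOn 𝓘(ℝ, Plane) 𝓘(ℝ, Plane).tangent ∞
      (fun x : Plane => (Bundle.TotalSpace.mk' Plane (Φ.symm x)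
        (mfderiv 𝓘(ℝ, Plane) 𝓘(ℝ, Plane) Φ.symm x (basisVec i)) :
        TangentBundle 𝓘(ℝ, Plane) M)) Φ.target := by
    intro i
    have hc : ContMDiffOn 𝓘(ℝ, Plane) 𝓘(ℝ, Plane).tangent ∞
        (fun x : Plane => (⟨x, basisVec i⟩ : TangentBundle 𝓘(ℝ, Plane) Plane)) Φ.target := by
      intro x hx
      exact contMDiffWithinAt_vectorSpace_iff_contDiffWithinAt.2 contDiffWithinAt_const
    refine (hT.comp hc (fun x hx => hx)).congr ?_
    intro x hx
    simp only [Function.comp, tangentMapWithin]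
    rw [mfderivWithin_of_isOpen Φ.open_target hx]
  rw [← contMDiffOn_iff_contDiffOn]
  intro x hx
  have hg : ContMDiffWithinAt 𝓘(ℝ, Plane) (𝓘(ℝ, Plane).prod 𝓘(ℝ, Plane →L[ℝ] Plane →L[ℝ] ℝ)) ∞
      (fun x : Plane => Bundle.TotalSpace.mk' (Plane →L[ℝ] Plane →L[ℝ] ℝ)
        (E := fun (p : M) => (TangentSpace 𝓘(ℝ, Plane) p →L[ℝ] TangentSpace 𝓘(ℝ, Plane) p →L[ℝ]
          Bundle.Trivial M ℝ p)) (Φ.symm x) (g.inner (Φ.symm x))) Φ.target x :=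
    (g.contMDiff (Φ.symm x)).comp_contMDiffWithinAt x (hs x hx)
  have := ContMDiffWithinAt.clm_bundle_apply₂ (F₁ := Plane) (F₂ := Plane) (F₃ := ℝ)
    (E₃ := Bundle.Trivial M ℝ) hg
    (hV i x hx) (hV j x hx)
  simp only [Bundle.contMDiffWithinAt_totalSpace] at this
  exact this.2

/-- The Jacobian matrix `∂κʲ/∂xⁱ` (row `j`, column `i`). -/
def jacobian (κ : Plane → Plane) (x : Plane) : Matrix (Fin 2) (Fin 2) ℝ :=
  Matrix.of fun j i => fderiv ℝ κ x (basisVec i) j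

theorem plane_eq_sum (v : Plane) : v = ∑ i, v i • basisVec i := by
  ext j
  fin_cases j <;> simp [basisVec, Fin.sum_univ_two]

theorem bilinear_expand (B : Plane →L[ℝ] Plane →L[ℝ] ℝ) (L : Plane →L[ℝ] Plane) (v w : Plane) :
    B (L v) (L w) = ∑ i, ∑ j, B (L (basisVec i)) (L (basisVec j)) * v i * w j := by
  conv_lhs => rw [plane_eq_sum v, plane_eq_sum w]
  simp only [Fin.sum_univ_two, map_add, map_smul, _root_.add_apply, _root_.smul_apply, smul_eq_mul]
  ring

/-- A metric evaluated on coordinate vectors. -/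
theorem inner_mfderiv_symm (g : Metric M) (Φ : OpenPartialHomeomorph M Plane) (x v w : Plane) :
    g.inner (Φ.symm x) (mfderiv 𝓘(ℝ, Plane) 𝓘(ℝ, Plane) Φ.symm x v)
      (mfderiv 𝓘(ℝ, Plane) 𝓘(ℝ, Plane) Φ.symm x w) =
      ∑ i, ∑ j, metricMatrix g Φ x i j * v i * w j :=
  bilinear_expand (g.inner (Φ.symm x)) (mfderiv 𝓘(ℝ, Plane) 𝓘(ℝ, Plane) Φ.symm x) v w

theorem det_jacobian (κ : Plane → Plane) (x : Plane) :
    (jacobian κ x).det = (fderiv ℝ κ x).det := by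
  rw [ContinuousLinearMap.det,
    ← LinearMap.det_toMatrix (EuclideanSpace.basisFun (Fin 2) ℝ).toBasis]
  congr 1
-- The map `κ` need not be a transition map of charts: the same law is applied to the quadratic
-- normal coordinates of claim (a).
theorem metricMatrix_comp (g : Metric M) {Φ Ψ : OpenPartialHomeomorph M Plane}
    (hΨ : Ψ ∈ IsManifold.maximalAtlas 𝓘(ℝ, Plane) ∞ M) {κ : Plane → Plane} {x : Plane}
    (hκ : DifferentiableAt ℝ κ x) (hx : κ x ∈ Ψ.target)
    (h : Φ.symm =ᶠ[nhds x] Ψ.symm ∘ κ) :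
    metricMatrix g Φ x = (jacobian κ x).transpose * metricMatrix g Ψ (κ x) * jacobian κ x := by
  have hd : MDifferentiableAt 𝓘(ℝ, Plane) 𝓘(ℝ, Plane) Ψ.symm (κ x) :=
    ((contMDiffOn_symm_of_mem_maximalAtlas hΨ).mdifferentiableOn (by simp)).mdifferentiableAt
      (Ψ.open_target.mem_nhds hx)
  have hpt : Φ.symm x = Ψ.symm (κ x) := h.eq_of_nhds
  -- The base points `Φ.symm x` and `Ψ.symm (κ x)` are equal only propositionally, so the two
  -- tangent vectors are compared by `HEq`.
  have hm : ∀ v : Plane, HEq (mfderiv 𝓘(ℝ, Plane) 𝓘(ℝ, Plane) Φ.symm x v)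
      (mfderiv 𝓘(ℝ, Plane) 𝓘(ℝ, Plane) Ψ.symm (κ x) (fderiv ℝ κ x v)) := by
    intro v
    have h1 : mfderiv 𝓘(ℝ, Plane) 𝓘(ℝ, Plane) Φ.symm x =
      mfderiv 𝓘(ℝ, Plane) 𝓘(ℝ, Plane) (Ψ.symm ∘ κ) x := h.mfderiv_eq
    have h2 : mfderiv 𝓘(ℝ, Plane) 𝓘(ℝ, Plane) (Ψ.symm ∘ κ) x =
      (mfderiv 𝓘(ℝ, Plane) 𝓘(ℝ, Plane) Ψ.symm (κ x)).comp
        (mfderiv 𝓘(ℝ, Plane) 𝓘(ℝ, Plane) κ x) := mfderiv_comp x hd hκ.mdifferentiableAt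
    rw [h1, h2, mfderiv_eq_fderiv]
    rfl
  have hb : ∀ i j, metricMatrix g Φ x i j = g.inner (Ψ.symm (κ x))
      (mfderiv 𝓘(ℝ, Plane) 𝓘(ℝ, Plane) Ψ.symm (κ x) (fderiv ℝ κ x (basisVec i)))
      (mfderiv 𝓘(ℝ, Plane) 𝓘(ℝ, Plane) Ψ.symm (κ x) (fderiv ℝ κ x (basisVec j))) := by
    intro i j
    -- Every tangent space unfolds to `Plane`, so the vectors can be typed before `p = q` is
    -- substituted.
    have key : ∀ (p q : M) (hpq : p = q) (v w v' w' : Plane), v = v' → w = w' →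
        g.inner p v w = g.inner q v' w' := by
      rintro p q rfl v w v' w' rfl rfl; rfl
    exact key _ _ hpt _ _ _ _ (eq_of_heq (hm _)) (eq_of_heq (hm _))
  ext i j
  rw [hb, inner_mfderiv_symm]
  simp only [Fin.sum_univ_two, Matrix.mul_apply, Matrix.transpose_apply, jacobian, Matrix.of_apply]
  ring

theorem metricMatrix_symm (g : Metric M) (Φ : OpenPartialHomeomorph M Plane) (x : Plane)
    (i j : Fin 2) : metricMatrix g Φ x i j = metricMatrix g Φ x j i :=
  g.symm _ _ _

theorem metricMatrix_quadratic_pos (g : Metric M) {Φ : OpenPartialHomeomorph M Plane}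
    (hΦ : Φ ∈ IsManifold.maximalAtlas 𝓘(ℝ, Plane) ∞ M) {x : Plane} (hx : x ∈ Φ.target)
    {ξ : Plane} (hξ : ξ ≠ 0) :
    0 < ∑ i, ∑ j, metricMatrix g Φ x i j * ξ i * ξ j := by
  have hd : MDifferentiableAt 𝓘(ℝ, Plane) 𝓘(ℝ, Plane) Φ.symm x :=
    ((contMDiffOn_symm_of_mem_maximalAtlas hΦ).mdifferentiableOn (by simp)).mdifferentiableAt
      (Φ.open_target.mem_nhds hx)
  have hd' : MDifferentiableAt 𝓘(ℝ, Plane) 𝓘(ℝ, Plane) Φ (Φ.symm x) :=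
    ((contMDiffOn_of_mem_maximalAtlas hΦ).mdifferentiableOn (by simp)).mdifferentiableAt
      (Φ.open_source.mem_nhds (Φ.map_target hx))
  have hne : mfderiv 𝓘(ℝ, Plane) 𝓘(ℝ, Plane) Φ.symm x ξ ≠ 0 := by
    intro h0
    have h1 : mfderiv 𝓘(ℝ, Plane) 𝓘(ℝ, Plane) (Φ ∘ Φ.symm) x = ContinuousLinearMap.id ℝ _ := by
      have : (Φ ∘ Φ.symm) =ᶠ[nhds x] id := by
        filter_upwards [Φ.open_target.mem_nhds hx] with y hy using Φ.right_inv hy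
      rw [this.mfderiv_eq]
      exact mfderiv_id
    rw [mfderiv_comp x hd' hd] at h1
    have h2 : mfderiv 𝓘(ℝ, Plane) 𝓘(ℝ, Plane) Φ (Φ.symm x)
        (mfderiv 𝓘(ℝ, Plane) 𝓘(ℝ, Plane) Φ.symm x ξ) = ξ := DFunLike.congr_fun h1 ξ
    rw [h0, map_zero] at h2
    exact hξ h2.symm
  have := g.pos _ _ hne
  rw [inner_mfderiv_symm] at this
  exact this

theorem det_pos_of_quadratic_pos {A : Matrix (Fin 2) (Fin 2) ℝ} (hs : A 0 1 = A 1 0)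
    (h : ∀ ξ : Plane, ξ ≠ 0 → 0 < ∑ i, ∑ j, A i j * ξ i * ξ j) : 0 < A 0 0 ∧ 0 < A.det := by
  have h0 : 0 < A 0 0 := by
    have := h (basisVec 0) (by intro h; simpa [basisVec] using congrArg (fun v : Plane => v 0) h)
    simpa [basisVec, Fin.sum_univ_two] using this
  refine ⟨h0, ?_⟩
  -- At `ξ = (-A₀₁, A₀₀)` the quadratic form equals `A₀₀ det A`.
  have := h (!₂[-A 0 1, A 0 0]) (by
    intro h; have := congrArg (fun v : Plane => v 1) h
    simp at this
    exact h0.ne' this)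
  simp only [Fin.sum_univ_two] at this
  simp at this
  rw [Matrix.det_fin_two]
  have h2 : 0 < A 0 0 * (A 0 0 * A 1 1 - A 0 1 * A 1 0) := by
    rw [← hs] at *; nlinarith
  exact pos_of_mul_pos_right (by linarith) h0.le

theorem metricMatrix_det_pos (g : Metric M) {Φ : OpenPartialHomeomorph M Plane}
    (hΦ : Φ ∈ IsManifold.maximalAtlas 𝓘(ℝ, Plane) ∞ M) {x : Plane} (hx : x ∈ Φ.target) :
    0 < (metricMatrix g Φ x).det :=
  (det_pos_of_quadratic_pos (metricMatrix_symm g Φ x 0 1)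
    fun _ hξ => metricMatrix_quadratic_pos g hΦ hx hξ).2

theorem volDensity_pos (g : Metric M) {Φ : OpenPartialHomeomorph M Plane}
    (hΦ : Φ ∈ IsManifold.maximalAtlas 𝓘(ℝ, Plane) ∞ M) {x : Plane} (hx : x ∈ Φ.target) :
    0 < volDensity g Φ x :=
  Real.sqrt_pos.2 (metricMatrix_det_pos g hΦ hx)

theorem volDensity_contDiffOn (g : Metric M) {Φ : OpenPartialHomeomorph M Plane}
    (hΦ : Φ ∈ IsManifold.maximalAtlas 𝓘(ℝ, Plane) ∞ M) :
    ContDiffOn ℝ ∞ (volDensity g Φ) Φ.target := by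
  have h := metricMatrix_contDiffOn g hΦ
  have hd : ContDiffOn ℝ ∞ (fun x => (metricMatrix g Φ x).det) Φ.target := by
    simp only [Matrix.det_fin_two]
    exact ((h 0 0).mul (h 1 1)).sub ((h 0 1).mul (h 1 0))
  exact hd.sqrt fun x hx => (metricMatrix_det_pos g hΦ hx).ne'

theorem inv_fin_two (A : Matrix (Fin 2) (Fin 2) ℝ) :
    A⁻¹ = (A.det)⁻¹ • !![A 1 1, -A 0 1; -A 1 0, A 0 0] := by
  rw [Matrix.inv_def, Matrix.adjugate_fin_two, Ring.inverse_eq_inv']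

/-- The coefficients `√g g^{ij}` of the Laplace-Beltrami operator in divergence form. -/
def conformalCoeff (g : Metric M) (Φ : OpenPartialHomeomorph M Plane) (i j : Fin 2) (x : Plane) :
    ℝ :=
  volDensity g Φ x * (metricMatrix g Φ x)⁻¹ i j

theorem conformalCoeff_contDiffOn (g : Metric M) {Φ : OpenPartialHomeomorph M Plane}
    (hΦ : Φ ∈ IsManifold.maximalAtlas 𝓘(ℝ, Plane) ∞ M) (i j : Fin 2) :
    ContDiffOn ℝ ∞ (conformalCoeff g Φ i j) Φ.target := by
  have h := metricMatrix_contDiffOn g hΦ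
  have hd : ContDiffOn ℝ ∞ (fun x => (metricMatrix g Φ x).det) Φ.target := by
    simp only [Matrix.det_fin_two]
    exact ((h 0 0).mul (h 1 1)).sub ((h 0 1).mul (h 1 0))
  refine (volDensity_contDiffOn g hΦ).mul ?_
  simp only [inv_fin_two, Matrix.smul_apply]
  refine (hd.inv fun x hx => (metricMatrix_det_pos g hΦ hx).ne').smul ?_
  fin_cases i <;> fin_cases j <;> simp
  exacts [h 1 1, (h 0 1).neg, (h 1 0).neg, h 0 0]

theorem conformalCoeff_symm (g : Metric M) (Φ : OpenPartialHomeomorph M Plane) (i j : Fin 2)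
    (x : Plane) : conformalCoeff g Φ i j x = conformalCoeff g Φ j i x := by
  simp only [conformalCoeff, inv_fin_two]
  have := metricMatrix_symm g Φ x 0 1
  fin_cases i <;> fin_cases j <;> simp [this]

/-- `g^{ij} ∂_i a ∂_j b` for scalar functions of the coordinate. -/
def gradInner (g : Metric M) (Φ : OpenPartialHomeomorph M Plane) (a b : Plane → ℝ) (x : Plane) :
    ℝ :=
  ∑ i, ∑ j, (metricMatrix g Φ x)⁻¹ i j * (partialD i a x * partialD j b x)

theorem partialD_comp {F : Type*} [NormedAddCommGroup F] [NormedSpace ℝ F] {f : Plane → F}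
    {κ : Plane → Plane} {x : Plane} (hf : DifferentiableAt ℝ f (κ x))
    (hκ : DifferentiableAt ℝ κ x) (i : Fin 2) :
    partialD i (f ∘ κ) x = ∑ j, jacobian κ x j i • partialD j f (κ x) := by
  have h : fderiv ℝ κ x (basisVec i) = ∑ l, jacobian κ x l i • basisVec l := plane_eq_sum _
  simp only [partialD]
  rw [fderiv_comp x hf hκ, ContinuousLinearMap.comp_apply, h]
  simp

/-- Inverting `A = Jᵀ B J` gives `J A⁻¹ Jᵀ = B⁻¹`, which absorbs the two Jacobians that the chain
rule puts on the gradients. -/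
theorem gradInner_comp (g : Metric M) {Φ Ψ : OpenPartialHomeomorph M Plane}
    (hΦ : Φ ∈ IsManifold.maximalAtlas 𝓘(ℝ, Plane) ∞ M)
    (hΨ : Ψ ∈ IsManifold.maximalAtlas 𝓘(ℝ, Plane) ∞ M) {κ : Plane → Plane} {x : Plane}
    (hκ : DifferentiableAt ℝ κ x) (hx : x ∈ Φ.target) (hκx : κ x ∈ Ψ.target)
    (h : Φ.symm =ᶠ[nhds x] Ψ.symm ∘ κ) {a b : Plane → ℝ}
    (ha : DifferentiableAt ℝ a (κ x)) (hb : DifferentiableAt ℝ b (κ x)) :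
    gradInner g Φ (a ∘ κ) (b ∘ κ) x = gradInner g Ψ a b (κ x) := by
  have hG := metricMatrix_comp g hΨ hκ hκx h
  have hdet := congrArg Matrix.det hG
  have h1 := metricMatrix_det_pos g hΦ hx
  have h2 := metricMatrix_det_pos g hΨ hκx
  simp only [gradInner, partialD_comp ha hκ, partialD_comp hb hκ]
  set J := jacobian κ x
  set A := metricMatrix g Φ x
  set B := metricMatrix g Ψ (κ x)
  have hJ : J.det ≠ 0 := by
    intro h0
    rw [Matrix.det_mul, Matrix.det_mul, h0, mul_zero] at hdet
    exact h1.ne' hdet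
  have hinv : J * A⁻¹ * J.transpose = B⁻¹ := by
    rw [hG, Matrix.mul_inv_rev, Matrix.mul_inv_rev, ← Matrix.mul_assoc, ← Matrix.mul_assoc,
      Matrix.mul_nonsing_inv J hJ.isUnit, Matrix.one_mul, Matrix.mul_assoc,
      Matrix.nonsing_inv_mul _ (by rw [Matrix.det_transpose]; exact hJ.isUnit), Matrix.mul_one]
  rw [← hinv]
  simp only [Fin.sum_univ_two, Matrix.mul_apply, Matrix.transpose_apply, smul_eq_mul]
  ring

theorem volDensity_comp (g : Metric M) {Φ Ψ : OpenPartialHomeomorph M Plane}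
    (hΨ : Ψ ∈ IsManifold.maximalAtlas 𝓘(ℝ, Plane) ∞ M) {κ : Plane → Plane} {x : Plane}
    (hκ : DifferentiableAt ℝ κ x) (hκx : κ x ∈ Ψ.target)
    (h : Φ.symm =ᶠ[nhds x] Ψ.symm ∘ κ) :
    volDensity g Φ x = |(fderiv ℝ κ x).det| * volDensity g Ψ (κ x) := by
  rw [volDensity, metricMatrix_comp g hΨ hκ hκx h, Matrix.det_mul, Matrix.det_mul,
    Matrix.det_transpose, ← det_jacobian, volDensity, ← Real.sqrt_sq_eq_abs,
    ← Real.sqrt_mul (sq_nonneg _)]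
  congr 1
  ring

/-- The change of coordinates between two charts satisfies the hypotheses of `metricMatrix_comp`. -/
theorem transition_properties {Φ Ψ : OpenPartialHomeomorph M Plane}
    (hΦ : Φ ∈ IsManifold.maximalAtlas 𝓘(ℝ, Plane) ∞ M)
    (hΨ : Ψ ∈ IsManifold.maximalAtlas 𝓘(ℝ, Plane) ∞ M) {x : Plane} (hx : x ∈ Φ.target)
    (hx' : Φ.symm x ∈ Ψ.source) :
    DifferentiableAt ℝ (Ψ ∘ Φ.symm) x ∧ (Ψ ∘ Φ.symm) x ∈ Ψ.target ∧
      Φ.symm =ᶠ[nhds x] Ψ.symm ∘ (Ψ ∘ Φ.symm) := by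
  refine ⟨?_, Ψ.map_source hx', ?_⟩
  · rw [← mdifferentiableAt_iff_differentiableAt]
    have hd : MDifferentiableAt 𝓘(ℝ, Plane) 𝓘(ℝ, Plane) Φ.symm x :=
      ((contMDiffOn_symm_of_mem_maximalAtlas hΦ).mdifferentiableOn (by simp)).mdifferentiableAt
        (Φ.open_target.mem_nhds hx)
    have hd' : MDifferentiableAt 𝓘(ℝ, Plane) 𝓘(ℝ, Plane) Ψ (Φ.symm x) :=
      ((contMDiffOn_of_mem_maximalAtlas hΨ).mdifferentiableOn (by simp)).mdifferentiableAt
        (Ψ.open_source.mem_nhds hx')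
    exact hd'.comp x hd
  · have : ∀ᶠ y in nhds x, Φ.symm y ∈ Ψ.source :=
      (Φ.continuousAt_symm hx).eventually (Ψ.open_source.mem_nhds hx')
    filter_upwards [this] with y hy
    exact (Ψ.left_inv hy).symm

/-- The pairing `⟨∇α, ∇β⟩_g` of two functions on `M` does not depend on the chart. -/
theorem gradInner_chart_eq (g : Metric M) {Φ Ψ : OpenPartialHomeomorph M Plane}
    (hΦ : Φ ∈ IsManifold.maximalAtlas 𝓘(ℝ, Plane) ∞ M)
    (hΨ : Ψ ∈ IsManifold.maximalAtlas 𝓘(ℝ, Plane) ∞ M) {p : M} (hp : p ∈ Φ.source)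
    (hp' : p ∈ Ψ.source) {α β : M → ℝ} (hα : DifferentiableAt ℝ (α ∘ Ψ.symm) (Ψ p))
    (hβ : DifferentiableAt ℝ (β ∘ Ψ.symm) (Ψ p)) :
    gradInner g Φ (α ∘ Φ.symm) (β ∘ Φ.symm) (Φ p) =
      gradInner g Ψ (α ∘ Ψ.symm) (β ∘ Ψ.symm) (Ψ p) := by
  have hx := Φ.map_source hp
  have hpp : Φ.symm (Φ p) = p := Φ.left_inv hp
  obtain ⟨h1, h2, h3⟩ := transition_properties hΦ hΨ hx (by rwa [hpp])
  have hκ : (Ψ ∘ Φ.symm) (Φ p) = Ψ p := by simp [hpp]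
  have hcongr : ∀ γ : M → ℝ, ∀ i, partialD i (γ ∘ Φ.symm) (Φ p) =
      partialD i ((γ ∘ Ψ.symm) ∘ (Ψ ∘ Φ.symm)) (Φ p) := by
    intro γ i
    simp only [partialD]
    rw [Filter.EventuallyEq.fderiv_eq]
    filter_upwards [h3] with y hy
    simp only [Function.comp] at hy ⊢
    rw [← hy]
  rw [← hκ] at hα hβ
  have := gradInner_comp g hΦ hΨ h1 hx h2 h3 hα hβ
  rw [hκ] at this
  rw [← this]
  simp only [gradInner, hcongr]

end ChartAlgebra

/-! ### The Riemannian volume and integration over coordinate domains. -/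

section RiemannianVolume

variable {M : Type*} [TopologicalSpace M] [ChartedSpace Plane M] [IsManifold 𝓘(ℝ, Plane) ∞ M]
  [MeasurableSpace M] [BorelSpace M]

theorem aemeasurable_chart_symm (g : Metric M) (Φ : OpenPartialHomeomorph M Plane) :
    AEMeasurable Φ.symm ((volume.restrict Φ.target).withDensity
      (fun x => ENNReal.ofReal (volDensity g Φ x))) :=
  (Φ.continuousOn_symm.aemeasurable Φ.open_target.measurableSet).mono_ac
    (withDensity_absolutelyContinuous _ _)

theorem chartVolume_apply (g : Metric M) (Φ : OpenPartialHomeomorph M Plane) {A : Set M}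
    (hA : MeasurableSet A) :
    chartVolume g Φ A =
      ∫⁻ x in Φ.target ∩ Φ.symm ⁻¹' A, ENNReal.ofReal (volDensity g Φ x) := by
  rw [chartVolume, Measure.map_apply_of_aemeasurable (aemeasurable_chart_symm g Φ) hA,
    withDensity_apply', Measure.restrict_restrict' Φ.open_target.measurableSet, inter_comm]

theorem measurableSet_chart_preimage (Φ : OpenPartialHomeomorph M Plane) {A : Set M}
    (hA : MeasurableSet A) : MeasurableSet (Φ.target ∩ Φ.symm ⁻¹' A) := by
  have h : Measurable (fun x : Φ.target => Φ.symm x) :=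
    (continuousOn_iff_continuous_domRestrict.1 Φ.continuousOn_symm).measurable
  have := Φ.open_target.measurableSet.subtype_image (h hA)
  convert this using 1
  ext x
  simp [and_comm]

theorem chartVolume_inter_source (g : Metric M) (Φ : OpenPartialHomeomorph M Plane) {A : Set M}
    (hA : MeasurableSet A) : chartVolume g Φ (A ∩ Φ.source) = chartVolume g Φ A := by
  rw [chartVolume_apply g Φ hA, chartVolume_apply g Φ (hA.inter Φ.open_source.measurableSet)]
  congr 2
  ext x
  simp only [mem_inter_iff, mem_preimage]
  exact ⟨fun h => ⟨h.1, h.2.1⟩, fun h => ⟨h.1, h.2, Φ.map_target h.1⟩⟩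

/-- This is the change of variables formula: the factor `|det Dκ|` of the transition map is exactly
the quotient of the two densities. -/
theorem chartVolume_eq_of_subset (g : Metric M) {Φ Ψ : OpenPartialHomeomorph M Plane}
    (hΦ : Φ ∈ IsManifold.maximalAtlas 𝓘(ℝ, Plane) ∞ M)
    (hΨ : Ψ ∈ IsManifold.maximalAtlas 𝓘(ℝ, Plane) ∞ M) {A : Set M} (hA : MeasurableSet A)
    (h1 : A ⊆ Φ.source) (h2 : A ⊆ Ψ.source) : chartVolume g Φ A = chartVolume g Ψ A := by
  rw [chartVolume_apply g Φ hA, chartVolume_apply g Ψ hA]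
  have him : Ψ.target ∩ Ψ.symm ⁻¹' A = (Ψ ∘ Φ.symm) '' (Φ.target ∩ Φ.symm ⁻¹' A) := by
    ext y
    constructor
    · rintro ⟨hy, hyA⟩
      refine ⟨Φ (Ψ.symm y), ⟨Φ.map_source (h1 hyA), ?_⟩, ?_⟩
      · simpa [Φ.left_inv (h1 hyA)] using hyA
      · simp [Φ.left_inv (h1 hyA), Ψ.right_inv hy]
    · rintro ⟨x, ⟨hx, hxA⟩, rfl⟩
      have := h2 hxA
      refine ⟨Ψ.map_source this, ?_⟩
      simpa [Ψ.left_inv this] using hxA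
  have hprop := fun x (hx : x ∈ Φ.target ∩ Φ.symm ⁻¹' A) =>
    transition_properties hΦ hΨ hx.1 (h2 hx.2)
  rw [him, lintegral_image_eq_lintegral_abs_det_fderiv_mul volume
    (measurableSet_chart_preimage Φ hA) (f' := fun x => fderiv ℝ (Ψ ∘ Φ.symm) x)
    (fun x hx => (hprop x hx).1.hasFDerivAt.hasFDerivWithinAt)]
  · refine setLIntegral_congr_fun (measurableSet_chart_preimage Φ hA) fun x hx => ?_
    obtain ⟨a, b, c⟩ := hprop x hx
    rw [volDensity_comp g hΨ a b c, ENNReal.ofReal_mul (abs_nonneg _)]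
  · intro x hx y hy hxy
    have := Ψ.injOn (h2 hx.2) (h2 hy.2) hxy
    exact Φ.symm.injOn hx.1 hy.1 this

/-- A supremum of measures is not computed setwise. It is compared with an explicit upper bound that
has the desired values on subsets of a chart domain. -/
theorem riemannianVolume_apply [CompactSpace M] (g : Metric M)
    {Φ : OpenPartialHomeomorph M Plane} (hΦ : Φ ∈ IsManifold.maximalAtlas 𝓘(ℝ, Plane) ∞ M)
    {A : Set M} (hA : MeasurableSet A) (hAΦ : A ⊆ Φ.source) :
    riemannianVolume g A = chartVolume g Φ A := by
  rcases A.eq_empty_or_nonempty with rfl | ⟨p₀, -⟩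
  · simp
  have hle : ∀ Ψ ∈ IsManifold.maximalAtlas 𝓘(ℝ, Plane) ∞ M,
      chartVolume g Ψ ≤ riemannianVolume g := fun Ψ hΨ => le_iSup₂_of_le Ψ hΨ le_rfl
  obtain ⟨t, ht⟩ := isCompact_univ.elim_nhds_subcover (fun p : M => (chartAt Plane p).source)
    (fun p _ => chart_source_mem_nhds Plane p)
  have : Nonempty M := ⟨p₀⟩
  obtain ⟨e, he⟩ : ∃ e : ℕ → M, ⋃ n, (chartAt Plane (e n)).source = univ := by
    have htn : (t : Set M).Nonempty := by
      obtain ⟨i, hi, -⟩ := mem_iUnion₂.1 (ht.2 (mem_univ p₀))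
      exact ⟨i, hi⟩
    obtain ⟨e, he⟩ := t.countable_toSet.exists_eq_range htn
    refine ⟨e, eq_univ_of_forall fun p => ?_⟩
    obtain ⟨i, hi, hp⟩ := mem_iUnion₂.1 (ht.2 (mem_univ p))
    obtain ⟨n, rfl⟩ : i ∈ range e := he ▸ hi
    exact mem_iUnion.2 ⟨n, hp⟩
  set D : ℕ → Set M := disjointed fun n => (chartAt Plane (e n)).source with hD
  have hDm : ∀ n, MeasurableSet (D n) := fun n =>
    MeasurableSet.disjointed (fun n => (chartAt Plane (e n)).open_source.measurableSet) n
  have hDd : Pairwise (Function.onFun Disjoint D) := disjoint_disjointed _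
  have hDu : ⋃ n, D n = univ := by rw [hD, iUnion_disjointed, he]
  -- The chart measures are glued along a countable disjoint refinement of a chart cover. Since
  -- chart measures agree on overlaps, `ν` agrees with each of them on its own domain, so it
  -- dominates them all.
  set ν : Measure M :=
    Measure.sum fun n => (chartVolume g (chartAt Plane (e n))).restrict (D n) with hν
  have hνeq : ∀ Ψ ∈ IsManifold.maximalAtlas 𝓘(ℝ, Plane) ∞ M, ∀ B : Set M, MeasurableSet B →
      B ⊆ Ψ.source → ν B = chartVolume g Ψ B := by
    intro Ψ hΨ B hB hBΨ
    rw [hν, Measure.sum_apply _ hB]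
    have : B = ⋃ n, B ∩ D n := by rw [← inter_iUnion, hDu, inter_univ]
    conv_rhs => rw [this]
    rw [measure_iUnion (fun i j hij => (hDd hij).mono inter_subset_right inter_subset_right)
      (fun n => hB.inter (hDm n))]
    refine tsum_congr fun n => ?_
    rw [Measure.restrict_apply hB]
    exact chartVolume_eq_of_subset g (IsManifold.chart_mem_maximalAtlas _) hΨ (hB.inter (hDm n))
      (inter_subset_right.trans (disjointed_subset _ n)) (inter_subset_left.trans hBΨ)
  have hνle : riemannianVolume g ≤ ν := by
    refine iSup₂_le fun Ψ hΨ => Measure.le_iff.2 fun B hB => ?_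
    rw [← chartVolume_inter_source g Ψ hB, ← hνeq Ψ hΨ _ (hB.inter Ψ.open_source.measurableSet)
      inter_subset_right]
    exact measure_mono inter_subset_left
  refine le_antisymm ?_ (hle Φ hΦ A)
  rw [← hνeq Φ hΦ A hA hAΦ]
  exact hνle A

theorem chartVolume_le (g : Metric M) {Φ : OpenPartialHomeomorph M Plane}
    (hΦ : Φ ∈ IsManifold.maximalAtlas 𝓘(ℝ, Plane) ∞ M) :
    chartVolume g Φ ≤ riemannianVolume g := le_iSup₂_of_le Φ hΦ le_rfl

theorem riemannianVolume_restrict [CompactSpace M] (g : Metric M)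
    {Φ : OpenPartialHomeomorph M Plane} (hΦ : Φ ∈ IsManifold.maximalAtlas 𝓘(ℝ, Plane) ∞ M) :
    (riemannianVolume g).restrict Φ.source = chartVolume g Φ := by
  ext A hA
  rw [Measure.restrict_apply hA,
    riemannianVolume_apply g hΦ (hA.inter Φ.open_source.measurableSet) inter_subset_right,
    chartVolume_inter_source g Φ hA]

/-- A compact neighbourhood inside a chart domain has finite volume because the density is
continuous on its compact image; compactness of `M` does the rest. -/
theorem isFiniteMeasure_riemannianVolume [CompactSpace M] [T2Space M] (g : Metric M) :
    IsFiniteMeasure (riemannianVolume g) := by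
  have : LocallyCompactSpace M := ChartedSpace.locallyCompactSpace Plane M
  have : IsLocallyFiniteMeasure (riemannianVolume g) := by
    refine ⟨fun p => ?_⟩
    obtain ⟨K, hK, hKs, hKc⟩ := local_compact_nhds (chart_source_mem_nhds Plane p)
    refine ⟨K, hK, ?_⟩
    have hmem := IsManifold.chart_mem_maximalAtlas (I := 𝓘(ℝ, Plane)) (n := ∞) p
    rw [riemannianVolume_apply g hmem hKc.measurableSet hKs,
      chartVolume_apply g _ hKc.measurableSet]
    set Φ := chartAt Plane p
    have him : Φ.target ∩ Φ.symm ⁻¹' K = Φ '' K := by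
      rw [Φ.image_eq_target_inter_inv_preimage hKs]
    have hcomp : IsCompact (Φ '' K) := hKc.image_of_continuousOn (Φ.continuousOn.mono hKs)
    rw [him]
    have hc : ContinuousOn (volDensity g Φ) (Φ '' K) :=
      (volDensity_contDiffOn g hmem).continuousOn.mono (by rw [← him]; exact inter_subset_left)
    have hi : IntegrableOn (volDensity g Φ) (Φ '' K) := hc.integrableOn_compact hcomp
    exact hi.lintegral_lt_top
  infer_instance

/-- Integration over a coordinate domain. -/
theorem integral_chartVolume (g : Metric M) {Φ : OpenPartialHomeomorph M Plane}
    (hΦ : Φ ∈ IsManifold.maximalAtlas 𝓘(ℝ, Plane) ∞ M) {h : M → ℝ} (hh : Continuous h)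
    [SecondCountableTopology M] :
    ∫ p, h p ∂(chartVolume g Φ) = ∫ x in Φ.target, volDensity g Φ x * h (Φ.symm x) := by
  have hm : AEMeasurable (volDensity g Φ) (volume.restrict Φ.target) :=
    (volDensity_contDiffOn g hΦ).continuousOn.aemeasurable Φ.open_target.measurableSet
  rw [chartVolume, integral_map (aemeasurable_chart_symm g Φ)
    hh.aestronglyMeasurable, integral_withDensity_eq_integral_toReal_smul₀ hm.ennreal_ofReal
    (Filter.Eventually.of_forall fun _ => ENNReal.ofReal_lt_top)]
  refine setIntegral_congr_fun Φ.open_target.measurableSet fun x hx => ?_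
  simp only [smul_eq_mul]
  rw [ENNReal.toReal_ofReal (volDensity_pos g hΦ hx).le]

/-- The integral of a function supported in a coordinate domain. -/
theorem integral_riemannianVolume_of_support [CompactSpace M] (g : Metric M)
    {Φ : OpenPartialHomeomorph M Plane}
    (hΦ : Φ ∈ IsManifold.maximalAtlas 𝓘(ℝ, Plane) ∞ M) {h : M → ℝ} (hh : Continuous h)
    (hs : Function.support h ⊆ Φ.source) [SecondCountableTopology M] :
    ∫ p, h p ∂(riemannianVolume g) =
      ∫ x in Φ.target, volDensity g Φ x * h (Φ.symm x) := by
  rw [← integral_chartVolume g hΦ hh, ← riemannianVolume_restrict g hΦ,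
    setIntegral_eq_integral_of_forall_compl_eq_zero]
  intro p hp
  by_contra h0
  exact hp (hs h0)

/-- The integral of a nonnegative function over a coordinate domain is at most the full one. -/
theorem setIntegral_chart_le [CompactSpace M] [T2Space M] (g : Metric M)
    {Φ : OpenPartialHomeomorph M Plane}
    (hΦ : Φ ∈ IsManifold.maximalAtlas 𝓘(ℝ, Plane) ∞ M) {h : M → ℝ} (hh : Continuous h)
    (h0 : ∀ p, 0 ≤ h p) [SecondCountableTopology M] :
    ∫ x in Φ.target, volDensity g Φ x * h (Φ.symm x) ≤ ∫ p, h p ∂(riemannianVolume g) := by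
  have := isFiniteMeasure_riemannianVolume g
  rw [← integral_chartVolume g hΦ hh]
  exact integral_mono_measure (chartVolume_le g hΦ) (Filter.Eventually.of_forall h0)
    (hh.integrable_of_hasCompactSupport (HasCompactSupport.of_compactSpace h))

/-- The pushed-forward integrand is integrable on the coordinate domain. -/
theorem integrableOn_chart [CompactSpace M] [T2Space M] (g : Metric M)
    {Φ : OpenPartialHomeomorph M Plane}
    (hΦ : Φ ∈ IsManifold.maximalAtlas 𝓘(ℝ, Plane) ∞ M) {h : M → ℝ} (hh : Continuous h)
    [SecondCountableTopology M] :
    IntegrableOn (fun x => volDensity g Φ x * h (Φ.symm x)) Φ.target := by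
  have := isFiniteMeasure_riemannianVolume g
  have h1 : Integrable h (chartVolume g Φ) :=
    (hh.integrable_of_hasCompactSupport (HasCompactSupport.of_compactSpace h)).mono_measure
      (chartVolume_le g hΦ)
  have hm : AEMeasurable (volDensity g Φ) (volume.restrict Φ.target) :=
    (volDensity_contDiffOn g hΦ).continuousOn.aemeasurable Φ.open_target.measurableSet
  rw [chartVolume, integrable_map_measure hh.aestronglyMeasurable (aemeasurable_chart_symm g Φ),
    integrable_withDensity_iff_integrable_smul₀' hm.ennreal_ofReal
    (Filter.Eventually.of_forall fun _ => ENNReal.ofReal_lt_top)] at h1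
  refine IntegrableOn.congr_fun h1 (fun x hx => ?_) Φ.open_target.measurableSet
  simp only [smul_eq_mul, Function.comp]
  rw [ENNReal.toReal_ofReal (volDensity_pos g hΦ hx).le]

end RiemannianVolume

/-! ### Compactly supported functions on the plane and rules for partial derivatives. -/

section PlaneAnalysis

/-- The open sets `U` and `Kᶜ` cover the plane. All integrands below are regular on a chart range
`U` and cut off inside a compact `K ⊆ U`, so the arbitrary values of `Φ.symm` outside `U` never
matter. -/
theorem continuousOn_of_zero_off {X F : Type*} [TopologicalSpace X] [NormedAddCommGroup F]
    {h : Plane → X → F} {U K : Set Plane} {S : Set X} (hU : IsOpen U) (hK : IsCompact K)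
    (hKU : K ⊆ U)
    (hc : ContinuousOn (Function.uncurry h) (U ×ˢ S)) (h0 : ∀ x ∉ K, ∀ t ∈ S, h x t = 0) :
    ContinuousOn (Function.uncurry h) (univ ×ˢ S) := by
  rintro ⟨x, t⟩ ⟨-, ht⟩
  by_cases hx : x ∈ U
  · refine (hc (x, t) ⟨hx, ht⟩).mono_of_mem_nhdsWithin ?_
    have : U ×ˢ (univ : Set X) ∈ nhds (x, t) := prod_mem_nhds (hU.mem_nhds hx) Filter.univ_mem
    filter_upwards [mem_nhdsWithin_of_mem_nhds this, self_mem_nhdsWithin] with z hz hz'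
    exact ⟨hz.1, hz'.2⟩
  · have hx' : x ∈ Kᶜ := fun h => hx (hKU h)
    have hn : Kᶜ ×ˢ (univ : Set X) ∈ nhds (x, t) :=
      prod_mem_nhds (hK.isClosed.isOpen_compl.mem_nhds hx') Filter.univ_mem
    have : Function.uncurry h =ᶠ[nhdsWithin (x, t) (univ ×ˢ S)] fun _ => 0 := by
      filter_upwards [mem_nhdsWithin_of_mem_nhds hn, self_mem_nhdsWithin] with z hz hz'
      exact h0 z.1 hz.1 z.2 hz'.2
    exact continuousWithinAt_const.congr_of_eventuallyEq this (h0 x hx' t ht)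

theorem contDiff_of_zero_off {F : Type*} [NormedAddCommGroup F] [NormedSpace ℝ F]
    {h : Plane → F} {n : ℕ∞ω} {U K : Set Plane} (hU : IsOpen U) (hK : IsCompact K)
    (hKU : K ⊆ U) (hc : ContDiffOn ℝ n h U) (h0 : ∀ x ∉ K, h x = 0) : ContDiff ℝ n h := by
  rw [contDiff_iff_contDiffAt]
  intro x
  by_cases hx : x ∈ U
  · exact hc.contDiffAt (hU.mem_nhds hx)
  · have hx' : x ∈ Kᶜ := fun h => hx (hKU h)
    have : h =ᶠ[nhds x] fun _ => 0 := by
      filter_upwards [hK.isClosed.isOpen_compl.mem_nhds hx'] with z hz using h0 z hz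
    exact contDiffAt_const.congr_of_eventuallyEq this

theorem continuous_of_zero_off {F : Type*} [NormedAddCommGroup F] [NormedSpace ℝ F]
    {h : Plane → F} {U K : Set Plane} (hU : IsOpen U) (hK : IsCompact K)
    (hKU : K ⊆ U) (hc : ContinuousOn h U) (h0 : ∀ x ∉ K, h x = 0) : Continuous h :=
  contDiff_zero.1 (contDiff_of_zero_off hU hK hKU (contDiffOn_zero.2 hc) h0)

theorem integrable_of_zero_off {F : Type*} [NormedAddCommGroup F] [NormedSpace ℝ F]
    {h : Plane → F} {U K : Set Plane} (hU : IsOpen U) (hK : IsCompact K)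
    (hKU : K ⊆ U) (hc : ContinuousOn h U) (h0 : ∀ x ∉ K, h x = 0) : Integrable h :=
  (continuous_of_zero_off hU hK hKU hc h0).integrable_of_hasCompactSupport
    (HasCompactSupport.intro hK h0)

theorem partialD_eq_zero_off {F : Type*} [NormedAddCommGroup F] [NormedSpace ℝ F]
    {h : Plane → F} {K : Set Plane} (hK : IsCompact K) (h0 : ∀ x ∉ K, h x = 0) (i : Fin 2)
    {x : Plane} (hx : x ∉ K) : partialD i h x = 0 := by
  have : h =ᶠ[nhds x] fun _ => 0 := by
    filter_upwards [hK.isClosed.isOpen_compl.mem_nhds hx] with z hz using h0 z hz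
  rw [partialD, this.fderiv_eq]
  simp

theorem contDiffOn_partialD {F : Type*} [NormedAddCommGroup F] [NormedSpace ℝ F]
    {h : Plane → F} {m n : ℕ∞ω} {U : Set Plane} (hU : IsOpen U) (hc : ContDiffOn ℝ n h U)
    (hmn : m + 1 ≤ n) (i : Fin 2) : ContDiffOn ℝ m (partialD i h) U :=
  (hc.fderiv_of_isOpen hU hmn).clm_apply contDiffOn_const

/-- Integration by parts against the constant function 1. -/
theorem integral_partialD_eq_zero {V : Plane → ℝ} {K : Set Plane} (hK : IsCompact K)
    (hV : ContDiff ℝ 1 V) (h0 : ∀ x ∉ K, V x = 0) (i : Fin 2) : ∫ x, partialD i V x = 0 := by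
  have hc : Continuous (partialD i V) :=
    ((hV.continuous_fderiv (by norm_num)).clm_apply continuous_const)
  have hi : Integrable (partialD i V) := hc.integrable_of_hasCompactSupport
    (HasCompactSupport.intro hK fun x hx => partialD_eq_zero_off hK h0 i hx)
  have hi' : Integrable V := hV.continuous.integrable_of_hasCompactSupport
    (HasCompactSupport.intro hK h0)
  have := integral_mul_fderiv_eq_neg_fderiv_mul_of_integrable (μ := (volume : Measure Plane))
    (f := fun _ => (1 : ℝ)) (g := V) (v := basisVec i) (by simp)
    (by simp only [one_mul]; exact hi) (by simpa using hi') (by simp)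
    (fun x _ => (hV.differentiable (by norm_num)) x)
  simpa [partialD] using this

section Rules

variable {F : Type*} [NormedAddCommGroup F] [InnerProductSpace ℝ F] {x : Plane}

theorem partialD_mul {f h : Plane → ℝ} (hf : DifferentiableAt ℝ f x) (hh : DifferentiableAt ℝ h x)
    (i : Fin 2) :
    partialD i (fun z => f z * h z) x = partialD i f x * h x + f x * partialD i h x := by
  simp only [partialD]
  rw [fderiv_fun_mul hf hh]
  simp
  ring

theorem partialD_smul {f : Plane → ℝ} {h : Plane → F} (hf : DifferentiableAt ℝ f x)
    (hh : DifferentiableAt ℝ h x) (i : Fin 2) :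
    partialD i (fun z => f z • h z) x = partialD i f x • h x + f x • partialD i h x := by
  simp only [partialD]
  rw [fderiv_fun_smul hf hh]
  simp [add_comm]

theorem partialD_add {f h : Plane → F} (hf : DifferentiableAt ℝ f x)
    (hh : DifferentiableAt ℝ h x) (i : Fin 2) :
    partialD i (fun z => f z + h z) x = partialD i f x + partialD i h x := by
  simp only [partialD]
  rw [fderiv_fun_add hf hh]
  simp

theorem partialD_sub {f h : Plane → F} (hf : DifferentiableAt ℝ f x)
    (hh : DifferentiableAt ℝ h x) (i : Fin 2) :
    partialD i (fun z => f z - h z) x = partialD i f x - partialD i h x := by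
  simp only [partialD]
  rw [fderiv_fun_sub hf hh]
  simp

theorem partialD_sum {f : Fin 2 → Plane → F} (hf : ∀ j, DifferentiableAt ℝ (f j) x) (i : Fin 2) :
    partialD i (fun z => ∑ j, f j z) x = ∑ j, partialD i (f j) x := by
  simp only [Fin.sum_univ_two]
  exact partialD_add (hf 0) (hf 1) i

theorem partialD_inner {f h : Plane → F} (hf : DifferentiableAt ℝ f x)
    (hh : DifferentiableAt ℝ h x) (i : Fin 2) :
    partialD i (fun z => inner ℝ (f z) (h z)) x =
      inner ℝ (partialD i f x) (h x) + inner ℝ (f x) (partialD i h x) := by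
  simp only [partialD]
  rw [fderiv_inner_apply ℝ hf hh, add_comm]

theorem partialD_coord (i j : Fin 2) (x : Plane) :
    partialD i (fun z : Plane => z j) x = if i = j then 1 else 0 := by
  have : (fun z : Plane => z j) = (EuclideanSpace.proj j : Plane →L[ℝ] ℝ) := rfl
  rw [partialD, this, ContinuousLinearMap.fderiv]
  simp [basisVec, eq_comm]

theorem differentiable_coord (j : Fin 2) : Differentiable ℝ (fun z : Plane => z j) :=
  (EuclideanSpace.proj j : Plane →L[ℝ] ℝ).differentiable

theorem contDiff_coord {n : ℕ∞ω} (j : Fin 2) : ContDiff ℝ n (fun z : Plane => z j) :=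
  (EuclideanSpace.proj j : Plane →L[ℝ] ℝ).contDiff

theorem partialD_comm {f : Plane → F} (hf : ContDiffAt ℝ 2 f x) (i j : Fin 2) :
    partialD i (partialD j f) x = partialD j (partialD i f) x := by
  have hs : IsSymmSndFDerivAt ℝ f x := hf.isSymmSndFDerivAt (by simp)
  have hd : DifferentiableAt ℝ (fderiv ℝ f) x :=
    (hf.fderiv_right (m := 1) (by norm_num)).differentiableAt (by norm_num)
  have key : ∀ a b : Fin 2, partialD a (partialD b f) x =
      fderiv ℝ (fderiv ℝ f) x (basisVec a) (basisVec b) := by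
    intro a b
    have : partialD b f = fun z => fderiv ℝ f z (basisVec b) := rfl
    rw [this, partialD, fderiv_clm_apply hd (differentiableAt_const _)]
    simp
  rw [key, key]
  exact hs.eq _ _

end Rules

/-! ### Integral identities on the plane for a divergence form operator -/

section Identities

variable {k : ℕ}

/-- The flux `a^{ij} ∂_j v`. -/
def flux (a : Fin 2 → Fin 2 → Plane → ℝ) (v : Plane → Euc k) (i : Fin 2) (x : Plane) : Euc k :=
  ∑ j, a i j x • partialD j v x

/-- The quadratic expression `a^{ij} ⟨∂_i v, ∂_j v⟩`. -/
def quadGrad (a : Fin 2 → Fin 2 → Plane → ℝ) (v : Plane → Euc k) (x : Plane) : ℝ :=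
  ∑ i, ∑ j, a i j x * inner ℝ (partialD i v x) (partialD j v x)

/-- The radial derivative `x^k ∂_k v`. -/
def radialD {F : Type*} [NormedAddCommGroup F] [NormedSpace ℝ F] (v : Plane → F) (x : Plane) : F :=
  ∑ i, x i • partialD i v x

variable {a : Fin 2 → Fin 2 → Plane → ℝ} {v w : Plane → Euc k} {m : Plane → ℝ} {η : Plane → ℝ}
  {U K : Set Plane} {S : Plane → Euc k}

theorem contDiffOn_flux (hU : IsOpen U) (ha : ∀ i j, ContDiffOn ℝ ∞ (a i j) U)
    (hv : ContDiffOn ℝ ∞ v U) (i : Fin 2) : ContDiffOn ℝ ∞ (flux a v i) U := by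
  unfold flux
  exact ContDiffOn.sum fun j _ => (ha i j).smul (contDiffOn_partialD hU hv (by simp) j)

theorem contDiffOn_quadGrad (hU : IsOpen U) (ha : ∀ i j, ContDiffOn ℝ ∞ (a i j) U)
    (hv : ContDiffOn ℝ ∞ v U) : ContDiffOn ℝ ∞ (quadGrad a v) U := by
  unfold quadGrad
  exact ContDiffOn.sum fun i _ => ContDiffOn.sum fun j _ => (ha i j).mul
    ((contDiffOn_partialD hU hv (by simp) i).inner ℝ (contDiffOn_partialD hU hv (by simp) j))

theorem contDiffOn_radialD {F : Type*} [NormedAddCommGroup F] [NormedSpace ℝ F] {v : Plane → F}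
    (hU : IsOpen U) (hv : ContDiffOn ℝ ∞ v U) :
    ContDiffOn ℝ ∞ (radialD v) U := by
  unfold radialD
  exact ContDiffOn.sum fun i _ => (contDiff_coord i).contDiffOn.smul
    (contDiffOn_partialD hU hv (by simp) i)

/-- Testing the equation with `η w`. -/
theorem integral_test_identity (hU : IsOpen U) (hK : IsCompact K) (hKU : K ⊆ U)
    (ha : ∀ i j, ContDiffOn ℝ ∞ (a i j) U) (hv : ContDiffOn ℝ ∞ v U) (hw : ContDiffOn ℝ ∞ w U)
    (hη : ContDiff ℝ 1 η) (hη0 : ∀ x ∉ K, η x = 0)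
    (heq : ∀ x ∈ U, ∑ i, partialD i (flux a v i) x = m x • (w x + S x))
    (hS : ∀ x ∈ U, inner ℝ (S x) (w x) = 0) :
    ∫ x, ((∑ i, partialD i η x * inner ℝ (flux a v i x) (w x)) + η x * m x * ‖w x‖ ^ 2 +
      η x * ∑ i, inner ℝ (flux a v i x) (partialD i w x)) = 0 := by
  have hfl := fun i => contDiffOn_flux hU ha hv i
  -- The field `η ⟨flux_i, w⟩` is compactly supported, so its divergence has integral zero; the
  -- equation replaces the divergence of the flux.
  have hV : ∀ i, ContDiffOn ℝ 1 (fun x => η x * inner ℝ (flux a v i x) (w x)) U := fun i =>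
    hη.contDiffOn.mul (((hfl i).of_le (by simp)).inner ℝ (hw.of_le (by simp)))
  have hV0 : ∀ i, ∀ x ∉ K, (fun x => η x * inner ℝ (flux a v i x) (w x)) x = 0 := by
    intro i x hx
    simp [hη0 x hx]
  have hV' := fun i => contDiff_of_zero_off hU hK hKU (hV i) (hV0 i)
  have hz := fun i => integral_partialD_eq_zero hK (hV' i) (hV0 i) i
  have hsum : ∫ x, ∑ i, partialD i (fun x => η x * inner ℝ (flux a v i x) (w x)) x = 0 := by
    rw [integral_finsetSum]
    · exact Finset.sum_eq_zero fun i _ => hz i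
    · intro i _
      exact integrable_of_zero_off isOpen_univ hK (subset_univ _)
        (contDiffOn_partialD isOpen_univ (m := 0) (hV' i).contDiffOn (by simp) i).continuousOn
        (fun x hx => partialD_eq_zero_off hK (hV0 i) i hx)
  rw [← hsum]
  refine integral_congr_ae (Filter.Eventually.of_forall fun x => ?_)
  by_cases hx : x ∈ U
  · have dη : DifferentiableAt ℝ η x := (hη.differentiable (by simp)) x
    have dfl := fun i => ((hfl i).contDiffAt (hU.mem_nhds hx)).differentiableAt (by simp)
    have dw : DifferentiableAt ℝ w x := (hw.contDiffAt (hU.mem_nhds hx)).differentiableAt (by simp)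
    have h1 : ∀ i, partialD i (fun x => η x * inner ℝ (flux a v i x) (w x)) x =
        partialD i η x * inner ℝ (flux a v i x) (w x) +
        η x * (inner ℝ (partialD i (flux a v i) x) (w x) +
          inner ℝ (flux a v i x) (partialD i w x)) := by
      intro i
      rw [partialD_mul dη ((dfl i).inner ℝ dw), partialD_inner (dfl i) dw]
    have h2 := congrArg (fun q => inner ℝ q (w x)) (heq x hx)
    simp only [Fin.sum_univ_two, inner_add_left, inner_smul_left, hS x hx,
      real_inner_self_eq_norm_sq] at h2
    simp only [h1, Fin.sum_univ_two]
    simp at h2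
    linear_combination (-η x) * h2
  · have hxK : x ∉ K := fun h => hx (hKU h)
    simp only [partialD_eq_zero_off hK (hV0 _) _ hxK, partialD_eq_zero_off hK hη0 _ hxK, hη0 x hxK]
    simp

/-- The Pohozaev identity: testing the equation with `ζ x^k ∂_k v`. -/
theorem integral_pohozaev {ζ : Plane → ℝ} (hU : IsOpen U) (hK : IsCompact K) (hKU : K ⊆ U)
    (ha : ∀ i j, ContDiffOn ℝ ∞ (a i j) U) (hsymm : ∀ i j x, a i j x = a j i x)
    (hv : ContDiffOn ℝ ∞ v U)
    (hζ : ContDiff ℝ 1 ζ) (hζ0 : ∀ x ∉ K, ζ x = 0)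
    (heq : ∀ x ∈ U, ∑ i, partialD i (flux a v i) x = m x • (w x + S x))
    (hS : ∀ x ∈ U, ∀ i, inner ℝ (S x) (partialD i v x) = 0) :
    ∫ x, (ζ x * m x * inner ℝ (w x) (radialD v x) +
      (∑ i, partialD i ζ x * inner ℝ (flux a v i x) (radialD v x)) -
      1 / 2 * radialD ζ x * quadGrad a v x -
      1 / 2 * ζ x * quadGrad (fun i j => radialD (a i j)) v x) = 0 := by
  have hfl := fun i => contDiffOn_flux hU ha hv i
  have hq := contDiffOn_quadGrad hU ha hv
  have hr := contDiffOn_radialD hU hv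
  -- This is `ζ` times the stress tensor contracted with the radial field. Differentiating `x·∇v`
  -- produces `ζ Q`, and `-½ ζ Q div x` is `-ζ Q` in dimension two, so these terms cancel and only
  -- derivatives of `ζ` and of the coefficients remain.
  have hV : ∀ i : Fin 2, ContDiffOn ℝ 1 (fun x : Plane => ζ x *
      (inner ℝ (flux a v i x) (radialD v x) - 1 / 2 * (x i * quadGrad a v x))) U := fun i =>
    hζ.contDiffOn.mul ((((hfl i).of_le (by simp)).inner ℝ (hr.of_le (by simp))).sub
      (contDiffOn_const.mul ((contDiff_coord i).contDiffOn.mul (hq.of_le (by simp)))))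
  have hV0 : ∀ i : Fin 2, ∀ x ∉ K, (fun x : Plane => ζ x *
      (inner ℝ (flux a v i x) (radialD v x) - 1 / 2 * (x i * quadGrad a v x))) x = 0 := by
    intro i x hx
    simp [hζ0 x hx]
  have hV' := fun i => contDiff_of_zero_off hU hK hKU (hV i) (hV0 i)
  have hz := fun i => integral_partialD_eq_zero hK (hV' i) (hV0 i) i
  have hsum : ∫ x, ∑ i, partialD i (fun x : Plane => ζ x *
      (inner ℝ (flux a v i x) (radialD v x) - 1 / 2 * (x i * quadGrad a v x))) x = 0 := by
    rw [integral_finsetSum]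
    · exact Finset.sum_eq_zero fun i _ => hz i
    · intro i _
      exact integrable_of_zero_off isOpen_univ hK (subset_univ _)
        (contDiffOn_partialD isOpen_univ (m := 0) (hV' i).contDiffOn (by simp) i).continuousOn
        (fun x hx => partialD_eq_zero_off hK (hV0 i) i hx)
  rw [← hsum]
  refine integral_congr_ae (Filter.Eventually.of_forall fun x => ?_)
  by_cases hx : x ∈ U
  · have dζ : DifferentiableAt ℝ ζ x := (hζ.differentiable (by simp)) x
    have dfl := fun i => ((hfl i).contDiffAt (hU.mem_nhds hx)).differentiableAt (by simp)
    have dq := (hq.contDiffAt (hU.mem_nhds hx)).differentiableAt (by simp)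
    have dr := (hr.contDiffAt (hU.mem_nhds hx)).differentiableAt (by simp)
    have da := fun i j => ((ha i j).contDiffAt (hU.mem_nhds hx)).differentiableAt (by simp)
    have dp : ∀ j, DifferentiableAt ℝ (partialD j v) x := fun j =>
      ((contDiffOn_partialD (m := ∞) hU hv (by simp) j).contDiffAt
        (hU.mem_nhds hx)).differentiableAt (by simp)
    have hcomm := fun i j => partialD_comm
      ((hv.contDiffAt (hU.mem_nhds hx)).of_le ENat.LEInfty.out) i j
    have h1 : ∀ i : Fin 2, partialD i (fun x : Plane => ζ x *
        (inner ℝ (flux a v i x) (radialD v x) - 1 / 2 * (x i * quadGrad a v x))) x =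
        partialD i ζ x * (inner ℝ (flux a v i x) (radialD v x) - 1 / 2 * (x i * quadGrad a v x)) +
        ζ x * ((inner ℝ (partialD i (flux a v i) x) (radialD v x) +
          inner ℝ (flux a v i x) (partialD i (radialD v) x)) -
          1 / 2 * (quadGrad a v x + x i * partialD i (quadGrad a v) x)) := by
      intro i
      have dc := (differentiable_coord i) x
      have e2 : partialD i (fun z : Plane => 1 / 2 * (z i * quadGrad a v z)) x =
          1 / 2 * (quadGrad a v x + x i * partialD i (quadGrad a v) x) := by
        have := partialD_mul (differentiableAt_const (1 / 2 : ℝ)) (dc.fun_mul dq) i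
        rw [this, partialD_mul dc dq, partialD_coord]
        simp [partialD]
      rw [partialD_mul dζ (((dfl i).inner ℝ dr).fun_sub ((dc.fun_mul dq).const_mul _)),
        partialD_sub ((dfl i).inner ℝ dr) ((dc.fun_mul dq).const_mul _),
        partialD_inner (dfl i) dr, e2]
    have h2 := congrArg (fun q => inner ℝ q (radialD v x)) (heq x hx)
    have hSr : inner ℝ (S x) (radialD v x) = 0 := by
      simp [radialD, Fin.sum_univ_two, inner_add_right, inner_smul_right, hS x hx]
    have hrad : ∀ i, partialD i (radialD v) x =
        partialD i v x + ∑ l, x l • partialD i (partialD l v) x := by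
      intro i
      unfold radialD
      rw [partialD_sum (fun l => ((differentiable_coord l) x).fun_smul (dp l))]
      simp_rw [partialD_smul ((differentiable_coord _) x) (dp _), partialD_coord]
      fin_cases i <;> simp [Fin.sum_univ_two] <;> abel
    have hquad : ∀ l, partialD l (quadGrad a v) x = ∑ i, ∑ j,
        (partialD l (a i j) x * inner ℝ (partialD i v x) (partialD j v x) +
          a i j x * (inner ℝ (partialD l (partialD i v) x) (partialD j v x) +
            inner ℝ (partialD i v x) (partialD l (partialD j v) x))) := by
      intro l
      unfold quadGrad
      have d1 := fun i j => (da i j).fun_mul ((dp i).inner ℝ (dp j))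
      rw [partialD_sum (fun i => DifferentiableAt.fun_sum fun j _ => d1 i j)]
      refine Finset.sum_congr rfl fun i _ => ?_
      rw [partialD_sum (fun j => d1 i j)]
      refine Finset.sum_congr rfl fun j _ => ?_
      rw [partialD_mul (da i j) ((dp i).inner ℝ (dp j)), partialD_inner (dp i) (dp j)]
    simp only [Fin.sum_univ_two, inner_add_left, inner_smul_left, hSr] at h2
    simp only [h1, Fin.sum_univ_two, hrad, hquad]
    simp only [RCLike.conj_to_real, add_zero] at h2
    have e1 := hsymm 1 0 x
    have e2 := hcomm 1 0
    have e3 : ∀ l, partialD l (a 1 0) x = partialD l (a 0 1) x := by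
      intro l
      have : a 1 0 = a 0 1 := funext fun z => hsymm 1 0 z
      rw [this]
    have hA : ζ x * (inner ℝ (partialD 0 (flux a v 0) x) (radialD v x) +
        inner ℝ (partialD 1 (flux a v 1) x) (radialD v x)) =
        ζ x * (m x * inner ℝ (w x) (radialD v x)) := by rw [h2]
    -- The second-order sum on the right occurs twice in `x·∇Q`, by symmetry of `a`; the factor `-½`
    -- in the field therefore removes it.
    have hB : inner ℝ (flux a v 0 x) (partialD 0 v x + (x 0 • partialD 0 (partialD 0 v) x +
        x 1 • partialD 0 (partialD 1 v) x)) + inner ℝ (flux a v 1 x) (partialD 1 v x +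
        (x 0 • partialD 1 (partialD 0 v) x + x 1 • partialD 1 (partialD 1 v) x)) =
        quadGrad a v x + (∑ l, ∑ i, ∑ j, x l * (a i j x *
          inner ℝ (partialD l (partialD i v) x) (partialD j v x))) := by
      simp only [flux, quadGrad, Fin.sum_univ_two, inner_add_left, inner_add_right,
        inner_smul_left, inner_smul_right, RCLike.conj_to_real, e1, e2,
        real_inner_comm (partialD 0 v x) (partialD 1 v x),
        real_inner_comm (partialD _ v x) (partialD _ (partialD _ v) x)]
      ring
    simp only [Fin.sum_univ_two] at hB
    simp only [radialD, Fin.sum_univ_two, smul_eq_mul] at hA ⊢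
    have hQ' : quadGrad (fun i j => radialD (a i j)) v x
        = ∑ i, ∑ j, (x 0 * partialD 0 (a i j) x + x 1 * partialD 1 (a i j) x) *
          inner ℝ (partialD i v x) (partialD j v x) := by
      simp only [quadGrad, radialD, Fin.sum_univ_two, smul_eq_mul]
    rw [hQ']
    simp only [Fin.sum_univ_two]
    simp only [real_inner_comm (partialD _ (partialD _ v) x) (partialD _ v x)] at hB ⊢
    simp only [e1, e2, e3] at hB ⊢
    linear_combination (-1) * hA - ζ x * hB
  · have hxK : x ∉ K := fun h => hx (hKU h)
    have e1 : radialD ζ x = 0 := by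
      simp [radialD, partialD_eq_zero_off hK hζ0 _ hxK]
    beta_reduce
    rw [Finset.sum_eq_zero fun i _ => partialD_eq_zero_off hK (hV0 i) i hxK]
    simp [partialD_eq_zero_off hK hζ0 _ hxK, hζ0 x hxK, e1]

end Identities

end PlaneAnalysis

/-! ### Time derivatives of localized integrals and local solutions in divergence form. -/

section TimeDependent

/-- The time derivative is bounded on `K` times a short closed time interval and vanishes off `K`;
this constant on `K` is the dominating function. -/
theorem hasDerivAt_integral_of_zero_off {h h' : Plane → ℝ → ℝ} {U K : Set Plane} {a b t : ℝ}
    (hU : IsOpen U) (hK : IsCompact K) (hKU : K ⊆ U) (ht : t ∈ Ioo a b)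
    (hd : ∀ x ∈ U, ∀ τ ∈ Ioo a b, HasDerivAt (h x) (h' x τ) τ)
    (hc : ContinuousOn (Function.uncurry h) (U ×ˢ Ioo a b))
    (hc' : ContinuousOn (Function.uncurry h') (U ×ˢ Ioo a b))
    (h0 : ∀ x ∉ K, ∀ τ ∈ Ioo a b, h x τ = 0) (h0' : ∀ x ∉ K, ∀ τ ∈ Ioo a b, h' x τ = 0) :
    HasDerivAt (fun τ => ∫ x, h x τ) (∫ x, h' x t) t := by
  have slice : ∀ {q : Plane → ℝ → ℝ}, ContinuousOn (Function.uncurry q) (U ×ˢ Ioo a b) →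
      (∀ x ∉ K, ∀ τ ∈ Ioo a b, q x τ = 0) → ∀ τ ∈ Ioo a b, Integrable (fun x => q x τ) := by
    intro q hq hq0 τ hτ
    refine integrable_of_zero_off hU hK hKU ?_ (fun x hx => hq0 x hx τ hτ)
    exact hq.comp (f := fun x => (x, τ)) (by fun_prop) (fun x hx => ⟨hx, hτ⟩)
  obtain ⟨ε, hε, hεs⟩ := Metric.isOpen_iff.1 isOpen_Ioo t ht
  have hIcc : Metric.closedBall t (ε / 2) ⊆ Ioo a b :=
    (Metric.closedBall_subset_ball (by linarith)).trans hεs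
  obtain ⟨B, hB⟩ := (hK.prod (isCompact_closedBall t (ε / 2))).exists_bound_of_continuousOn
    (hc'.mono (prod_mono hKU hIcc))
  refine (hasDerivAt_integral_of_dominated_loc_of_deriv_le (F := fun τ x => h x τ)
    (F' := fun τ x => h' x τ) (bound := K.indicator fun _ => B)
    (Metric.closedBall_mem_nhds t (by linarith : 0 < ε / 2)) ?_ (slice hc h0 t ht)
    (slice hc' h0' t ht).aestronglyMeasurable ?_ ?_ ?_).2
  · filter_upwards [isOpen_Ioo.mem_nhds ht] with τ hτ using (slice hc h0 τ hτ).aestronglyMeasurable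
  · refine Filter.Eventually.of_forall fun x τ hτ => ?_
    by_cases hx : x ∈ K
    · rw [indicator_of_mem hx]
      exact hB (x, τ) ⟨hx, hτ⟩
    · rw [h0' x hx τ (hIcc hτ), indicator_of_notMem hx, norm_zero]
  · exact (integrable_indicator_iff hK.measurableSet).2
      (integrableOn_const hK.measure_lt_top.ne)
  · refine Filter.Eventually.of_forall fun x τ hτ => ?_
    by_cases hx : x ∈ U
    · exact hd x hx τ (hIcc hτ)
    · have hxK : x ∉ K := fun h => hx (hKU h)
      rw [h0' x hxK τ (hIcc hτ)]
      refine (hasDerivAt_const τ (0 : ℝ)).congr_of_eventuallyEq ?_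
      filter_upwards [isOpen_Ioo.mem_nhds (hIcc hτ)] with σ hσ using h0 x hxK σ hσ

section Regularity

variable {F : Type*} [NormedAddCommGroup F] [NormedSpace ℝ F] {f : Plane → ℝ → F}
  {U : Set Plane} {I : Set ℝ}

theorem _root_.HasFDerivAt.slice_left {H : Plane × ℝ → F} {L : Plane × ℝ →L[ℝ] F} {x : Plane}
    {t : ℝ} (h : HasFDerivAt H L (x, t)) :
    HasFDerivAt (fun y => H (y, t)) (L.comp (ContinuousLinearMap.inl ℝ Plane ℝ)) x :=
  HasFDerivAt.comp (f := fun y : Plane => (y, t)) x h (hasFDerivAt_prodMk_left x t)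

theorem _root_.HasFDerivAt.slice_right {H : Plane × ℝ → F} {L : Plane × ℝ →L[ℝ] F} {x : Plane}
    {t : ℝ} (h : HasFDerivAt H L (x, t)) : HasDerivAt (fun τ => H (x, τ)) (L (0, 1)) t := by
  have h1 : HasFDerivAt (fun τ => H (x, τ)) (L.comp (ContinuousLinearMap.inr ℝ Plane ℝ)) t :=
    HasFDerivAt.comp (f := fun τ : ℝ => (x, τ)) t h (hasFDerivAt_prodMk_right x t)
  simpa using h1.hasDerivAt

theorem contDiffOn_slice (hf : ContDiffOn ℝ ∞ (Function.uncurry f) (U ×ˢ I)) {t : ℝ}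
    (ht : t ∈ I) : ContDiffOn ℝ ∞ (fun x => f x t) U :=
  hf.comp (f := fun x => (x, t)) (by fun_prop) (fun x hx => ⟨hx, ht⟩)

/-- The time set may be half-open, like `Ico 0 T`, where joint smoothness is one-sided. The spatial
derivative is therefore read off from the derivative within `U ×ˢ I`, and it is a true derivative
because `U` is open. -/
theorem continuousOn_partialD_slice (hU : IsOpen U) (hI : UniqueDiffOn ℝ I)
    (hf : ContDiffOn ℝ ∞ (Function.uncurry f) (U ×ˢ I)) (i : Fin 2) :
    ContinuousOn (Function.uncurry fun x t => partialD i (fun y => f y t) x) (U ×ˢ I) := by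
  have hS : UniqueDiffOn ℝ (U ×ˢ I) := hU.uniqueDiffOn.prod hI
  have h1 := (hf.continuousOn_fderivWithin hS (by simp)).clm_apply
    (continuousOn_const (c := ((basisVec i, 0) : Plane × ℝ)))
  refine h1.congr ?_
  rintro ⟨x, t⟩ ⟨hx, ht⟩
  have hd : HasFDerivWithinAt (Function.uncurry f)
      (fderivWithin ℝ (Function.uncurry f) (U ×ˢ I) (x, t)) (U ×ˢ I) (x, t) :=
    ((hf.differentiableOn (by simp)) (x, t) ⟨hx, ht⟩).hasFDerivWithinAt
  have hg : HasFDerivWithinAt (fun y : Plane => (y, t))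
      (ContinuousLinearMap.inl ℝ Plane ℝ) U x := (hasFDerivAt_prodMk_left x t).hasFDerivWithinAt
  have hmaps : MapsTo (fun y : Plane => (y, t)) U (U ×ˢ I) := fun y hy => ⟨hy, ht⟩
  have := (HasFDerivWithinAt.comp x hd hg hmaps).hasFDerivAt (hU.mem_nhds hx)
  have h2 : fderiv ℝ (fun y => f y t) x = _ := this.fderiv
  simp only [Function.uncurry, partialD]
  rw [h2]
  rfl

theorem contDiffOn_partialD_joint (hU : IsOpen U) (hI : IsOpen I)
    (hf : ContDiffOn ℝ ∞ (Function.uncurry f) (U ×ˢ I)) (i : Fin 2) :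
    ContDiffOn ℝ ∞ (Function.uncurry fun x t => partialD i (fun y => f y t) x) (U ×ˢ I) := by
  have h1 := (hf.fderiv_of_isOpen (m := ∞) (hU.prod hI) (by simp)).clm_apply
    (contDiffOn_const (c := ((basisVec i, 0) : Plane × ℝ)))
  refine h1.congr ?_
  rintro ⟨x, t⟩ hxt
  have hd : HasFDerivAt (Function.uncurry f) _ (x, t) :=
    ((hf.contDiffAt ((hU.prod hI).mem_nhds hxt)).differentiableAt (by simp)).hasFDerivAt
  have h2 : fderiv ℝ (fun y => f y t) x = _ :=
    hd.slice_left.fderiv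
  simp only [Function.uncurry, partialD]
  rw [h2]
  rfl

theorem hasDerivAt_slice (hU : IsOpen U) (hI : IsOpen I)
    (hf : ContDiffOn ℝ ∞ (Function.uncurry f) (U ×ˢ I)) {x : Plane} {t : ℝ} (hx : x ∈ U)
    (ht : t ∈ I) : HasDerivAt (f x) (fderiv ℝ (Function.uncurry f) (x, t) (0, 1)) t := by
  have hd : HasFDerivAt (Function.uncurry f) _ (x, t) :=
    ((hf.contDiffAt ((hU.prod hI).mem_nhds ⟨hx, ht⟩)).differentiableAt (by simp)).hasFDerivAt
  exact hd.slice_right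

theorem contDiffOn_deriv_joint (hU : IsOpen U) (hI : IsOpen I)
    (hf : ContDiffOn ℝ ∞ (Function.uncurry f) (U ×ˢ I)) :
    ContDiffOn ℝ ∞ (Function.uncurry fun x t => deriv (f x) t) (U ×ˢ I) := by
  have h1 := (hf.fderiv_of_isOpen (m := ∞) (hU.prod hI) (by simp)).clm_apply
    (contDiffOn_const (c := ((0, 1) : Plane × ℝ)))
  refine h1.congr ?_
  rintro ⟨x, t⟩ ⟨hx, ht⟩
  exact (hasDerivAt_slice hU hI hf hx ht).deriv

/-- The derivatives in space and time commute. -/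
theorem hasDerivAt_partialD (hU : IsOpen U) (hI : IsOpen I)
    (hf : ContDiffOn ℝ ∞ (Function.uncurry f) (U ×ˢ I)) {x : Plane} {t : ℝ} (hx : x ∈ U)
    (ht : t ∈ I) (i : Fin 2) :
    HasDerivAt (fun τ => partialD i (fun y => f y τ) x)
      (partialD i (fun y => deriv (f y) t) x) t := by
  have hO := hU.prod hI
  have hfx : ContDiffAt ℝ ∞ (Function.uncurry f) (x, t) := hf.contDiffAt (hO.mem_nhds ⟨hx, ht⟩)
  have hs : IsSymmSndFDerivAt ℝ (Function.uncurry f) (x, t) :=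
    hfx.isSymmSndFDerivAt (by rw [minSmoothness_of_isRCLikeNormedField]; exact ENat.LEInfty.out)
  have hd : HasFDerivAt (fderiv ℝ (Function.uncurry f))
      (fderiv ℝ (fderiv ℝ (Function.uncurry f)) (x, t)) (x, t) :=
    ((hfx.fderiv_right (m := 1) (by rw [one_add_one_eq_two]; exact ENat.LEInfty.out)).differentiableAt (by norm_num)).hasFDerivAt
  have h1 : HasDerivAt (fun τ => fderiv ℝ (Function.uncurry f) (x, τ) (basisVec i, 0))
      (fderiv ℝ (fderiv ℝ (Function.uncurry f)) (x, t) (0, 1) (basisVec i, 0)) t := by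
    have h2 := hd.slice_right
    have := h2.clm_apply (hasDerivAt_const t ((basisVec i, 0) : Plane × ℝ))
    simpa using this
  have h3 : partialD i (fun y => deriv (f y) t) x =
      fderiv ℝ (fderiv ℝ (Function.uncurry f)) (x, t) (0, 1) (basisVec i, 0) := by
    have he : (fun y => deriv (f y) t) =ᶠ[nhds x]
        fun y => fderiv ℝ (Function.uncurry f) (y, t) (0, 1) := by
      filter_upwards [hU.mem_nhds hx] with y hy using (hasDerivAt_slice hU hI hf hy ht).deriv
    have h2 := hd.slice_left.clm_apply
      (hasFDerivAt_const ((0, 1) : Plane × ℝ) x)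
    rw [partialD, he.fderiv_eq]
    have h4 : fderiv ℝ (fun y => fderiv ℝ (Function.uncurry f) (y, t) (0, 1)) x = _ := h2.fderiv
    rw [h4, hs.eq]
    simp
  rw [h3]
  refine h1.congr_of_eventuallyEq ?_
  filter_upwards [hI.mem_nhds ht] with τ hτ
  have hd : HasFDerivAt (Function.uncurry f) _ (x, τ) :=
    ((hf.contDiffAt (hO.mem_nhds ⟨hx, hτ⟩)).differentiableAt (by simp)).hasFDerivAt
  have h2 : fderiv ℝ (fun y => f y τ) x = _ :=
    hd.slice_left.fderiv
  simp only [partialD]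
  rw [h2]
  rfl

end Regularity

/-- `f(x, t)` solves `m f_t = ∂_i (a^{ij} ∂_j f) - m S` on `U × (0, T)` with a smooth extension to
`t = 0`, where `S` is orthogonal to all first derivatives of `f`. -/
structure IsLocalFlow {k : ℕ} (a : Fin 2 → Fin 2 → Plane → ℝ) (m : Plane → ℝ) (U : Set Plane)
    (T : ℝ) (f : Plane → ℝ → Euc k) : Prop where
  isOpen : IsOpen U
  coeff_smooth : ∀ i j, ContDiffOn ℝ ∞ (a i j) U
  coeff_symm : ∀ i j x, a i j x = a j i x
  density_smooth : ContDiffOn ℝ ∞ m U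
  smooth : ContDiffOn ℝ ∞ (Function.uncurry f) (U ×ˢ Ico 0 T)
  equation : ∀ t ∈ Ioo 0 T, ∃ S : Plane → Euc k, ∀ x ∈ U,
    (∑ i, partialD i (flux a (fun y => f y t) i) x = m x • (deriv (f x) t + S x)) ∧
    inner ℝ (S x) (deriv (f x) t) = 0 ∧ ∀ i, inner ℝ (S x) (partialD i (fun y => f y t) x) = 0

namespace IsLocalFlow

variable {k : ℕ} {a : Fin 2 → Fin 2 → Plane → ℝ} {m : Plane → ℝ} {U K : Set Plane}
    {T : ℝ} {f : Plane → ℝ → Euc k} {η : Plane → ℝ → ℝ}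

theorem smooth_Ioo (h : IsLocalFlow a m U T f) :
    ContDiffOn ℝ ∞ (Function.uncurry f) (U ×ˢ Ioo 0 T) :=
  h.smooth.mono (prod_mono subset_rfl Ioo_subset_Ico_self)

theorem continuousOn_coeff (h : IsLocalFlow a m U T f) (i j : Fin 2) (I : Set ℝ) :
    ContinuousOn (fun z : Plane × ℝ => a i j z.1) (U ×ˢ I) :=
  (h.coeff_smooth i j).continuousOn.comp continuousOn_fst (fun z hz => hz.1)

theorem continuousOn_quadGrad (h : IsLocalFlow a m U T f) :
    ContinuousOn (Function.uncurry fun x t => quadGrad a (fun y => f y t) x) (U ×ˢ Ico 0 T) := by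
  have h1 := continuousOn_partialD_slice h.isOpen (uniqueDiffOn_Ico 0 T) h.smooth
  unfold quadGrad
  exact continuousOn_finsetSum _ fun i _ => continuousOn_finsetSum _ fun j _ =>
    (h.continuousOn_coeff i j _).mul ((h1 i).inner (h1 j))

/-- The weighted energy is continuous in time, up to the initial time. -/
theorem continuousOn_energy (h : IsLocalFlow a m U T f) (hK : IsCompact K) (hKU : K ⊆ U)
    (hη : ContinuousOn (Function.uncurry η) (univ ×ˢ Ico 0 T))
    (hη0 : ∀ x ∉ K, ∀ t, η x t = 0) :
    ContinuousOn (fun t => ∫ x, η x t * quadGrad a (fun y => f y t) x) (Ico 0 T) := by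
  have h1 : ContinuousOn (Function.uncurry fun x t => η x t * quadGrad a (fun y => f y t) x)
      (univ ×ˢ Ico 0 T) :=
    continuousOn_of_zero_off h.isOpen hK hKU
      ((hη.mono (prod_mono (subset_univ _) subset_rfl)).mul h.continuousOn_quadGrad)
      (fun x hx t _ => by simp [hη0 x hx])
  refine continuousOn_integral_of_compact_support
    (f := fun t x => η x t * quadGrad a (fun y => f y t) x) hK ?_
    (fun t x _ hx => by simp [hη0 x hx])
  exact h1.comp (f := Prod.swap) continuous_swap.continuousOn
    (fun z hz => ⟨mem_univ _, hz.1⟩)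

theorem hasDerivAt_quadGrad (h : IsLocalFlow a m U T f) {x : Plane} (hx : x ∈ U) {t : ℝ}
    (ht : t ∈ Ioo 0 T) :
    HasDerivAt (fun τ => quadGrad a (fun y => f y τ) x)
      (2 * ∑ i, inner ℝ (flux a (fun y => f y t) i x)
        (partialD i (fun y => deriv (f y) t) x)) t := by
  have h1 := fun i => hasDerivAt_partialD h.isOpen isOpen_Ioo h.smooth_Ioo hx ht i
  have h2 : HasDerivAt (fun τ => quadGrad a (fun y => f y τ) x) (∑ i, ∑ j, a i j x *
      (inner ℝ (partialD i (fun y => f y t) x) (partialD j (fun y => deriv (f y) t) x) +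
        inner ℝ (partialD i (fun y => deriv (f y) t) x) (partialD j (fun y => f y t) x))) t := by
    unfold quadGrad
    exact HasDerivAt.fun_sum fun i _ => HasDerivAt.fun_sum fun j _ =>
      ((h1 i).inner ℝ (h1 j)).const_mul (a i j x)
  convert h2 using 1
  simp only [flux, Fin.sum_univ_two, inner_add_left, inner_smul_left, RCLike.conj_to_real,
    h.coeff_symm 1 0 x, real_inner_comm (partialD _ (fun y => deriv (f y) t) x)
      (partialD _ (fun y => f y t) x)]
  ring

/-- The evolution of the weighted energy. -/
theorem hasDerivAt_energy (h : IsLocalFlow a m U T f) (hK : IsCompact K) (hKU : K ⊆ U)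
    (hη : ContDiffOn ℝ 1 (Function.uncurry η) (univ ×ˢ Ioo 0 T))
    (hη0 : ∀ x ∉ K, ∀ t, η x t = 0) {t : ℝ} (ht : t ∈ Ioo 0 T) :
    HasDerivAt (fun τ => 1 / 2 * ∫ x, η x τ * quadGrad a (fun y => f y τ) x)
      (∫ x, (1 / 2 * deriv (η x) t * quadGrad a (fun y => f y t) x -
        η x t * m x * ‖deriv (f x) t‖ ^ 2 -
        ∑ i, partialD i (fun y => η y t) x *
          inner ℝ (flux a (fun y => f y t) i x) (deriv (f x) t))) t := by
  have hU := h.isOpen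
  have hI : IsOpen (Ioo 0 T) := isOpen_Ioo
  have hOη : IsOpen ((univ : Set Plane) ×ˢ Ioo 0 T) := isOpen_univ.prod hI
  have hηd : ∀ x, ∀ τ ∈ Ioo 0 T,
      HasDerivAt (η x) (fderiv ℝ (Function.uncurry η) (x, τ) (0, 1)) τ := by
    intro x τ hτ
    have hd : HasFDerivAt (Function.uncurry η) _ (x, τ) :=
      ((hη.contDiffAt (hOη.mem_nhds ⟨mem_univ _, hτ⟩)).differentiableAt (by simp)).hasFDerivAt
    exact hd.slice_right
  have hηt : ContinuousOn (Function.uncurry fun x τ => deriv (η x) τ) (univ ×ˢ Ioo 0 T) := by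
    have h1 := (hη.continuousOn_fderiv_of_isOpen hOη (by simp)).clm_apply
      (continuousOn_const (c := ((0, 1) : Plane × ℝ)))
    refine h1.congr ?_
    rintro ⟨x, τ⟩ ⟨-, hτ⟩
    exact (hηd x τ hτ).deriv
  have hηt0 : ∀ x ∉ K, ∀ τ, deriv (η x) τ = 0 := by
    intro x hx τ
    have : η x = fun _ => 0 := funext fun σ => hη0 x hx σ
    rw [this]; simp
  have hfi := fun i => (contDiffOn_partialD_joint hU hI h.smooth_Ioo i).continuousOn
  have hft := contDiffOn_deriv_joint hU hI h.smooth_Ioo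
  have hfti := fun i => (contDiffOn_partialD_joint hU hI hft i).continuousOn
  have hflux : ∀ i, ContinuousOn (Function.uncurry fun x τ => flux a (fun y => f y τ) i x)
      (U ×ˢ Ioo 0 T) := by
    intro i
    unfold flux
    exact continuousOn_finsetSum _ fun j _ => (h.continuousOn_coeff i j _).smul (hfi j)
  have hQ := h.continuousOn_quadGrad.mono (prod_mono (subset_refl U) (Ioo_subset_Ico_self (a := 0)
    (b := T)))
  have hηU := hη.continuousOn.mono (prod_mono (subset_univ U) (subset_refl (Ioo 0 T)))
  have hηtU := hηt.mono (prod_mono (subset_univ U) (subset_refl (Ioo 0 T)))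
  have hinner : ContinuousOn (Function.uncurry fun x τ =>
      ∑ i, inner ℝ (flux a (fun y => f y τ) i x) (partialD i (fun y => deriv (f y) τ) x))
      (U ×ˢ Ioo 0 T) :=
    continuousOn_finsetSum _ fun i _ => (hflux i).inner (hfti i)
  have h1 := (hasDerivAt_integral_of_zero_off
    (h := fun x τ => η x τ * quadGrad a (fun y => f y τ) x)
    (h' := fun x τ => deriv (η x) τ * quadGrad a (fun y => f y τ) x +
      η x τ * (2 * ∑ i, inner ℝ (flux a (fun y => f y τ) i x)
        (partialD i (fun y => deriv (f y) τ) x))) hU hK hKU ht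
    (fun x hx τ hτ => (hηd x τ hτ).differentiableAt.hasDerivAt.mul (h.hasDerivAt_quadGrad hx hτ))
    (hηU.mul hQ) ((hηtU.mul hQ).add (hηU.mul (continuousOn_const.mul hinner)))
    (fun x hx τ _ => by simp [hη0 x hx]) (fun x hx τ _ => by simp [hη0 x hx, hηt0 x hx])).const_mul
    (1 / 2 : ℝ)
  refine h1.congr_deriv ?_
  obtain ⟨S, hS⟩ := h.equation t ht
  have hηs : ContDiff ℝ 1 (fun x => η x t) := by
    rw [← contDiffOn_univ]
    exact hη.comp (f := fun x => (x, t)) (by fun_prop) (fun x hx => ⟨hx, ht⟩)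
  have hv := contDiffOn_slice h.smooth_Ioo ht
  have hw : ContDiffOn ℝ ∞ (fun x => deriv (f x) t) U := contDiffOn_slice hft ht
  -- Testing with `w = f_t` trades the mixed term `η ⟨flux_i, ∂_i f_t⟩`, produced by differentiating
  -- `Q`, for `-η m |f_t|²` and a term with `∂_i η`.
  have h2 := integral_test_identity hU hK hKU h.coeff_smooth hv hw hηs (fun x hx => hη0 x hx t)
    (fun x hx => (hS x hx).1) (fun x hx => (hS x hx).2.1)
  have hz : ∀ x ∉ K, ∀ i, partialD i (fun y => η y t) x = 0 := fun x hx i =>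
    partialD_eq_zero_off hK (fun x hx => hη0 x hx t) i hx
  have slice : ∀ {q : Plane → ℝ → ℝ}, ContinuousOn (Function.uncurry q) (U ×ˢ Ioo 0 T) →
      ContinuousOn (fun x => q x t) U := fun hq =>
    hq.comp (f := fun x => (x, t)) (by fun_prop) (fun x hx => ⟨hx, ht⟩)
  have hηsp : ∀ i, ContinuousOn (partialD i (fun y => η y t)) U := fun i =>
    (contDiffOn_partialD isOpen_univ (m := 0) hηs.contDiffOn (by simp) i).continuousOn.mono
      (subset_univ _)
  have hfluxs : ∀ i, ContinuousOn (flux a (fun y => f y t) i) U := fun i =>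
    (contDiffOn_flux hU h.coeff_smooth hv i).continuousOn
  have c1 : ContinuousOn (fun x => ∑ i, partialD i (fun y => η y t) x *
      inner ℝ (flux a (fun y => f y t) i x) (deriv (f x) t)) U :=
    continuousOn_finsetSum _ fun i _ => (hηsp i).mul ((hfluxs i).inner hw.continuousOn)
  have c2 : ContinuousOn (fun x => η x t * m x * ‖deriv (f x) t‖ ^ 2) U :=
    ((slice hηU).mul h.density_smooth.continuousOn).mul (hw.continuousOn.norm.pow 2)
  have c3 : ContinuousOn (fun x => η x t * ∑ i, inner ℝ (flux a (fun y => f y t) i x)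
      (partialD i (fun y => deriv (f y) t) x)) U := (slice hηU).mul (slice hinner)
  have c4 : ContinuousOn (fun x => 1 / 2 * deriv (η x) t * quadGrad a (fun y => f y t) x) U :=
    (continuousOn_const.mul (slice hηtU)).mul (slice hQ)
  have i1 := integrable_of_zero_off hU hK hKU ((c1.add c2).add c3) (fun x hx => by
    simp [hη0 x hx, hz x hx])
  have i2 := integrable_of_zero_off hU hK hKU ((c4.sub c2).sub c1) (fun x hx => by
    simp [hη0 x hx, hz x hx, hηt0 x hx])
  have h3 := integral_add i2 i1
  simp only [Pi.add_apply, Pi.sub_apply] at h3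
  rw [h2, add_zero] at h3
  rw [← h3, ← integral_const_mul]
  refine integral_congr_ae (Filter.Eventually.of_forall fun x => ?_)
  simp only
  ring

/-- The Pohozaev identity along the flow. -/
theorem pohozaev (h : IsLocalFlow a m U T f) (hK : IsCompact K) (hKU : K ⊆ U) {ζ : Plane → ℝ}
    (hζ : ContDiff ℝ 1 ζ) (hζ0 : ∀ x ∉ K, ζ x = 0) {t : ℝ} (ht : t ∈ Ioo 0 T) :
    ∫ x, (ζ x * m x * inner ℝ (deriv (f x) t) (radialD (fun y => f y t) x) +
      (∑ i, partialD i ζ x *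
        inner ℝ (flux a (fun y => f y t) i x) (radialD (fun y => f y t) x)) -
      1 / 2 * radialD ζ x * quadGrad a (fun y => f y t) x -
      1 / 2 * ζ x * quadGrad (fun i j => radialD (a i j)) (fun y => f y t) x) = 0 := by
  obtain ⟨S, hS⟩ := h.equation t ht
  exact integral_pohozaev h.isOpen hK hKU h.coeff_smooth h.coeff_symm
    (contDiffOn_slice h.smooth_Ioo ht) hζ hζ0 (fun x hx => (hS x hx).1)
    (fun x hx => (hS x hx).2.2)

end IsLocalFlow

end TimeDependent

/-! ### The second fundamental form is normal to the derivatives of a map into `N`. -/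

section Tangency

/-- A derivative maps tangent cones into tangent cones, and the tangent cone of a neighbourhood is
the whole space. -/
theorem hasFDerivAt_mem_tangentSpaceAt {E : Type*} [NormedAddCommGroup E] [NormedSpace ℝ E] {k : ℕ}
    {N : Set (Euc k)} {γ : E → Euc k} {γ' : E →L[ℝ] Euc k} {x : E} (h : HasFDerivAt γ γ' x)
    (hN : ∀ᶠ y in nhds x, γ y ∈ N) (v : E) : γ' v ∈ tangentSpaceAt N (γ x) := by
  refine Submodule.subset_span ?_
  obtain ⟨s, hs, hso, hxs⟩ := eventually_nhds_iff.1 hN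
  have h1 : HasFDerivWithinAt γ γ' s x := h.hasFDerivWithinAt
  have h2 := h1.mapsTo_tangent_cone
    (show v ∈ tangentConeAt ℝ s x by rw [tangentConeAt_of_mem_nhds (hso.mem_nhds hxs)]; trivial)
  refine tangentConeAt_mono ?_ h2
  rintro _ ⟨y, hy, rfl⟩
  exact hs y hy

/-- This orthogonality removes the nonlinear term of the flow whenever the equation is paired with a
derivative of the solution. -/
theorem inner_secondFundamentalForm {k : ℕ} (N : Set (Euc k)) (q X Y : Euc k) {v : Euc k}
    (hv : v ∈ tangentSpaceAt N q) : inner ℝ (secondFundamentalForm N q X Y) v = 0 := by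
  rw [real_inner_comm]
  exact Submodule.inner_right_of_mem_orthogonal hv (Submodule.starProjection_apply_mem _ _)

end Tangency

/-! ### The flow and its energy density in local coordinates. -/

section Coordinates

variable {M : Type*} [TopologicalSpace M] [ChartedSpace Plane M] [IsManifold 𝓘(ℝ, Plane) ∞ M]

theorem contDiffOn_comp_symm {F : Type*} [NormedAddCommGroup F] [NormedSpace ℝ F] {α : M → F}
    (hα : ContMDiff 𝓘(ℝ, Plane) 𝓘(ℝ, F) ∞ α) {Φ : OpenPartialHomeomorph M Plane}
    (hΦ : Φ ∈ IsManifold.maximalAtlas 𝓘(ℝ, Plane) ∞ M) :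
    ContDiffOn ℝ ∞ (α ∘ Φ.symm) Φ.target :=
  contMDiffOn_iff_contDiffOn.1
    (hα.comp_contMDiffOn (contMDiffOn_symm_of_mem_maximalAtlas hΦ))

/-- Multiplication by the volume density puts the equation in divergence form. The term `S` is the
trace of the second fundamental form, normal to `N`, while `u_t` and `∂_i u` are tangential. -/
theorem IsHarmonicHeatFlow.isLocalFlow {k : ℕ} {g : Metric M} {N : Set (Euc k)} {T : ℝ}
    {u : M → ℝ → Euc k} (hu : IsHarmonicHeatFlow g N T u) {Φ : OpenPartialHomeomorph M Plane}
    (hΦ : Φ ∈ IsManifold.maximalAtlas 𝓘(ℝ, Plane) ∞ M) :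
    IsLocalFlow (conformalCoeff g Φ) (volDensity g Φ) Φ.target T
      (fun x t => u (Φ.symm x) t) := by
  have hsm : ContDiffOn ℝ ∞ (Function.uncurry fun x t => u (Φ.symm x) t)
      (Φ.target ×ˢ Ico 0 T) := by
    have h1 : ContMDiffOn (𝓘(ℝ, Plane).prod 𝓘(ℝ, ℝ)) (𝓘(ℝ, Plane).prod 𝓘(ℝ, ℝ)) ∞
        (Prod.map Φ.symm (id : ℝ → ℝ)) (Φ.target ×ˢ Ico 0 T) :=
      (contMDiffOn_symm_of_mem_maximalAtlas hΦ).prodMap contMDiffOn_id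
    have h2 := hu.smooth.comp h1 (fun z hz => ⟨mem_univ _, hz.2⟩)
    rw [← modelWithCornersSelf_prod, chartedSpaceSelf_prod] at h2
    exact contMDiffOn_iff_contDiffOn.1 h2
  refine ⟨Φ.open_target, conformalCoeff_contDiffOn g hΦ, conformalCoeff_symm g Φ,
    volDensity_contDiffOn g hΦ, hsm, fun t ht => ?_⟩
  refine ⟨secondFormTrace g N Φ (fun z => u (Φ.symm z) t), fun x hx => ⟨?_, ?_⟩⟩
  · rw [hu.equation Φ hΦ x hx t ht, sub_add_cancel, laplaceBeltrami,
      smul_inv_smul₀ (volDensity_pos g hΦ hx).ne']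
    rfl
  · have hO : IsOpen (Φ.target ×ˢ Ioo 0 T) := Φ.open_target.prod isOpen_Ioo
    have hd : HasFDerivAt (Function.uncurry fun x t => u (Φ.symm x) t) _ (x, t) :=
      (((hsm.mono (prod_mono subset_rfl Ioo_subset_Ico_self)).contDiffAt
        (hO.mem_nhds ⟨hx, ht⟩)).differentiableAt (by simp)).hasFDerivAt
    have hN : ∀ᶠ z in nhds (x, t), (Function.uncurry fun x t => u (Φ.symm x) t) z ∈ N := by
      filter_upwards [hO.mem_nhds ⟨hx, ht⟩] with z hz
      exact hu.mem _ _ (Ioo_subset_Ico_self hz.2)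
    have hperp : ∀ v, v ∈ tangentSpaceAt N (u (Φ.symm x) t) →
        inner ℝ (secondFormTrace g N Φ (fun z => u (Φ.symm z) t) x) v = 0 := by
      intro v hv
      simp [secondFormTrace, Fin.sum_univ_two, inner_add_left, inner_smul_left,
        inner_secondFundamentalForm N _ _ _ hv]
    refine ⟨hperp _ ?_, fun i => hperp _ ?_⟩
    · have := hd.slice_right.deriv
      simp only [Function.uncurry] at this
      rw [this]
      exact hasFDerivAt_mem_tangentSpaceAt hd hN _
    · have := hd.slice_left.fderiv
      simp only [Function.uncurry] at this
      rw [partialD, this]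
      exact hasFDerivAt_mem_tangentSpaceAt hd hN _

/-- `⟨∇α, ∇β⟩_g` for functions `α`, `β` on `M`. -/
def gradPairing (g : Metric M) (α β : M → ℝ) (p : M) : ℝ :=
  gradInner g (chartAt Plane p) (α ∘ (chartAt Plane p).symm) (β ∘ (chartAt Plane p).symm)
    (chartAt Plane p p)

theorem gradPairing_symm_apply (g : Metric M) {α β : M → ℝ}
    (hα : ContMDiff 𝓘(ℝ, Plane) 𝓘(ℝ, ℝ) ∞ α) (hβ : ContMDiff 𝓘(ℝ, Plane) 𝓘(ℝ, ℝ) ∞ β)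
    {Φ : OpenPartialHomeomorph M Plane} (hΦ : Φ ∈ IsManifold.maximalAtlas 𝓘(ℝ, Plane) ∞ M)
    {x : Plane} (hx : x ∈ Φ.target) :
    gradPairing g α β (Φ.symm x) = gradInner g Φ (α ∘ Φ.symm) (β ∘ Φ.symm) x := by
  have hmem := IsManifold.chart_mem_maximalAtlas (I := 𝓘(ℝ, Plane)) (n := ∞) (Φ.symm x)
  have hd : ∀ {γ : M → ℝ}, ContMDiff 𝓘(ℝ, Plane) 𝓘(ℝ, ℝ) ∞ γ →
      DifferentiableAt ℝ (γ ∘ Φ.symm) (Φ (Φ.symm x)) := by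
    intro γ hγ
    rw [Φ.right_inv hx]
    exact ((contDiffOn_comp_symm hγ hΦ).contDiffAt (Φ.open_target.mem_nhds hx)).differentiableAt
      (by simp)
  have := gradInner_chart_eq g hmem hΦ (mem_chart_source Plane (Φ.symm x)) (Φ.map_target hx)
    (hd hα) (hd hβ)
  rw [gradPairing, this, Φ.right_inv hx]

theorem continuous_of_charts {F : Type*} [TopologicalSpace F] {h : M → F}
    (hh : ∀ p : M, ContinuousOn (h ∘ (chartAt Plane p).symm) (chartAt Plane p).target) :
    Continuous h := by
  rw [continuous_iff_continuousAt]
  intro p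
  set Φ := chartAt Plane p
  have hp : p ∈ Φ.source := mem_chart_source Plane p
  have h1 : ContinuousAt ((h ∘ Φ.symm) ∘ Φ) p :=
    ((hh p).continuousAt (Φ.open_target.mem_nhds (Φ.map_source hp))).comp (Φ.continuousAt hp)
  refine h1.congr ?_
  filter_upwards [Φ.open_source.mem_nhds hp] with q hq
  simp [Φ.left_inv hq]

theorem continuousOn_metric_inv (g : Metric M) {Φ : OpenPartialHomeomorph M Plane}
    (hΦ : Φ ∈ IsManifold.maximalAtlas 𝓘(ℝ, Plane) ∞ M) (i j : Fin 2) :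
    ContinuousOn (fun x => (metricMatrix g Φ x)⁻¹ i j) Φ.target := by
  refine ((conformalCoeff_contDiffOn g hΦ i j).continuousOn.div
    (volDensity_contDiffOn g hΦ).continuousOn fun x hx => (volDensity_pos g hΦ hx).ne').congr ?_
  intro x hx
  exact (mul_div_cancel_left₀ _ (volDensity_pos g hΦ hx).ne').symm

theorem continuous_gradPairing (g : Metric M) {α β : M → ℝ}
    (hα : ContMDiff 𝓘(ℝ, Plane) 𝓘(ℝ, ℝ) ∞ α) (hβ : ContMDiff 𝓘(ℝ, Plane) 𝓘(ℝ, ℝ) ∞ β) :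
    Continuous (gradPairing g α β) := by
  refine continuous_of_charts fun p => ?_
  have hmem := IsManifold.chart_mem_maximalAtlas (I := 𝓘(ℝ, Plane)) (n := ∞) p
  set Φ := chartAt Plane p
  have h1 : ∀ {γ : M → ℝ}, ContMDiff 𝓘(ℝ, Plane) 𝓘(ℝ, ℝ) ∞ γ → ∀ i,
      ContinuousOn (partialD i (γ ∘ Φ.symm)) Φ.target := fun hγ i =>
    (contDiffOn_partialD (m := ∞) Φ.open_target (contDiffOn_comp_symm hγ hmem) (by simp)
      i).continuousOn
  have h2 : ContinuousOn (gradInner g Φ (α ∘ Φ.symm) (β ∘ Φ.symm)) Φ.target := by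
    unfold gradInner
    exact continuousOn_finsetSum _ fun i _ => continuousOn_finsetSum _ fun j _ =>
      (continuousOn_metric_inv g hmem i j).mul ((h1 hα i).mul (h1 hβ j))
  exact h2.congr fun x hx => gradPairing_symm_apply g hα hβ hmem hx

theorem contMDiff_coord {k : ℕ} {v : M → Euc k} (hv : ContMDiff 𝓘(ℝ, Plane) 𝓘(ℝ, Euc k) ∞ v)
    (c : Fin k) : ContMDiff 𝓘(ℝ, Plane) 𝓘(ℝ, ℝ) ∞ (fun p => v p c) :=
  (EuclideanSpace.proj c : Euc k →L[ℝ] ℝ).contMDiff.comp hv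

theorem partialD_apply {k : ℕ} {f : Plane → Euc k} {x : Plane} (hf : DifferentiableAt ℝ f x)
    (i : Fin 2) (c : Fin k) : partialD i (fun z => f z c) x = partialD i f x c := by
  have := (EuclideanSpace.proj c : Euc k →L[ℝ] ℝ).hasFDerivAt.comp x hf.hasFDerivAt
  have h2 : fderiv ℝ (fun z => f z c) x = _ := this.fderiv
  rw [partialD, h2]
  rfl

theorem inner_eq_sum {k : ℕ} (v w : Euc k) : inner ℝ v w = ∑ c, v c * w c := by
  simp [PiLp.inner_apply, mul_comm]

theorem gradSq_eq_sum {k : ℕ} (g : Metric M) (Φ : OpenPartialHomeomorph M Plane)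
    {f : Plane → Euc k} {x : Plane} (hf : DifferentiableAt ℝ f x) :
    gradSq g Φ f x = ∑ c, gradInner g Φ (fun z => f z c) (fun z => f z c) x := by
  simp only [gradSq, gradInner, partialD_apply hf, inner_eq_sum, Fin.sum_univ_two, Finset.mul_sum,
    ← Finset.sum_add_distrib]

/-- Splitting into components reduces continuity and chart independence of the energy density to
those of scalar pairings. -/
theorem energyDensity_eq_sum {k : ℕ} (g : Metric M) {v : M → Euc k}
    (hv : ContMDiff 𝓘(ℝ, Plane) 𝓘(ℝ, Euc k) ∞ v) (p : M) :
    energyDensity g v p = ∑ c, gradPairing g (fun q => v q c) (fun q => v q c) p := by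
  have hmem := IsManifold.chart_mem_maximalAtlas (I := 𝓘(ℝ, Plane)) (n := ∞) p
  rw [energyDensity, gradSq_eq_sum]
  · rfl
  · exact ((contDiffOn_comp_symm hv hmem).contDiffAt ((chartAt Plane p).open_target.mem_nhds
      (mem_chart_target Plane p))).differentiableAt (by simp)

theorem energyDensity_symm_apply {k : ℕ} (g : Metric M) {v : M → Euc k}
    (hv : ContMDiff 𝓘(ℝ, Plane) 𝓘(ℝ, Euc k) ∞ v) {Φ : OpenPartialHomeomorph M Plane}
    (hΦ : Φ ∈ IsManifold.maximalAtlas 𝓘(ℝ, Plane) ∞ M) {x : Plane} (hx : x ∈ Φ.target) :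
    energyDensity g v (Φ.symm x) = gradSq g Φ (v ∘ Φ.symm) x := by
  rw [energyDensity_eq_sum g hv, gradSq_eq_sum]
  · exact Finset.sum_congr rfl fun c _ =>
      gradPairing_symm_apply g (contMDiff_coord hv c) (contMDiff_coord hv c) hΦ hx
  · exact ((contDiffOn_comp_symm hv hΦ).contDiffAt (Φ.open_target.mem_nhds hx)).differentiableAt
      (by simp)

theorem continuous_energyDensity {k : ℕ} (g : Metric M) {v : M → Euc k}
    (hv : ContMDiff 𝓘(ℝ, Plane) 𝓘(ℝ, Euc k) ∞ v) : Continuous (energyDensity g v) := by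
  rw [show energyDensity g v = _ from funext (energyDensity_eq_sum g hv)]
  exact continuous_finsetSum _ fun c _ =>
    continuous_gradPairing g (contMDiff_coord hv c) (contMDiff_coord hv c)

theorem volDensity_mul_gradSq {k : ℕ} (g : Metric M) (Φ : OpenPartialHomeomorph M Plane)
    (f : Plane → Euc k) (x : Plane) :
    volDensity g Φ x * gradSq g Φ f x = quadGrad (conformalCoeff g Φ) f x := by
  simp only [gradSq, quadGrad, conformalCoeff, Fin.sum_univ_two]
  ring

/-- A symmetric matrix which is positive on vectors is positive on tuples of vectors. -/
theorem sum_inner_nonneg {k : ℕ} {A : Fin 2 → Fin 2 → ℝ}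
    (hA : ∀ ξ : Plane, 0 ≤ ∑ i, ∑ j, A i j * ξ i * ξ j) (p : Fin 2 → Euc k) :
    0 ≤ ∑ i, ∑ j, A i j * inner ℝ (p i) (p j) := by
  have h : ∑ i, ∑ j, A i j * inner ℝ (p i) (p j) =
      ∑ c, ∑ i, ∑ j, A i j * (!₂[p 0 c, p 1 c] : Plane) i * (!₂[p 0 c, p 1 c] : Plane) j := by
    simp only [inner_eq_sum, Fin.sum_univ_two, Finset.mul_sum, ← Finset.sum_add_distrib]
    refine Finset.sum_congr rfl fun c _ => ?_
    simp
    ring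
  rw [h]
  exact Finset.sum_nonneg fun c _ => hA _

/-- Up to the factor `det⁻¹`, the form of the inverse of a symmetric `2 × 2` matrix at `ξ` is the
original form at `ξ` turned by a right angle. -/
theorem metric_inv_quadratic_nonneg (g : Metric M) {Φ : OpenPartialHomeomorph M Plane}
    (hΦ : Φ ∈ IsManifold.maximalAtlas 𝓘(ℝ, Plane) ∞ M) {x : Plane} (hx : x ∈ Φ.target)
    (ξ : Plane) : 0 ≤ ∑ i, ∑ j, (metricMatrix g Φ x)⁻¹ i j * ξ i * ξ j := by
  have hdet := metricMatrix_det_pos g hΦ hx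
  have h : ∑ i, ∑ j, (metricMatrix g Φ x)⁻¹ i j * ξ i * ξ j = (metricMatrix g Φ x).det⁻¹ *
      ∑ i, ∑ j, metricMatrix g Φ x i j * (!₂[-ξ 1, ξ 0] : Plane) i * (!₂[-ξ 1, ξ 0] : Plane) j := by
    rw [inv_fin_two]
    simp only [Fin.sum_univ_two]
    simp
    ring
  rw [h]
  refine mul_nonneg (inv_nonneg.2 hdet.le) ?_
  by_cases h0 : (!₂[-ξ 1, ξ 0] : Plane) = 0
  · rw [h0]; simp
  · exact (metricMatrix_quadratic_pos g hΦ hx h0).le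

theorem gradSq_nonneg {k : ℕ} (g : Metric M) {Φ : OpenPartialHomeomorph M Plane}
    (hΦ : Φ ∈ IsManifold.maximalAtlas 𝓘(ℝ, Plane) ∞ M) {x : Plane} (hx : x ∈ Φ.target)
    (f : Plane → Euc k) : 0 ≤ gradSq g Φ f x :=
  sum_inner_nonneg (fun ξ => metric_inv_quadratic_nonneg g hΦ hx ξ) fun i => partialD i f x

theorem energyDensity_nonneg {k : ℕ} (g : Metric M) (v : M → Euc k) (p : M) :
    0 ≤ energyDensity g v p :=
  gradSq_nonneg g (IsManifold.chart_mem_maximalAtlas p) (mem_chart_target Plane p) _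

end Coordinates

/-! ### Decay of the global Dirichlet energy, by a partition of unity. -/

section GlobalEnergy

variable {M : Type*} [TopologicalSpace M] [ChartedSpace Plane M] [IsManifold 𝓘(ℝ, Plane) ∞ M]

/-- A function on `M` in the local coordinates `Φ`, extended by zero. -/
def chartCutoff (Φ : OpenPartialHomeomorph M Plane) (χ : M → ℝ) : Plane → ℝ :=
  Φ.target.indicator (χ ∘ Φ.symm)

theorem chartCutoff_apply {Φ : OpenPartialHomeomorph M Plane} {χ : M → ℝ} {x : Plane}
    (hx : x ∈ Φ.target) : chartCutoff Φ χ x = χ (Φ.symm x) :=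
  indicator_of_mem hx _

theorem chartCutoff_eq_zero {Φ : OpenPartialHomeomorph M Plane} {χ : M → ℝ} {x : Plane}
    (hx : x ∉ Φ '' tsupport χ) : chartCutoff Φ χ x = 0 := by
  by_cases h : x ∈ Φ.target
  · rw [chartCutoff_apply h]
    by_contra h0
    exact hx ⟨Φ.symm x, subset_tsupport χ h0, Φ.right_inv h⟩
  · exact indicator_of_notMem h _

theorem partialD_chartCutoff {Φ : OpenPartialHomeomorph M Plane} {χ : M → ℝ} {x : Plane}
    (hx : x ∈ Φ.target) (i : Fin 2) :
    partialD i (chartCutoff Φ χ) x = partialD i (χ ∘ Φ.symm) x := by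
  rw [partialD, partialD, Filter.EventuallyEq.fderiv_eq]
  filter_upwards [Φ.open_target.mem_nhds hx] with y hy using chartCutoff_apply hy

theorem isCompact_chart_image [CompactSpace M] {Φ : OpenPartialHomeomorph M Plane} {χ : M → ℝ}
    (hs : tsupport χ ⊆ Φ.source) : IsCompact (Φ '' tsupport χ) ∧ Φ '' tsupport χ ⊆ Φ.target :=
  ⟨(isClosed_tsupport χ).isCompact.image_of_continuousOn (Φ.continuousOn.mono hs),
    image_subset_iff.2 fun _ hp => Φ.map_source (hs hp)⟩

theorem contDiff_chartCutoff [CompactSpace M] {Φ : OpenPartialHomeomorph M Plane}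
    (hΦ : Φ ∈ IsManifold.maximalAtlas 𝓘(ℝ, Plane) ∞ M) {χ : M → ℝ}
    (hχ : ContMDiff 𝓘(ℝ, Plane) 𝓘(ℝ, ℝ) ∞ χ) (hs : tsupport χ ⊆ Φ.source) :
    ContDiff ℝ ∞ (chartCutoff Φ χ) :=
  contDiff_of_zero_off Φ.open_target (isCompact_chart_image hs).1 (isCompact_chart_image hs).2
    ((contDiffOn_comp_symm hχ hΦ).congr fun _ hx => chartCutoff_apply hx)
    fun _ hx => chartCutoff_eq_zero hx

theorem gradPairing_sum {ι : Type*} [Fintype ι] (g : Metric M) {χ : ι → M → ℝ}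
    (hχ : ∀ i, ContMDiff 𝓘(ℝ, Plane) 𝓘(ℝ, ℝ) ∞ (χ i)) (β : M → ℝ) (p : M) :
    ∑ i, gradPairing g (χ i) β p = gradPairing g (fun q => ∑ i, χ i q) β p := by
  have hmem := IsManifold.chart_mem_maximalAtlas (I := 𝓘(ℝ, Plane)) (n := ∞) p
  have hd : ∀ i, DifferentiableAt ℝ (χ i ∘ (chartAt Plane p).symm) (chartAt Plane p p) :=
    fun i => ((contDiffOn_comp_symm (hχ i) hmem).contDiffAt
      ((chartAt Plane p).open_target.mem_nhds (mem_chart_target Plane p))).differentiableAt (by simp)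
  have h : ∀ l, partialD l ((fun q => ∑ i, χ i q) ∘ (chartAt Plane p).symm)
      (chartAt Plane p p) = ∑ i, partialD l (χ i ∘ (chartAt Plane p).symm) (chartAt Plane p p) := by
    intro l
    have h1 : fderiv ℝ ((fun q => ∑ i, χ i q) ∘ (chartAt Plane p).symm) (chartAt Plane p p) = _ :=
      fderiv_fun_sum (u := Finset.univ) (A := fun i => χ i ∘ (chartAt Plane p).symm)
        fun i _ => hd i
    rw [partialD, h1]
    simp [partialD]
  simp only [gradPairing, gradInner, h, Fin.sum_univ_two, Finset.sum_mul, Finset.mul_sum,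
    ← Finset.sum_add_distrib]

theorem gradPairing_const (g : Metric M) (c : ℝ) (β : M → ℝ) (p : M) :
    gradPairing g (fun _ => c) β p = 0 := by
  have : ((fun _ : M => c) ∘ (chartAt Plane p).symm) = fun _ => c := rfl
  simp [gradPairing, gradInner, this, partialD]

namespace IsHarmonicHeatFlow

variable {k : ℕ} {g : Metric M} {N : Set (Euc k)} {T : ℝ} {u : M → ℝ → Euc k}

theorem contMDiff_slice (hu : IsHarmonicHeatFlow g N T u) {t : ℝ} (ht : t ∈ Ico 0 T) :
    ContMDiff 𝓘(ℝ, Plane) 𝓘(ℝ, Euc k) ∞ (fun p => u p t) := by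
  rw [← contMDiffOn_univ]
  exact hu.smooth.comp (f := fun p : M => (p, t)) (contMDiff_id.prodMk contMDiff_const).contMDiffOn
    (fun p _ => ⟨mem_univ _, ht⟩)

theorem continuous_deriv (hu : IsHarmonicHeatFlow g N T u) {t : ℝ} (ht : t ∈ Ioo 0 T) :
    Continuous (fun p => deriv (u p) t) := by
  refine continuous_of_charts fun p => ?_
  have h := hu.isLocalFlow (IsManifold.chart_mem_maximalAtlas (I := 𝓘(ℝ, Plane)) (n := ∞) p)
  exact (contDiffOn_slice (contDiffOn_deriv_joint h.isOpen isOpen_Ioo h.smooth_Ioo)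
    ht).continuousOn

variable [CompactSpace M] [T2Space M] [MeasurableSpace M] [BorelSpace M]
  [SecondCountableTopology M] {Φ : OpenPartialHomeomorph M Plane} {χ : M → ℝ}

theorem integral_mul_energyDensity (hu : IsHarmonicHeatFlow g N T u)
    (hΦ : Φ ∈ IsManifold.maximalAtlas 𝓘(ℝ, Plane) ∞ M)
    (hχ : ContMDiff 𝓘(ℝ, Plane) 𝓘(ℝ, ℝ) ∞ χ) (hs : tsupport χ ⊆ Φ.source) {t : ℝ}
    (ht : t ∈ Ico 0 T) :
    ∫ p, χ p * energyDensity g (fun q => u q t) p ∂(riemannianVolume g) =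
      ∫ x, chartCutoff Φ χ x * quadGrad (conformalCoeff g Φ) (fun y => u (Φ.symm y) t) x := by
  have hsl := hu.contMDiff_slice ht
  have h0 : ∀ x ∉ Φ.target, chartCutoff Φ χ x *
      quadGrad (conformalCoeff g Φ) (fun y => u (Φ.symm y) t) x = 0 := by
    intro x hx
    simp [chartCutoff, hx]
  rw [integral_riemannianVolume_of_support g hΦ
    (hχ.continuous.fun_mul (continuous_energyDensity g hsl))
    (fun p hp => hs (subset_tsupport χ (left_ne_zero_of_mul hp))),
    ← setIntegral_eq_integral_of_forall_compl_eq_zero h0]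
  refine setIntegral_congr_fun Φ.open_target.measurableSet fun x hx => ?_
  rw [chartCutoff_apply hx, energyDensity_symm_apply g hsl hΦ hx, ← volDensity_mul_gradSq]
  simp only [Function.comp_def]
  ring

theorem continuousOn_localized (hu : IsHarmonicHeatFlow g N T u)
    (hΦ : Φ ∈ IsManifold.maximalAtlas 𝓘(ℝ, Plane) ∞ M)
    (hχ : ContMDiff 𝓘(ℝ, Plane) 𝓘(ℝ, ℝ) ∞ χ) (hs : tsupport χ ⊆ Φ.source) :
    ContinuousOn (fun t => ∫ p, χ p * energyDensity g (fun q => u q t) p ∂(riemannianVolume g))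
      (Ico 0 T) := by
  obtain ⟨hK, hKt⟩ := isCompact_chart_image hs
  refine ((hu.isLocalFlow hΦ).continuousOn_energy hK hKt (η := fun x _ => chartCutoff Φ χ x)
    ?_ (fun x hx _ => chartCutoff_eq_zero hx)).congr
    (fun t ht => hu.integral_mul_energyDensity hΦ hχ hs ht)
  exact ((contDiff_chartCutoff hΦ hχ hs).continuous.comp continuous_fst).continuousOn

/-- The local energy identity with a time-independent weight is rewritten as an integral over `M`,
so that contributions of different charts can be added and their `∇χ` terms compared. -/
theorem hasDerivAt_localized (hu : IsHarmonicHeatFlow g N T u)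
    (hΦ : Φ ∈ IsManifold.maximalAtlas 𝓘(ℝ, Plane) ∞ M)
    (hχ : ContMDiff 𝓘(ℝ, Plane) 𝓘(ℝ, ℝ) ∞ χ) (hs : tsupport χ ⊆ Φ.source) {t : ℝ}
    (ht : t ∈ Ioo 0 T) :
    HasDerivAt
      (fun t => 1 / 2 * ∫ p, χ p * energyDensity g (fun q => u q t) p ∂(riemannianVolume g))
      (-∫ p, (χ p * ‖deriv (u p) t‖ ^ 2 +
        ∑ c, gradPairing g χ (fun q => u q t c) p * deriv (u p) t c) ∂(riemannianVolume g)) t := by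
  obtain ⟨hK, hKt⟩ := isCompact_chart_image hs
  have hl := hu.isLocalFlow hΦ
  have hsl := hu.contMDiff_slice (Ioo_subset_Ico_self ht)
  have hη := contDiff_chartCutoff hΦ hχ hs
  have h1 := hl.hasDerivAt_energy hK hKt (η := fun x _ => chartCutoff Φ χ x)
    ((hη.of_le (by simp)).comp contDiff_fst).contDiffOn (fun x hx _ => chartCutoff_eq_zero hx) ht
  have h2 := h1.congr_of_eventuallyEq (f₁ := fun t => 1 / 2 * ∫ p, χ p *
      energyDensity g (fun q => u q t) p ∂(riemannianVolume g)) (by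
    filter_upwards [isOpen_Ioo.mem_nhds ht] with τ hτ
    rw [hu.integral_mul_energyDensity hΦ hχ hs (Ioo_subset_Ico_self hτ)])
  refine h2.congr_deriv ?_
  have hc : Continuous (fun p => χ p * ‖deriv (u p) t‖ ^ 2 +
        ∑ c, gradPairing g χ (fun q => u q t c) p * deriv (u p) t c) :=
    (hχ.continuous.mul ((hu.continuous_deriv ht).norm.pow 2)).add
      (continuous_finsetSum _ fun c _ => (continuous_gradPairing g hχ (contMDiff_coord hsl c)).mul
        ((EuclideanSpace.proj c : Euc k →L[ℝ] ℝ).continuous.comp (hu.continuous_deriv ht)))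
  have hsupp : Function.support (fun p => χ p * ‖deriv (u p) t‖ ^ 2 +
        ∑ c, gradPairing g χ (fun q => u q t c) p * deriv (u p) t c) ⊆ Φ.source := by
    intro p hp
    by_contra hpΦ
    have hpt : p ∉ tsupport χ := fun h => hpΦ (hs h)
    refine hp ?_
    have h0 : χ p = 0 := image_eq_zero_of_notMem_tsupport hpt
    have h3 : ∀ i, partialD i (χ ∘ (chartAt Plane p).symm) (chartAt Plane p p) = 0 := by
      intro i
      have hev : (χ ∘ (chartAt Plane p).symm) =ᶠ[nhds (chartAt Plane p p)] fun _ => 0 := by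
        have hca : ContinuousAt (chartAt Plane p).symm (chartAt Plane p p) :=
          (chartAt Plane p).continuousAt_symm (mem_chart_target Plane p)
        have hmem : (tsupport χ)ᶜ ∈ nhds ((chartAt Plane p).symm (chartAt Plane p p)) := by
          rw [(chartAt Plane p).left_inv (mem_chart_source Plane p)]
          exact (isClosed_tsupport χ).isOpen_compl.mem_nhds hpt
        filter_upwards [hca.eventually hmem] with y hy
        exact image_eq_zero_of_notMem_tsupport (f := χ) hy
      rw [partialD, hev.fderiv_eq]
      simp
    simp [h0, gradPairing, gradInner, h3]
  rw [integral_riemannianVolume_of_support g hΦ hc hsupp, ← integral_neg,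
    ← setIntegral_eq_integral_of_forall_compl_eq_zero (s := Φ.target)]
  · refine setIntegral_congr_fun Φ.open_target.measurableSet fun x hx => ?_
    have hd : DifferentiableAt ℝ (fun y => u (Φ.symm y) t) x :=
      ((contDiffOn_comp_symm hsl hΦ).contDiffAt (Φ.open_target.mem_nhds hx)).differentiableAt
        (by simp)
    simp only [chartCutoff_apply hx, deriv_const, partialD_chartCutoff hx]
    have h4 : ∀ c, gradPairing g χ (fun q => u q t c) (Φ.symm x) =
        ∑ i, ∑ j, (metricMatrix g Φ x)⁻¹ i j * (partialD i (χ ∘ Φ.symm) x *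
          partialD j (fun y => u (Φ.symm y) t) x c) := by
      intro c
      rw [gradPairing_symm_apply g hχ (contMDiff_coord hsl c) hΦ hx, gradInner]
      simp only [← partialD_apply hd]
      rfl
    simp only [h4, flux, conformalCoeff, Fin.sum_univ_two, inner_add_left, inner_smul_left,
      RCLike.conj_to_real, inner_eq_sum, Finset.mul_sum, ← Finset.sum_add_distrib]
    have h5 : ∀ (Q A V n : ℝ) (s s' : Fin k → ℝ), (∑ c, s c = V * ∑ c, s' c) →
        1 / 2 * 0 * Q - A * V * n - ∑ c, s c = -(V * (A * n + ∑ c, s' c)) := by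
      intro Q A V n s s' h
      rw [h]; ring
    refine h5 _ _ _ _ _ _ ?_
    rw [Finset.mul_sum]
    exact Finset.sum_congr rfl fun c _ => by ring
  · intro x hx
    have hxK : x ∉ Φ '' tsupport χ := fun h => hx (hKt h)
    have h6 := fun i => partialD_eq_zero_off hK (fun x hx => chartCutoff_eq_zero hx) i hxK
    simp only [h6, chartCutoff_eq_zero hxK, deriv_const]
    simp

/-- The energy is continuous up to the initial time and decreases at the rate `∫ |u_t|²`. -/
theorem energy_continuousOn_and_hasDerivAt (hu : IsHarmonicHeatFlow g N T u) :
    ContinuousOn (fun t => energy g (fun p => u p t)) (Ico 0 T) ∧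
    ∀ t ∈ Ioo 0 T, HasDerivAt (fun t => energy g (fun p => u p t))
      (-∫ p, ‖deriv (u p) t‖ ^ 2 ∂(riemannianVolume g)) t := by
  have hfin := isFiniteMeasure_riemannianVolume g
  obtain ⟨s, hs⟩ := isCompact_univ.elim_nhds_subcover (fun p : M => (chartAt Plane p).source)
    (fun p _ => chart_source_mem_nhds Plane p)
  obtain ⟨f, hf⟩ := SmoothPartitionOfUnity.exists_isSubordinate 𝓘(ℝ, Plane)
    (isClosed_univ (X := M)) (fun i : s => (chartAt Plane (i : M)).source)
    (fun i => (chartAt Plane (i : M)).open_source) (by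
      intro p _
      obtain ⟨i, hi, hp⟩ := mem_iUnion₂.1 (hs.2 (mem_univ p))
      exact mem_iUnion.2 ⟨⟨i, hi⟩, hp⟩)
  have hsum : ∀ p, ∑ i, f i p = 1 := by
    intro p
    rw [← finsum_eq_sum_of_fintype]
    exact f.sum_eq_one (mem_univ p)
  have hmem : ∀ i : s, chartAt Plane (i : M) ∈ IsManifold.maximalAtlas 𝓘(ℝ, Plane) ∞ M :=
    fun i => IsManifold.chart_mem_maximalAtlas _
  have hint : ∀ {h : M → ℝ}, Continuous h → Integrable h (riemannianVolume g) := fun hh =>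
    hh.integrable_of_hasCompactSupport (HasCompactSupport.of_compactSpace _)
  have hE : ∀ t ∈ Ico 0 T, energy g (fun p => u p t) = ∑ i, 1 / 2 *
      ∫ p, f i p * energyDensity g (fun q => u q t) p ∂(riemannianVolume g) := by
    intro t ht
    have hce := continuous_energyDensity g (hu.contMDiff_slice ht)
    rw [← Finset.mul_sum, ← integral_finsetSum _
      (fun i _ => hint ((f i).contMDiff.continuous.fun_mul hce)), energy]
    congr 2
    funext p
    rw [← Finset.sum_mul, hsum, one_mul]
  constructor
  · refine ContinuousOn.congr ?_ hE
    exact continuousOn_finsetSum _ fun i _ => continuousOn_const.mul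
      (hu.continuousOn_localized (hmem i) (f i).contMDiff (hf i))
  · intro t ht
    have hsl := hu.contMDiff_slice (Ioo_subset_Ico_self ht)
    have h1 : HasDerivAt (fun t => ∑ i, 1 / 2 *
      ∫ p, f i p * energyDensity g (fun q => u q t) p ∂(riemannianVolume g)) _ t :=
      HasDerivAt.fun_sum (u := Finset.univ) fun i _ =>
        hu.hasDerivAt_localized (hmem i) (f i).contMDiff (hf i) ht
    have h2 := h1.congr_of_eventuallyEq (f₁ := fun t => energy g (fun p => u p t)) (by
      filter_upwards [isOpen_Ioo.mem_nhds ht] with τ hτ using hE τ (Ioo_subset_Ico_self hτ))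
    refine h2.congr_deriv ?_
    rw [Finset.sum_neg_distrib, ← integral_finsetSum]
    · congr 2
      funext p
      rw [Finset.sum_add_distrib, ← Finset.sum_mul, hsum, one_mul, Finset.sum_comm]
      -- The weights add up to the constant 1, whose gradient is zero, so all cross terms disappear.
      simp only [← Finset.sum_mul, gradPairing_sum g (fun i => (f i).contMDiff), hsum,
        gradPairing_const]
      simp
    · intro i _
      refine hint (((f i).contMDiff.continuous.mul ((hu.continuous_deriv ht).norm.pow 2)).add
        (continuous_finsetSum _ fun c _ =>
          (continuous_gradPairing g (f i).contMDiff (contMDiff_coord hsl c)).mul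
          ((EuclideanSpace.proj c : Euc k →L[ℝ] ℝ).continuous.comp (hu.continuous_deriv ht))))

theorem energy_antitoneOn (hu : IsHarmonicHeatFlow g N T u) :
    AntitoneOn (fun t => energy g (fun p => u p t)) (Ico 0 T) := by
  obtain ⟨h1, h2⟩ := hu.energy_continuousOn_and_hasDerivAt
  refine antitoneOn_of_deriv_nonpos (convex_Ico 0 T) h1 ?_ ?_
  · rw [interior_Ico]
    exact fun t ht => (h2 t ht).differentiableAt.differentiableWithinAt
  · rw [interior_Ico]
    intro t ht
    rw [(h2 t ht).deriv]
    exact neg_nonpos.2 (integral_nonneg fun p => by positivity)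

end IsHarmonicHeatFlow

theorem energy_nonneg [MeasurableSpace M] {k : ℕ} (g : Metric M) (v : M → Euc k) :
    0 ≤ energy g v :=
  mul_nonneg (by norm_num) (integral_nonneg fun p => energyDensity_nonneg g v p)

end GlobalEnergy

/-! ### Bounds for the coefficients of the operator in an adapted chart. -/

section CoefficientBounds

/-- Bounds on the ball `B_δ` for the coefficients of an operator `m⁻¹ ∂_i (a^{ij} ∂_j)` which is
the Laplacian at the origin. -/
structure CoeffBounds (a : Fin 2 → Fin 2 → Plane → ℝ) (m : Plane → ℝ) (δ L : ℝ) : Prop where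
  pos : 0 < L
  density_lower : ∀ x ∈ Metric.closedBall (0 : Plane) δ, L⁻¹ ≤ m x
  density_upper : ∀ x ∈ Metric.closedBall (0 : Plane) δ, m x ≤ L
  elliptic : ∀ x ∈ Metric.closedBall (0 : Plane) δ, ∀ ξ : Plane,
    L⁻¹ * ‖ξ‖ ^ 2 ≤ ∑ i, ∑ j, a i j x * ξ i * ξ j
  coeff_le : ∀ x ∈ Metric.closedBall (0 : Plane) δ, ∀ i j, |a i j x| ≤ L
  radial_le : ∀ x ∈ Metric.closedBall (0 : Plane) δ, ∀ i j, |radialD (a i j) x| ≤ L * ‖x‖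
  sub_le : ∀ x ∈ Metric.closedBall (0 : Plane) δ, ∀ i j,
    |a i j x - if i = j then m x else 0| ≤ L * ‖x‖

theorem radialD_eq {F : Type*} [NormedAddCommGroup F] [NormedSpace ℝ F] (v : Plane → F)
    (x : Plane) : radialD v x = fderiv ℝ v x x := by
  conv_rhs => rw [plane_eq_sum x]
  simp only [map_sum, map_smul, radialD, partialD]
  rw [← plane_eq_sum x]

theorem norm_sq_plane (ξ : Plane) : ‖ξ‖ ^ 2 = ξ 0 ^ 2 + ξ 1 ^ 2 := by
  rw [EuclideanSpace.norm_sq_eq]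
  simp

variable {M : Type*} [TopologicalSpace M] [ChartedSpace Plane M] [IsManifold 𝓘(ℝ, Plane) ∞ M]

theorem IsAdaptedChart.det_bounds {g : Metric M} {p₀ : M} {δ Λ : ℝ} (hΛ : 0 < Λ)
    {Φ : OpenPartialHomeomorph M Plane} (h : IsAdaptedChart g p₀ δ Λ Φ) {x : Plane}
    (hx : x ∈ Metric.closedBall (0 : Plane) δ) :
    (Λ⁻¹ ≤ volDensity g Φ x ∧ volDensity g Φ x ≤ Λ) ∧ ∀ i j, |metricMatrix g Φ x i j| ≤ Λ := by
  have hb := h.metric_bounds x hx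
  have hs := metricMatrix_symm g Φ x 1 0
  have hdet := metricMatrix_det_pos g h.mem_atlas (h.ball_subset hx)
  simp only [Fin.sum_univ_two, norm_sq_plane] at hb
  have b0 := hb (!₂[1, 0])
  have b1 := hb (!₂[0, 1])
  have bd : ∀ a b : ℝ, _ := fun a b => hb (!₂[a, b])
  have bp := (hb (!₂[1, 1])).2
  have bm := (hb (!₂[1, -1])).2
  have bp' := (hb (!₂[1, 1])).1
  have bm' := (hb (!₂[1, -1])).1
  simp [hs] at b0 b1 bp bm bd bp' bm'
  set A := metricMatrix g Φ x 0 0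
  set B := metricMatrix g Φ x 0 1
  set C := metricMatrix g Φ x 1 1
  have hΛi : 0 < Λ⁻¹ := inv_pos.2 hΛ
  have hD : (metricMatrix g Φ x).det = A * C - B ^ 2 := by
    rw [Matrix.det_fin_two, hs]; ring
  have hA : 0 < A := lt_of_lt_of_le hΛi b0.1
  -- The lower bound at `(-B, A)` reads `Λ⁻¹ (A² + B²) ≤ A det`, whence `det ≥ Λ⁻¹ A ≥ Λ⁻²`.
  have hlow : Λ⁻¹ ^ 2 ≤ A * C - B ^ 2 := by
    have h1 := (bd (-B) A).1
    have h2 : Λ⁻¹ * A ^ 2 ≤ A * (A * C - B ^ 2) := by nlinarith [mul_nonneg hΛi.le (sq_nonneg B)]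
    have h3 : Λ⁻¹ * A ≤ A * C - B ^ 2 := by
      by_contra hcon
      push Not at hcon
      nlinarith
    nlinarith
  have hup : A * C - B ^ 2 ≤ Λ ^ 2 := by nlinarith [sq_nonneg B]
  refine ⟨⟨?_, ?_⟩, ?_⟩
  · rw [volDensity, hD]
    exact Real.le_sqrt_of_sq_le hlow
  · rw [volDensity, hD]
    exact Real.sqrt_le_iff.2 ⟨hΛ.le, hup⟩
  · have hC : 0 < C := lt_of_lt_of_le hΛi b1.1
    have hBΛ : |B| ≤ Λ := by
      rw [abs_le]
      constructor <;> nlinarith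
    intro i j
    fin_cases i <;> fin_cases j
    · exact (abs_of_pos hA).trans_le b0.2
    · exact hBΛ
    · change |metricMatrix g Φ x 1 0| ≤ Λ
      rw [hs]; exact hBΛ
    · exact (abs_of_pos hC).trans_le b1.2

/-- The entries of the adjugate of a symmetric `2 × 2` matrix, up to sign. -/
theorem conformalCoeff_eq (g : Metric M) {Φ : OpenPartialHomeomorph M Plane}
    (hΦ : Φ ∈ IsManifold.maximalAtlas 𝓘(ℝ, Plane) ∞ M) {x : Plane} (hx : x ∈ Φ.target)
    (i j : Fin 2) : conformalCoeff g Φ i j x =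
      (if i = j then 1 else -1) * metricMatrix g Φ x (1 - i) (1 - j) / volDensity g Φ x := by
  have hv := volDensity_pos g hΦ hx
  have hd : (metricMatrix g Φ x).det = volDensity g Φ x ^ 2 :=
    (Real.sq_sqrt (metricMatrix_det_pos g hΦ hx).le).symm
  have hs := metricMatrix_symm g Φ x 1 0
  rw [conformalCoeff, inv_fin_two, hd]
  fin_cases i <;> fin_cases j <;> simp <;> field_simp
  · rw [hs]
  · rw [hs]

/-- The derivative is `∇det / (2 √det)`: the numerator is a sum of four products, each at most `Λ²`,
and `1 / (2 √det) ≤ Λ / 2`. -/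
theorem fderiv_volDensity_le {g : Metric M} {p₀ : M} {δ Λ : ℝ} (hΛ : 0 < Λ)
    {Φ : OpenPartialHomeomorph M Plane} (h : IsAdaptedChart g p₀ δ Λ Φ) {x : Plane}
    (hx : x ∈ Metric.closedBall (0 : Plane) δ) : ‖fderiv ℝ (volDensity g Φ) x‖ ≤ 2 * Λ ^ 3 := by
  have hxt := h.ball_subset hx
  obtain ⟨⟨hm, -⟩, hg⟩ := h.det_bounds hΛ hx
  have hd := fun i j => (((metricMatrix_contDiffOn g h.mem_atlas i j).contDiffAt
    (Φ.open_target.mem_nhds hxt)).differentiableAt (by simp)).hasFDerivAt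
  have hb := h.fderiv_metric_bound x hx
  have hD := ((hd 0 0).mul (hd 1 1)).sub ((hd 0 1).mul (hd 1 0))
  have hD' : HasFDerivAt (fun x => (metricMatrix g Φ x).det) _ x :=
    hD.congr_of_eventuallyEq (Filter.Eventually.of_forall fun y => Matrix.det_fin_two _)
  have hpos := metricMatrix_det_pos g h.mem_atlas hxt
  have hV : HasFDerivAt (volDensity g Φ) _ x := hD'.sqrt hpos.ne'
  rw [hV.fderiv, norm_smul]
  have key : ∀ i j k l, ‖metricMatrix g Φ x i j • fderiv ℝ (fun z => metricMatrix g Φ z k l) x‖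
      ≤ Λ ^ 2 := by
    intro i j k l
    rw [norm_smul, Real.norm_eq_abs, sq]
    exact mul_le_mul (hg i j) (hb k l) (norm_nonneg _) hΛ.le
  have h1 : ‖metricMatrix g Φ x 0 0 • fderiv ℝ (fun z => metricMatrix g Φ z 1 1) x +
      metricMatrix g Φ x 1 1 • fderiv ℝ (fun z => metricMatrix g Φ z 0 0) x -
      (metricMatrix g Φ x 0 1 • fderiv ℝ (fun z => metricMatrix g Φ z 1 0) x +
      metricMatrix g Φ x 1 0 • fderiv ℝ (fun z => metricMatrix g Φ z 0 1) x)‖ ≤ 4 * Λ ^ 2 := by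
    refine (norm_sub_le _ _).trans ?_
    have e1 := norm_add_le (metricMatrix g Φ x 0 0 • fderiv ℝ (fun z => metricMatrix g Φ z 1 1) x)
      (metricMatrix g Φ x 1 1 • fderiv ℝ (fun z => metricMatrix g Φ z 0 0) x)
    have e2 := norm_add_le (metricMatrix g Φ x 0 1 • fderiv ℝ (fun z => metricMatrix g Φ z 1 0) x)
      (metricMatrix g Φ x 1 0 • fderiv ℝ (fun z => metricMatrix g Φ z 0 1) x)
    linarith [key 0 0 1 1, key 1 1 0 0, key 0 1 1 0, key 1 0 0 1]
  have h2 : ‖1 / (2 * √(metricMatrix g Φ x).det)‖ ≤ Λ / 2 := by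
    have hm' : Λ⁻¹ ≤ √(metricMatrix g Φ x).det := hm
    have hp : 0 < √(metricMatrix g Φ x).det := Real.sqrt_pos.2 hpos
    rw [Real.norm_of_nonneg (by positivity), div_le_div_iff₀ (by positivity) (by norm_num)]
    have := mul_le_mul_of_nonneg_left hm' hΛ.le
    rw [mul_inv_cancel₀ hΛ.ne'] at this
    linarith
  calc _ ≤ Λ / 2 * (4 * Λ ^ 2) := mul_le_mul h2 h1 (norm_nonneg _) (by positivity)
    _ = 2 * Λ ^ 3 := by ring

/-- The quotient rule for `± g_{kl} / √det` gives `Λ · Λ` from the entry and `Λ · Λ² · 2Λ³` from the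
density. -/
theorem fderiv_conformalCoeff_le {g : Metric M} {p₀ : M} {δ Λ : ℝ} (hΛ : 0 < Λ)
    {Φ : OpenPartialHomeomorph M Plane} (h : IsAdaptedChart g p₀ δ Λ Φ) {x : Plane}
    (hx : x ∈ Metric.closedBall (0 : Plane) δ) (i j : Fin 2) :
    ‖fderiv ℝ (conformalCoeff g Φ i j) x‖ ≤ Λ ^ 2 + 2 * Λ ^ 6 := by
  have hxt := h.ball_subset hx
  obtain ⟨⟨hm, -⟩, hg⟩ := h.det_bounds hΛ hx
  have hv := volDensity_pos g h.mem_atlas hxt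
  have hmi : ‖(volDensity g Φ x)⁻¹‖ ≤ Λ := by
    rw [Real.norm_of_nonneg (by positivity)]
    exact inv_le_of_inv_le₀ hΛ hm
  have hd := (((metricMatrix_contDiffOn g h.mem_atlas (1 - i) (1 - j)).contDiffAt
    (Φ.open_target.mem_nhds hxt)).differentiableAt (by simp)).hasFDerivAt
  have hdm := (((volDensity_contDiffOn g h.mem_atlas).contDiffAt
    (Φ.open_target.mem_nhds hxt)).differentiableAt (by simp)).hasFDerivAt
  have hq := (hd.const_mul (if i = j then 1 else -1)).mul
    ((hasDerivAt_inv hv.ne').comp_hasFDerivAt x hdm)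
  have hq' : HasFDerivAt (conformalCoeff g Φ i j) _ x := hq.congr_of_eventuallyEq (by
    filter_upwards [Φ.open_target.mem_nhds hxt] with y hy
    rw [conformalCoeff_eq g h.mem_atlas hy, div_eq_mul_inv]
    rfl)
  have hsgn : ‖(if i = j then 1 else -1 : ℝ)‖ = 1 := by split_ifs <;> simp
  rw [hq'.fderiv]
  refine (norm_add_le _ _).trans ?_
  have e1 : ‖(if i = j then 1 else -1 : ℝ) * metricMatrix g Φ x (1 - i) (1 - j)‖ ≤ Λ := by
    rw [norm_mul, hsgn, one_mul]
    exact hg _ _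
  have e2 : ‖(-(volDensity g Φ x ^ 2)⁻¹) • fderiv ℝ (volDensity g Φ) x‖ ≤ Λ ^ 2 * (2 * Λ ^ 3) := by
    rw [norm_smul, norm_neg, ← inv_pow, norm_pow]
    exact mul_le_mul (pow_le_pow_left₀ (norm_nonneg _) hmi 2) (fderiv_volDensity_le hΛ h hx)
      (norm_nonneg _) (by positivity)
  have e3 : ‖(if i = j then 1 else -1 : ℝ) •
      fderiv ℝ (fun y => metricMatrix g Φ y (1 - i) (1 - j)) x‖ ≤ Λ := by
    rw [norm_smul, hsgn, one_mul]
    exact h.fderiv_metric_bound x hx _ _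
  calc _ ≤ Λ * (Λ ^ 2 * (2 * Λ ^ 3)) + Λ * Λ :=
        add_le_add ((norm_smul_le _ _).trans (mul_le_mul e1 e2 (norm_nonneg _) hΛ.le))
          ((norm_smul_le _ _).trans (mul_le_mul hmi e3 (norm_nonneg _) hΛ.le))
    _ = Λ ^ 2 + 2 * Λ ^ 6 := by ring

theorem IsAdaptedChart.coeffBounds {g : Metric M} {p₀ : M} {δ Λ : ℝ} (hδ : 0 < δ) (hΛ : 0 < Λ)
    {Φ : OpenPartialHomeomorph M Plane} (h : IsAdaptedChart g p₀ δ Λ Φ) :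
    CoeffBounds (conformalCoeff g Φ) (volDensity g Φ) δ (5 * (1 + Λ) ^ 6) := by
  -- A single generous constant: its expansion dominates, term by term, `1`, `Λ`, `Λ²` and the
  -- largest bound that occurs, `Λ² + 2Λ⁶ + 2Λ³`.
  set L : ℝ := 5 * (1 + Λ) ^ 6 with hL
  have hLpos : 0 < L := by positivity
  have hLexp : L = 5 + 30 * Λ + 75 * Λ ^ 2 + 100 * Λ ^ 3 + 75 * Λ ^ 4 + 30 * Λ ^ 5 + 5 * Λ ^ 6 := by
    rw [hL]; ring
  have p2 : 0 ≤ Λ ^ 2 := by positivity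
  have p3 : 0 ≤ Λ ^ 3 := by positivity
  have p4 : 0 ≤ Λ ^ 4 := by positivity
  have p5 : 0 ≤ Λ ^ 5 := by positivity
  have p6 : 0 ≤ Λ ^ 6 := by positivity
  have hball : ∀ x ∈ Metric.closedBall (0 : Plane) δ, x ∈ Φ.target := fun x hx => h.ball_subset hx
  have hda := fun i j x (hx : x ∈ Metric.closedBall (0 : Plane) δ) =>
    ((conformalCoeff_contDiffOn g h.mem_atlas i j).contDiffAt
      (Φ.open_target.mem_nhds (hball x hx))).differentiableAt (by simp)
  have hdm := fun x (hx : x ∈ Metric.closedBall (0 : Plane) δ) =>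
    ((volDensity_contDiffOn g h.mem_atlas).contDiffAt
      (Φ.open_target.mem_nhds (hball x hx))).differentiableAt (by simp)
  have hmi : ∀ x ∈ Metric.closedBall (0 : Plane) δ, Λ⁻¹ ≤ (volDensity g Φ x)⁻¹ ∧
      (volDensity g Φ x)⁻¹ ≤ Λ := by
    intro x hx
    obtain ⟨⟨h1, h2⟩, -⟩ := h.det_bounds hΛ hx
    have hv := volDensity_pos g h.mem_atlas (hball x hx)
    exact ⟨inv_anti₀ hv h2, inv_le_of_inv_le₀ hΛ h1⟩
  have hsgn : ∀ i j : Fin 2, |(if i = j then 1 else -1 : ℝ)| = 1 := fun i j => by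
    split_ifs <;> simp
  refine ⟨hLpos, fun x hx => ?_, fun x hx => ?_, fun x hx ξ => ?_, fun x hx i j => ?_,
    fun x hx i j => ?_, fun x hx i j => ?_⟩
  · exact (inv_anti₀ hΛ (by rw [hLexp]; linarith)).trans (h.det_bounds hΛ hx).1.1
  · exact (h.det_bounds hΛ hx).1.2.trans (by rw [hLexp]; linarith)
  · have hxt := hball x hx
    have hb := (h.metric_bounds x hx (!₂[-ξ 1, ξ 0])).1
    have hs := metricMatrix_symm g Φ x 1 0
    have he : ∑ i, ∑ j, conformalCoeff g Φ i j x * ξ i * ξ j = (volDensity g Φ x)⁻¹ *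
        ∑ i, ∑ j, metricMatrix g Φ x i j * (!₂[-ξ 1, ξ 0] : Plane) i *
          (!₂[-ξ 1, ξ 0] : Plane) j := by
      simp only [Fin.sum_univ_two, conformalCoeff_eq g h.mem_atlas hxt]
      simp
      ring
    have hn : ‖(!₂[-ξ 1, ξ 0] : Plane)‖ ^ 2 = ‖ξ‖ ^ 2 := by
      rw [norm_sq_plane, norm_sq_plane]
      simp
      ring
    rw [he]
    rw [hn] at hb
    have hLi : L⁻¹ ≤ Λ⁻¹ * Λ⁻¹ := by
      rw [← mul_inv]
      exact inv_anti₀ (by positivity) (by rw [hLexp]; nlinarith)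
    calc L⁻¹ * ‖ξ‖ ^ 2 ≤ Λ⁻¹ * Λ⁻¹ * ‖ξ‖ ^ 2 := mul_le_mul_of_nonneg_right hLi (by positivity)
      _ = Λ⁻¹ * (Λ⁻¹ * ‖ξ‖ ^ 2) := by ring
      _ ≤ _ := mul_le_mul (hmi x hx).1 hb (by positivity)
        ((inv_pos.2 hΛ).le.trans (hmi x hx).1)
  · rw [conformalCoeff_eq g h.mem_atlas (hball x hx), div_eq_mul_inv, abs_mul, abs_mul, hsgn,
      one_mul, abs_of_pos (inv_pos.2 (volDensity_pos g h.mem_atlas (hball x hx)))]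
    calc _ ≤ Λ * Λ := mul_le_mul ((h.det_bounds hΛ hx).2 _ _) (hmi x hx).2
          (inv_pos.2 (volDensity_pos g h.mem_atlas (hball x hx))).le hΛ.le
      _ ≤ L := by rw [hLexp]; nlinarith
  · rw [radialD_eq]
    refine ((fderiv ℝ (conformalCoeff g Φ i j) x).le_opNorm x).trans
      (mul_le_mul_of_nonneg_right ?_ (norm_nonneg _))
    refine (fderiv_conformalCoeff_le hΛ h hx i j).trans (by rw [hLexp]; linarith)
  · set e : Plane → ℝ := fun x => conformalCoeff g Φ i j x - if i = j then volDensity g Φ x else 0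
      with he
    have h0 : (0 : Plane) ∈ Metric.closedBall (0 : Plane) δ := by simp [hδ.le]
    have hv0 : volDensity g Φ 0 = 1 := by simp [volDensity, h.metric_zero]
    have he0 : e 0 = 0 := by
      simp only [he, hv0, conformalCoeff, h.metric_zero, inv_one, Matrix.one_apply, one_mul]
      split_ifs <;> simp
    have hed : ∀ y ∈ Metric.closedBall (0 : Plane) δ, DifferentiableAt ℝ e y ∧
        ‖fderiv ℝ e y‖ ≤ L := by
      intro y hy
      have b1 := fderiv_conformalCoeff_le hΛ h hy i j
      have b2 := fderiv_volDensity_le hΛ h hy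
      by_cases hij : i = j
      · have : e = fun x => conformalCoeff g Φ i j x - volDensity g Φ x := by
          simp [he, hij]
        rw [this]
        refine ⟨(hda i j y hy).fun_sub (hdm y hy), ?_⟩
        rw [fderiv_fun_sub (hda i j y hy) (hdm y hy)]
        refine (norm_sub_le _ _).trans ?_
        rw [hLexp]; linarith
      · have : e = conformalCoeff g Φ i j := by
          simp [he, hij]
        rw [this]
        exact ⟨hda i j y hy, b1.trans (by rw [hLexp]; linarith)⟩
    have := (convex_closedBall (0 : Plane) δ).norm_image_sub_le_of_norm_fderiv_le
      (fun y hy => (hed y hy).1) (fun y hy => (hed y hy).2) h0 hx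
    rw [he0, sub_zero, sub_zero] at this
    exact this

end CoefficientBounds

/-! ### Completing the square, error terms and Gaussian tails. -/

section PointwiseEstimates

variable {k : ℕ}

/-- Absorption of a product by a quadratic term. -/
theorem mul_le_quarter_add {L m α b : ℝ} (hL : 0 < L) (hm : L⁻¹ ≤ m) :
    α * b ≤ 1 / 4 * m * b ^ 2 + L * α ^ 2 := by
  have h1 : 0 ≤ (b - 2 * L * α) ^ 2 * L⁻¹ := by positivity
  have h2 : (b - 2 * L * α) ^ 2 * L⁻¹ = L⁻¹ * b ^ 2 - 4 * α * b + 4 * L * α ^ 2 := by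
    field_simp
    ring
  have h3 : L⁻¹ * b ^ 2 ≤ m * b ^ 2 := mul_le_mul_of_nonneg_right hm (sq_nonneg b)
  linarith

/-- Here `μ = 1/(2τ)`, `X = x·∇f`, `w = f_t`, `P` is the flux and `p` the part of `∇η` from the
cut-off. The energy and Pohozaev integrands are added; the `Q` terms from `η_t` and from the
Gaussian part of `x·∇η` cancel. What accompanies the square vanishes when `Σ x_i P_i = m X`, `p = 0`
and `Z = 0`, as for the flat metric without cut-off. -/
theorem integrand_identity (μ m η Q Z : ℝ) (x p : Fin 2 → ℝ) (P : Fin 2 → Euc k) (X w : Euc k) :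
    1 / 2 * (-(μ ^ 2 * (x 0 ^ 2 + x 1 ^ 2)) * η) * Q - η * m * ‖w‖ ^ 2 -
      ∑ i, (-(μ * x i * η) + p i) * inner ℝ (P i) w +
      (μ * η * m * inner ℝ w X + (∑ i, μ * (-(μ * x i * η) + p i) * inner ℝ (P i) X) -
        1 / 2 * (∑ i, x i * (μ * (-(μ * x i * η) + p i))) * Q - 1 / 2 * (μ * η) * Z) =
      -(η * m * ‖w - μ • X‖ ^ 2) +
        μ * η * inner ℝ ((∑ i, x i • P i) - m • X) (w - μ • X) -
        inner ℝ (∑ i, p i • P i) (w - μ • X) - μ / 2 * (∑ i, x i * p i) * Q - μ / 2 * η * Z := by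
  rw [← real_inner_self_eq_norm_sq, ← real_inner_self_eq_norm_sq]
  simp only [Fin.sum_univ_two, inner_sub_left, inner_sub_right, inner_add_left, inner_add_right,
    inner_smul_left, inner_smul_right, RCLike.conj_to_real, real_inner_comm X w]
  ring

/-- The two products linear in `v` each consume a quarter of `m |v|²`, so half of the dissipation
survives. Metric errors keep the factor `φ²`; cut-off errors lose it but carry `q = |∇φ|`. -/
theorem integrand_bound {L m μ G φ q r s Q Z y : ℝ} {v R W : Euc k} (hL : 0 < L) (hm : L⁻¹ ≤ m)
    (hμ : 0 ≤ μ) (hG : 0 ≤ G) (hφ0 : 0 ≤ φ) (hφ1 : φ ≤ 1) (hr : 0 ≤ r)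
    (hs2 : s ^ 2 ≤ 2 * L * Q) (hR : ‖R‖ ≤ 2 * L * r ^ 2 * s)
    (hW : ‖W‖ ≤ 2 * q * L * s) (hy : |y| ≤ q * r) (hZ : |Z| ≤ L * r * s ^ 2) :
    -(G * φ ^ 2 * m * ‖v‖ ^ 2) + μ * (G * φ ^ 2) * inner ℝ R v - 2 * G * φ * inner ℝ W v -
      μ * G * φ * y * Q - μ / 2 * (G * φ ^ 2) * Z ≤
      -(1 / 2 * (G * φ ^ 2 * m * ‖v‖ ^ 2)) +
        (8 * L ^ 4 * (μ * r ^ 2) ^ 2 + L ^ 2 * (μ * r)) * (G * φ ^ 2 * Q) +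
        (32 * q ^ 2 * L ^ 4 + μ * q * r) * (G * Q) := by
  have hQ : 0 ≤ Q := by
    have : 0 ≤ 2 * L * Q := (sq_nonneg s).trans hs2
    exact nonneg_of_mul_nonneg_right this (by positivity)
  have e1 : μ * inner ℝ R v ≤ 1 / 4 * m * ‖v‖ ^ 2 + 8 * L ^ 4 * (μ * r ^ 2) ^ 2 * Q := by
    have h1 : inner ℝ R v ≤ 2 * L * r ^ 2 * s * ‖v‖ :=
      (real_inner_le_norm R v).trans (mul_le_mul_of_nonneg_right hR (norm_nonneg _))
    have h2 := mul_le_quarter_add (α := μ * (2 * L * r ^ 2 * s)) (b := ‖v‖) hL hm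
    have h3 : L * (μ * (2 * L * r ^ 2 * s)) ^ 2 ≤ 8 * L ^ 4 * (μ * r ^ 2) ^ 2 * Q := by
      have := mul_le_mul_of_nonneg_left hs2
        (show 0 ≤ 4 * L ^ 3 * (μ * r ^ 2) ^ 2 by positivity)
      nlinarith
    have h4 := mul_le_mul_of_nonneg_left h1 hμ
    linarith
  have e2 : -(2 * φ * inner ℝ W v) ≤ 1 / 4 * m * (φ * ‖v‖) ^ 2 + 32 * q ^ 2 * L ^ 4 * Q := by
    have h1 : -inner ℝ W v ≤ 2 * q * L * s * ‖v‖ := by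
      refine (neg_le_abs _).trans ((abs_real_inner_le_norm W v).trans ?_)
      exact mul_le_mul_of_nonneg_right hW (norm_nonneg _)
    have h2 := mul_le_quarter_add (α := 4 * q * L * s) (b := φ * ‖v‖) hL hm
    have h3 : L * (4 * q * L * s) ^ 2 ≤ 32 * q ^ 2 * L ^ 4 * Q := by
      have := mul_le_mul_of_nonneg_left hs2 (show 0 ≤ 16 * L ^ 3 * q ^ 2 by positivity)
      nlinarith
    have h4 := mul_le_mul_of_nonneg_left h1 (show 0 ≤ 2 * φ by positivity)
    linarith
  have e3 : -(φ * y) ≤ q * r := by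
    have h1 : -(φ * y) ≤ |φ * y| := neg_le_abs _
    rw [abs_mul, abs_of_nonneg hφ0] at h1
    have h2 : φ * |y| ≤ 1 * |y| := mul_le_mul_of_nonneg_right hφ1 (abs_nonneg _)
    linarith
  have e4 : -(1 / 2 * Z) ≤ L ^ 2 * r * Q := by
    have h1 := (neg_le_abs Z).trans hZ
    have h2 := mul_le_mul_of_nonneg_left hs2 (show 0 ≤ L * r by positivity)
    nlinarith
  have f1 := mul_le_mul_of_nonneg_left e1 (show 0 ≤ G * φ ^ 2 by positivity)
  have f2 := mul_le_mul_of_nonneg_left e2 hG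
  have f3 := mul_le_mul_of_nonneg_left e3 (show 0 ≤ μ * G * Q by positivity)
  have f4 := mul_le_mul_of_nonneg_left e4 (show 0 ≤ μ * (G * φ ^ 2) by positivity)
  nlinarith

theorem exp_neg_le_pow {y : ℝ} (hy : 0 < y) (n : ℕ) : Real.exp (-y) ≤ n.factorial / y ^ n := by
  have := Real.pow_div_factorial_le_exp y hy.le n
  rw [Real.exp_neg, inv_le_comm₀ (Real.exp_pos _) (by positivity), inv_div]
  exact this

/-- The radius `τ^{3/8}` separates two regimes. Inside, `r/τ` and `r⁴/τ²` are at most `τ^{-5/8}`,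
which is integrable at `τ = 0`. Outside, `r²/τ ≥ τ^{-1/4}`, so the exponential beats every power of
`τ`. -/
theorem gaussian_tail_bounds {δ κ : ℝ} (hδ : 0 < δ) (hκ : 1 < κ) :
    ∃ C : ℝ, 0 < C ∧ ∀ τ : ℝ, 0 < τ → τ ≤ 1 → ∀ r : ℝ, 0 ≤ r → r ≤ δ →
      (r / τ + r ^ 4 / τ ^ 2) * Real.exp (-r ^ 2 / (4 * τ)) ≤
        2 * τ ^ (-5 / 8 : ℝ) * Real.exp (-r ^ 2 / (4 * τ)) + C * τ ^ (κ - 1) ∧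
      (δ / 2 ≤ r → (1 + 1 / τ) * Real.exp (-r ^ 2 / (4 * τ)) ≤ C * τ ^ (κ - 1)) := by
  -- The choice makes `-2 + n/4` and `-1 + n` at least `κ - 1`, the exponents that remain in the two
  -- tail estimates.
  obtain ⟨n, hn⟩ := exists_nat_ge (4 * (κ + 1))
  set C₁ : ℝ := (δ + δ ^ 4) * (n.factorial * 4 ^ n) with hC₁
  set C₂ : ℝ := 2 * (n.factorial * (16 / δ ^ 2) ^ n) with hC₂
  have hC₁pos : 0 < C₁ := by positivity
  have hC₂pos : 0 < C₂ := by positivity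
  refine ⟨C₁ + C₂, by positivity, fun τ hτ hτ1 r hr hrδ => ⟨?_, fun hrδ' => ?_⟩⟩
  · have hτp : 0 < τ ^ (κ - 1) := Real.rpow_pos_of_pos hτ _
    rcases le_or_gt r (τ ^ (3 / 8 : ℝ)) with h | h
    · have h1 : r / τ ≤ τ ^ (-5 / 8 : ℝ) := by
        rw [div_le_iff₀ hτ]
        calc r ≤ τ ^ (3 / 8 : ℝ) := h
          _ = τ ^ (-5 / 8 : ℝ) * τ := by
            rw [← Real.rpow_add_one hτ.ne']; norm_num
      have h2 : r ^ 4 / τ ^ 2 ≤ τ ^ (-5 / 8 : ℝ) := by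
        rw [div_le_iff₀ (by positivity)]
        calc r ^ 4 ≤ (τ ^ (3 / 8 : ℝ)) ^ 4 := pow_le_pow_left₀ hr h 4
          _ = τ ^ (3 / 2 : ℝ) := by
            rw [← Real.rpow_natCast, ← Real.rpow_mul hτ.le]; norm_num
          _ ≤ τ ^ (11 / 8 : ℝ) := Real.rpow_le_rpow_of_exponent_ge hτ hτ1 (by norm_num)
          _ = τ ^ (-5 / 8 : ℝ) * τ ^ 2 := by
            rw [← Real.rpow_natCast τ 2, ← Real.rpow_add hτ]; norm_num
      have h3 : (r / τ + r ^ 4 / τ ^ 2) * Real.exp (-r ^ 2 / (4 * τ)) ≤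
          2 * τ ^ (-5 / 8 : ℝ) * Real.exp (-r ^ 2 / (4 * τ)) :=
        mul_le_mul_of_nonneg_right (by linarith) (Real.exp_pos _).le
      have : 0 ≤ (C₁ + C₂) * τ ^ (κ - 1) := by positivity
      linarith
    · have h1 : Real.exp (-r ^ 2 / (4 * τ)) ≤ Real.exp (-(τ ^ (-1 / 4 : ℝ) / 4)) := by
        apply Real.exp_le_exp.2
        rw [neg_div, neg_le_neg_iff, div_le_div_iff₀ (by norm_num) (by positivity)]
        have : (τ ^ (3 / 8 : ℝ)) ^ 2 ≤ r ^ 2 := pow_le_pow_left₀ (by positivity) h.le 2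
        have h2 : (τ ^ (3 / 8 : ℝ)) ^ 2 = τ ^ (-1 / 4 : ℝ) * τ := by
          rw [← Real.rpow_natCast, ← Real.rpow_mul hτ.le, ← Real.rpow_add_one hτ.ne']; norm_num
        linarith
      have h2 : Real.exp (-(τ ^ (-1 / 4 : ℝ) / 4)) ≤ n.factorial * 4 ^ n * τ ^ ((n : ℝ) / 4) := by
        have h3 := exp_neg_le_pow (y := τ ^ (-1 / 4 : ℝ) / 4)
          (by have := Real.rpow_pos_of_pos hτ (-1 / 4); positivity) n
        refine h3.trans (le_of_eq ?_)
        have h4 : (τ ^ (-1 / 4 : ℝ)) ^ n = (τ ^ ((n : ℝ) / 4))⁻¹ := by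
          rw [← Real.rpow_natCast, ← Real.rpow_mul hτ.le, ← Real.rpow_neg hτ.le]
          congr 1; ring
        rw [div_pow, h4]
        have := (Real.rpow_pos_of_pos hτ ((n : ℝ) / 4)).ne'
        field_simp
      have h3 : r / τ + r ^ 4 / τ ^ 2 ≤ (δ + δ ^ 4) * τ ^ (-2 : ℝ) := by
        have hτ2 : τ ^ (-2 : ℝ) = 1 / τ ^ 2 := by
          rw [Real.rpow_neg hτ.le, one_div]; norm_num
        rw [hτ2]
        have i1 : r / τ ≤ δ * (1 / τ ^ 2) := by
          rw [mul_one_div, div_le_div_iff₀ hτ (by positivity)]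
          have h5 : r * τ ≤ δ * 1 := mul_le_mul hrδ hτ1 hτ.le hδ.le
          calc r * τ ^ 2 = r * τ * τ := by ring
            _ ≤ δ * τ := by rw [mul_one] at h5; exact mul_le_mul_of_nonneg_right h5 hτ.le
        have i2 : r ^ 4 / τ ^ 2 ≤ δ ^ 4 * (1 / τ ^ 2) := by
          rw [mul_one_div]
          exact div_le_div_of_nonneg_right (pow_le_pow_left₀ hr hrδ 4) (by positivity)
        linarith
      have h4 : (r / τ + r ^ 4 / τ ^ 2) * Real.exp (-r ^ 2 / (4 * τ)) ≤ C₁ * τ ^ (κ - 1) := by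
        calc _ ≤ (δ + δ ^ 4) * τ ^ (-2 : ℝ) * (n.factorial * 4 ^ n * τ ^ ((n : ℝ) / 4)) :=
              mul_le_mul h3 (h1.trans h2) (Real.exp_pos _).le (by positivity)
          _ = C₁ * τ ^ (-2 + (n : ℝ) / 4) := by rw [Real.rpow_add hτ, hC₁]; ring
          _ ≤ C₁ * τ ^ (κ - 1) := mul_le_mul_of_nonneg_left
              (Real.rpow_le_rpow_of_exponent_ge hτ hτ1 (by linarith)) hC₁pos.le
      have h5 : 0 ≤ C₂ * τ ^ (κ - 1) := by positivity
      have h6 : 0 ≤ 2 * τ ^ (-5 / 8 : ℝ) * Real.exp (-r ^ 2 / (4 * τ)) := by positivity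
      linarith
  · have hτp : 0 < τ ^ (κ - 1) := Real.rpow_pos_of_pos hτ _
    have h1 : Real.exp (-r ^ 2 / (4 * τ)) ≤ Real.exp (-(δ ^ 2 / (16 * τ))) := by
      apply Real.exp_le_exp.2
      rw [neg_div, neg_le_neg_iff, div_le_div_iff₀ (by positivity) (by positivity)]
      have : (δ / 2) ^ 2 ≤ r ^ 2 := pow_le_pow_left₀ (by positivity) hrδ' 2
      nlinarith
    have h2 : Real.exp (-(δ ^ 2 / (16 * τ))) ≤ n.factorial * (16 / δ ^ 2) ^ n * τ ^ (n : ℝ) := by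
      refine (exp_neg_le_pow (y := δ ^ 2 / (16 * τ)) (by positivity) n).trans (le_of_eq ?_)
      rw [Real.rpow_natCast, div_pow, div_pow, mul_pow]
      field_simp
    have h3 : 1 + 1 / τ ≤ 2 * τ ^ (-1 : ℝ) := by
      rw [Real.rpow_neg_one, ← one_div]
      have : 1 ≤ 1 / τ := by rw [le_div_iff₀ hτ]; linarith
      linarith
    have h4 : (1 + 1 / τ) * Real.exp (-r ^ 2 / (4 * τ)) ≤ C₂ * τ ^ (κ - 1) := by
      calc _ ≤ 2 * τ ^ (-1 : ℝ) * (n.factorial * (16 / δ ^ 2) ^ n * τ ^ (n : ℝ)) :=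
            mul_le_mul h3 (h1.trans h2) (Real.exp_pos _).le (by positivity)
        _ = C₂ * τ ^ (-1 + (n : ℝ)) := by rw [Real.rpow_add hτ, hC₂]; ring
        _ ≤ C₂ * τ ^ (κ - 1) := mul_le_mul_of_nonneg_left
            (Real.rpow_le_rpow_of_exponent_ge hτ hτ1 (by linarith)) hC₂pos.le
    have h5 : 0 ≤ C₁ * τ ^ (κ - 1) := by positivity
    linarith

end PointwiseEstimates

/-! ### The localized backward Gaussian and its derivatives. -/

section Weight

/-- The squared cut-off function times the backward Gaussian with singularity at time `T`. -/
def heatWeight (φ : Plane → ℝ) (T : ℝ) (x : Plane) (t : ℝ) : ℝ :=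
  Real.exp (-‖x‖ ^ 2 / (4 * (T - t))) * φ x ^ 2

variable {φ : Plane → ℝ} {T t : ℝ}

theorem contDiffOn_gaussian {I : Set ℝ} (hI : ∀ t ∈ I, t < T) {n : ℕ∞ω} :
    ContDiffOn ℝ n (Function.uncurry fun (x : Plane) t => Real.exp (-‖x‖ ^ 2 / (4 * (T - t))))
      (univ ×ˢ I) := by
  refine Real.contDiff_exp.comp_contDiffOn (ContDiffOn.div ?_ ?_ ?_)
  · exact ((contDiff_fst.norm_sq ℝ).neg).contDiffOn
  · exact (contDiff_const.mul (contDiff_const.sub contDiff_snd)).contDiffOn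
  · rintro ⟨x, t⟩ ⟨-, ht⟩
    have := hI t ht
    have : 0 < T - t := by linarith
    positivity

theorem contDiffOn_heatWeight {I : Set ℝ} (hI : ∀ t ∈ I, t < T) {n : ℕ∞ω}
    (hφ : ContDiff ℝ n φ) :
    ContDiffOn ℝ n (Function.uncurry (heatWeight φ T)) (univ ×ˢ I) := by
  have h1 : ContDiff ℝ n (fun z : Plane × ℝ => φ z.1 ^ 2) := (hφ.comp contDiff_fst).pow 2
  exact (contDiffOn_gaussian hI).mul h1.contDiffOn

theorem contDiff_heatWeight {n : ℕ∞ω} (hφ : ContDiff ℝ n φ) :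
    ContDiff ℝ n (fun x => heatWeight φ T x t) := by
  have h1 : ContDiff ℝ n (fun x : Plane => Real.exp (-‖x‖ ^ 2 / (4 * (T - t)))) :=
    Real.contDiff_exp.comp ((contDiff_id.norm_sq ℝ).neg.div_const _)
  exact h1.mul (hφ.pow 2)

theorem heatWeight_nonneg (x : Plane) : 0 ≤ heatWeight φ T x t := by
  unfold heatWeight
  positivity

theorem deriv_heatWeight (ht : t < T) (x : Plane) :
    deriv (heatWeight φ T x) t =
      -((1 / (2 * (T - t))) ^ 2 * (x 0 ^ 2 + x 1 ^ 2)) * heatWeight φ T x t := by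
  have h0 : T - t ≠ 0 := by linarith
  have h1 : HasDerivAt (fun τ : ℝ => 4 * (T - τ)) (4 * (-1)) t :=
    ((hasDerivAt_id t).const_sub T).const_mul 4
  have h2 := ((((hasDerivAt_const t (-‖x‖ ^ 2)).div h1 (by positivity)).exp).mul_const (φ x ^ 2))
  have h3 : heatWeight φ T x = fun τ => Real.exp (-‖x‖ ^ 2 / (4 * (T - τ))) * φ x ^ 2 := rfl
  rw [h3]
  refine h2.deriv.trans ?_
  rw [← norm_sq_plane]
  simp only [Pi.div_apply, heatWeight]
  field_simp
  ring

theorem partialD_heatWeight (ht : t < T) {x : Plane} (hφ : DifferentiableAt ℝ φ x) (i : Fin 2) :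
    partialD i (fun y => heatWeight φ T y t) x =
      -(1 / (2 * (T - t)) * x i * heatWeight φ T x t) +
        2 * Real.exp (-‖x‖ ^ 2 / (4 * (T - t))) * φ x * partialD i φ x := by
  have h0 : T - t ≠ 0 := by linarith
  have h1 : HasFDerivAt (fun y : Plane => ‖y‖ ^ 2) (2 • innerSL ℝ x) x :=
    (hasStrictFDerivAt_norm_sq x).hasFDerivAt
  have h2 := (((h1.neg.mul_const (4 * (T - t))⁻¹).exp).mul (hφ.hasFDerivAt.pow 2))
  have h3 : (fun y => heatWeight φ T y t) =
      fun y => Real.exp (-‖y‖ ^ 2 * (4 * (T - t))⁻¹) * φ y ^ 2 := by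
    funext y
    rw [heatWeight, div_eq_mul_inv]
  have h4 : inner ℝ x (basisVec i) = x i := by
    rw [inner_eq_sum]
    fin_cases i <;> simp [basisVec]
  have h5 := congrArg (fun l : Plane →L[ℝ] ℝ => l (basisVec i)) h2.fderiv
  rw [h3, partialD]
  refine h5.trans ?_
  simp only [Pi.neg_apply, add_apply, smul_apply, innerSL_apply_apply, h4,
    neg_apply, smul_eq_mul, heatWeight, partialD, div_eq_mul_inv, nsmul_eq_mul]
  push_cast
  field_simp
  ring

end Weight

/-! ### Bounds for the flux and the radial terms on the ball. -/

section GradientBounds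

variable {k : ℕ} {a : Fin 2 → Fin 2 → Plane → ℝ} {m : Plane → ℝ} {δ L : ℝ} {x : Plane}

theorem abs_coord_le (x : Plane) (i : Fin 2) : |x i| ≤ ‖x‖ :=
  PiLp.norm_apply_le x i

theorem abs_partialD_le (φ : Plane → ℝ) (x : Plane) (i : Fin 2) :
    |partialD i φ x| ≤ ‖fderiv ℝ φ x‖ := by
  have := (fderiv ℝ φ x).le_opNorm (basisVec i)
  simpa [partialD, basisVec] using this

theorem CoeffBounds.sum_norm_sq_le (hb : CoeffBounds a m δ L)
    (hx : x ∈ Metric.closedBall (0 : Plane) δ) (f : Plane → Euc k) :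
    L⁻¹ * (‖partialD 0 f x‖ ^ 2 + ‖partialD 1 f x‖ ^ 2) ≤ quadGrad a f x := by
  have h1 := sum_inner_nonneg (A := fun i j => a i j x - if i = j then L⁻¹ else 0)
    (fun ξ => by
      have := hb.elliptic x hx ξ
      rw [norm_sq_plane] at this
      simp only [Fin.sum_univ_two] at this ⊢
      simp
      nlinarith) (fun i => partialD i f x)
  rw [← real_inner_self_eq_norm_sq, ← real_inner_self_eq_norm_sq, quadGrad]
  simp only [Fin.sum_univ_two] at h1 ⊢
  simp at h1
  simp only [← real_inner_self_eq_norm_sq] at h1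
  nlinarith

theorem CoeffBounds.sq_le_quadGrad (hb : CoeffBounds a m δ L)
    (hx : x ∈ Metric.closedBall (0 : Plane) δ) (f : Plane → Euc k) :
    (‖partialD 0 f x‖ + ‖partialD 1 f x‖) ^ 2 ≤ 2 * L * quadGrad a f x := by
  have h1 := hb.sum_norm_sq_le hx f
  rw [inv_mul_le_iff₀ hb.pos] at h1
  nlinarith [sq_nonneg (‖partialD 0 f x‖ - ‖partialD 1 f x‖)]

theorem CoeffBounds.quadGrad_nonneg (hb : CoeffBounds a m δ L)
    (hx : x ∈ Metric.closedBall (0 : Plane) δ) (f : Plane → Euc k) : 0 ≤ quadGrad a f x := by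
  have := hb.pos
  exact le_trans (by positivity) (hb.sum_norm_sq_le hx f)

theorem CoeffBounds.norm_flux_le (hb : CoeffBounds a m δ L)
    (hx : x ∈ Metric.closedBall (0 : Plane) δ) (f : Plane → Euc k) (i : Fin 2) :
    ‖flux a f i x‖ ≤ L * (‖partialD 0 f x‖ + ‖partialD 1 f x‖) := by
  have h : ∀ j, ‖a i j x • partialD j f x‖ ≤ L * ‖partialD j f x‖ := fun j => by
    rw [norm_smul]
    exact mul_le_mul_of_nonneg_right (hb.coeff_le x hx i j) (norm_nonneg _)
  rw [flux, Fin.sum_univ_two, mul_add]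
  exact (norm_add_le _ _).trans (add_le_add (h 0) (h 1))

/-- One factor `|x|` is the radial weight and the other comes from `a^{ij} - m δ_ij = O(|x|)`. This
is the metric error that multiplies the dissipation factor and causes the term `|x|⁴/τ²`. -/
theorem CoeffBounds.norm_radial_flux_le (hb : CoeffBounds a m δ L)
    (hx : x ∈ Metric.closedBall (0 : Plane) δ) (f : Plane → Euc k) :
    ‖(∑ i, x i • flux a f i x) - m x • radialD f x‖ ≤
      2 * L * ‖x‖ ^ 2 * (‖partialD 0 f x‖ + ‖partialD 1 f x‖) := by
  have e : (∑ i, x i • flux a f i x) - m x • radialD f x =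
      ∑ i, ∑ j, (x i * (a i j x - if i = j then m x else 0)) • partialD j f x := by
    simp only [flux, radialD, Fin.sum_univ_two]
    simp
    module
  have h : ∀ i j, ‖(x i * (a i j x - if i = j then m x else 0)) • partialD j f x‖ ≤
      ‖x‖ * (L * ‖x‖) * ‖partialD j f x‖ := fun i j => by
    rw [norm_smul, norm_mul]
    exact mul_le_mul_of_nonneg_right (mul_le_mul (abs_coord_le x i) (hb.sub_le x hx i j)
      (norm_nonneg _) (norm_nonneg _)) (norm_nonneg _)
  rw [e]
  refine (norm_sum_le _ _).trans ((Finset.sum_le_sum fun i _ => (norm_sum_le _ _).trans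
    (Finset.sum_le_sum fun j _ => h i j)).trans (le_of_eq ?_))
  simp only [Fin.sum_univ_two]
  ring

theorem CoeffBounds.norm_cutoff_flux_le (hb : CoeffBounds a m δ L)
    (hx : x ∈ Metric.closedBall (0 : Plane) δ) (f : Plane → Euc k) (φ : Plane → ℝ) :
    ‖∑ i, partialD i φ x • flux a f i x‖ ≤
      2 * ‖fderiv ℝ φ x‖ * L * (‖partialD 0 f x‖ + ‖partialD 1 f x‖) := by
  have h : ∀ i, ‖partialD i φ x • flux a f i x‖ ≤
      ‖fderiv ℝ φ x‖ * (L * (‖partialD 0 f x‖ + ‖partialD 1 f x‖)) := fun i => by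
    rw [norm_smul]
    exact mul_le_mul (abs_partialD_le φ x i) (hb.norm_flux_le hx f i) (norm_nonneg _)
      (norm_nonneg _)
  refine (norm_sum_le _ _).trans ((Finset.sum_le_sum fun i _ => h i).trans (le_of_eq ?_))
  simp only [Fin.sum_univ_two]
  ring

theorem CoeffBounds.abs_quadGrad_radial_le (hb : CoeffBounds a m δ L)
    (hx : x ∈ Metric.closedBall (0 : Plane) δ) (f : Plane → Euc k) :
    |quadGrad (fun i j => radialD (a i j)) f x| ≤
      L * ‖x‖ * (‖partialD 0 f x‖ + ‖partialD 1 f x‖) ^ 2 := by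
  have h : ∀ i j, |radialD (a i j) x * inner ℝ (partialD i f x) (partialD j f x)| ≤
      L * ‖x‖ * (‖partialD i f x‖ * ‖partialD j f x‖) := fun i j => by
    rw [abs_mul]
    exact mul_le_mul (hb.radial_le x hx i j) (abs_real_inner_le_norm _ _) (abs_nonneg _)
      (mul_nonneg hb.pos.le (norm_nonneg _))
  refine (Finset.abs_sum_le_sum_abs _ _).trans ((Finset.sum_le_sum fun i _ =>
    (Finset.abs_sum_le_sum_abs _ _).trans (Finset.sum_le_sum fun j _ => h i j)).trans
    (le_of_eq ?_))
  simp only [Fin.sum_univ_two]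
  ring

/-- Confines the cut-off errors to `|x| ≥ δ/2`, where the Gaussian is negligible. -/
theorem IsCutoff.fderiv_eq_zero {c : ℝ} {φ : Plane → ℝ} (hφ : IsCutoff δ c φ)
    (hx : ‖x‖ < δ / 2) : fderiv ℝ φ x = 0 := by
  have : φ =ᶠ[nhds x] fun _ => 1 := by
    filter_upwards [Metric.isOpen_ball.mem_nhds (mem_ball_zero_iff.2 hx)] with z hz
    exact hφ.eq_one z (Metric.ball_subset_closedBall hz)
  rw [this.fderiv_eq]
  simp

end GradientBounds

/-! ### The differential inequality for the localized energy. -/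

section EnergyInequality

variable {k : ℕ} {a : Fin 2 → Fin 2 → Plane → ℝ} {m : Plane → ℝ} {δ L c κ C : ℝ}
  {φ : Plane → ℝ}

/-- The pointwise bound of the derivative of the local energy. -/
theorem CoeffBounds.integrand_le {x : Plane} (hb : CoeffBounds a m δ L) (hδ : 0 < δ)
    (hφ : IsCutoff δ c φ) (hx : x ∈ Metric.closedBall (0 : Plane) δ) {T t : ℝ} (ht : t < T)
    (hC : ∀ r : ℝ, 0 ≤ r → r ≤ δ →
      (r / (T - t) + r ^ 4 / (T - t) ^ 2) * Real.exp (-r ^ 2 / (4 * (T - t))) ≤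
        2 * (T - t) ^ (-5 / 8 : ℝ) * Real.exp (-r ^ 2 / (4 * (T - t))) +
          C * (T - t) ^ (κ - 1) ∧
      (δ / 2 ≤ r → (1 + 1 / (T - t)) * Real.exp (-r ^ 2 / (4 * (T - t))) ≤
        C * (T - t) ^ (κ - 1))) (hC0 : 0 < C) (f : Plane → Euc k) (w : Euc k) :
    (1 / 2 * deriv (heatWeight φ T x) t * quadGrad a f x - heatWeight φ T x t * m x * ‖w‖ ^ 2 -
        ∑ i, partialD i (fun y => heatWeight φ T y t) x * inner ℝ (flux a f i x) w) +
      (1 / (2 * (T - t)) * heatWeight φ T x t * m x * inner ℝ w (radialD f x) +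
        (∑ i, 1 / (2 * (T - t)) * partialD i (fun y => heatWeight φ T y t) x *
          inner ℝ (flux a f i x) (radialD f x)) -
        1 / 2 * (∑ i, x i * (1 / (2 * (T - t)) * partialD i (fun y => heatWeight φ T y t) x)) *
          quadGrad a f x -
        1 / 2 * (1 / (2 * (T - t)) * heatWeight φ T x t) *
          quadGrad (fun i j => radialD (a i j)) f x) ≤
      -(1 / 2 * (heatWeight φ T x t * m x * ‖w - (1 / (2 * (T - t))) • radialD f x‖ ^ 2)) +
        2 * (2 * L ^ 4 + L ^ 2) * (T - t) ^ (-5 / 8 : ℝ) * (heatWeight φ T x t * quadGrad a f x) +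
        (2 * L ^ 4 + L ^ 2 + 32 * (c / δ) ^ 2 * L ^ 4 + c) * C * (T - t) ^ (κ - 1) *
          quadGrad a f x := by
  have hL := hb.pos
  set τ := T - t with hτdef
  have hτ : 0 < τ := by rw [hτdef]; linarith
  have hxδ : ‖x‖ ≤ δ := mem_closedBall_zero_iff.1 hx
  have hdφ : DifferentiableAt ℝ φ x := hφ.contDiff.differentiable (by norm_num) x
  simp only [deriv_heatWeight ht, partialD_heatWeight ht hdφ, ← hτdef]
  set G := Real.exp (-‖x‖ ^ 2 / (4 * τ)) with hG
  have hG0 : 0 < G := Real.exp_pos _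
  have hη : heatWeight φ T x t = G * φ x ^ 2 := rfl
  set Q := quadGrad a f x with hQdef
  have hQ : 0 ≤ Q := hb.quadGrad_nonneg hx f
  set μ := 1 / (2 * τ) with hμdef
  have hμ : 0 ≤ μ := by positivity
  set v := w - μ • radialD f x with hv
  rw [integrand_identity μ (m x) _ Q _ (fun i => x i) (fun i => 2 * G * φ x * partialD i φ x)
    (fun i => flux a f i x) (radialD f x) w]
  have hb1 := integrand_bound (L := L) (m := m x) (μ := μ) (G := G) (φ := φ x)
    (q := ‖fderiv ℝ φ x‖) (r := ‖x‖) (s := ‖partialD 0 f x‖ + ‖partialD 1 f x‖) (Q := Q)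
    (Z := quadGrad (fun i j => radialD (a i j)) f x) (y := ∑ i, x i * partialD i φ x)
    (v := v) (R := (∑ i, x i • flux a f i x) - m x • radialD f x)
    (W := ∑ i, partialD i φ x • flux a f i x) hL (hb.density_lower x hx) hμ hG0.le
    (hφ.mem_Icc x).1 (hφ.mem_Icc x).2 (norm_nonneg _)
    (hb.sq_le_quadGrad hx f) (hb.norm_radial_flux_le hx f)
    (hb.norm_cutoff_flux_le hx f φ) (by
      have : ∑ i, x i * partialD i φ x = radialD φ x := rfl
      rw [this, radialD_eq]
      exact (fderiv ℝ φ x).le_opNorm x) (hb.abs_quadGrad_radial_le hx f)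
  have e1 : inner ℝ (∑ i, (2 * G * φ x * partialD i φ x) • flux a f i x) v =
      2 * G * φ x * inner ℝ (∑ i, partialD i φ x • flux a f i x) v := by
    simp only [Fin.sum_univ_two, inner_add_left, inner_smul_left, RCLike.conj_to_real]
    ring
  have e2 : ∑ i, x i * (2 * G * φ x * partialD i φ x) =
      2 * G * φ x * ∑ i, x i * partialD i φ x := by
    simp only [Fin.sum_univ_two]
    ring
  have htail := hC ‖x‖ (norm_nonneg _) hxδ
  rw [← hG] at htail
  have hτκ : 0 < τ ^ (κ - 1) := Real.rpow_pos_of_pos hτ _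
  have hφ2 : φ x ^ 2 ≤ 1 := pow_le_one₀ (hφ.mem_Icc x).1 (hφ.mem_Icc x).2
  -- Inside the radius `τ^{3/8}` the factor `G φ²` is kept, so that the error is a multiple of the
  -- energy integrand itself; in the tail only `φ² ≤ 1` is used.
  have b1 : (8 * L ^ 4 * (μ * ‖x‖ ^ 2) ^ 2 + L ^ 2 * (μ * ‖x‖)) * (G * φ x ^ 2 * Q) ≤
      2 * (2 * L ^ 4 + L ^ 2) * τ ^ (-5 / 8 : ℝ) * (G * φ x ^ 2 * Q) +
        (2 * L ^ 4 + L ^ 2) * C * τ ^ (κ - 1) * Q := by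
    have h1 : 8 * L ^ 4 * (μ * ‖x‖ ^ 2) ^ 2 + L ^ 2 * (μ * ‖x‖) ≤
        (2 * L ^ 4 + L ^ 2) * (‖x‖ / τ + ‖x‖ ^ 4 / τ ^ 2) := by
      have e : 8 * L ^ 4 * (μ * ‖x‖ ^ 2) ^ 2 + L ^ 2 * (μ * ‖x‖) =
          2 * L ^ 4 * (‖x‖ ^ 4 / τ ^ 2) + 1 / 2 * L ^ 2 * (‖x‖ / τ) := by
        rw [hμdef]
        field_simp
        ring
      have p1 : 0 ≤ L ^ 4 * (‖x‖ / τ) := by positivity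
      have p2 : 0 ≤ L ^ 2 * (‖x‖ / τ) := by positivity
      have p3 : 0 ≤ L ^ 2 * (‖x‖ ^ 4 / τ ^ 2) := by positivity
      rw [e]
      linarith
    have h2 := mul_le_mul_of_nonneg_left htail.1
      (show 0 ≤ (2 * L ^ 4 + L ^ 2) * (φ x ^ 2 * Q) by positivity)
    have h3 := mul_le_mul_of_nonneg_right h1 (show 0 ≤ G * φ x ^ 2 * Q by positivity)
    have h4 := mul_le_mul_of_nonneg_left hφ2
      (show 0 ≤ (2 * L ^ 4 + L ^ 2) * C * τ ^ (κ - 1) * Q by positivity)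
    linarith
  have b2 : (32 * ‖fderiv ℝ φ x‖ ^ 2 * L ^ 4 + μ * ‖fderiv ℝ φ x‖ * ‖x‖) * (G * Q) ≤
      (32 * (c / δ) ^ 2 * L ^ 4 + c) * C * τ ^ (κ - 1) * Q := by
    have hq := hφ.fderiv_le x
    have hcδ : 0 ≤ c / δ := (norm_nonneg _).trans hq
    have hc : 0 ≤ c := by
      have := mul_nonneg hcδ hδ.le
      rwa [div_mul_cancel₀ _ hδ.ne'] at this
    rcases lt_or_ge ‖x‖ (δ / 2) with h | h
    · rw [hφ.fderiv_eq_zero h, norm_zero]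
      have : 0 ≤ (32 * (c / δ) ^ 2 * L ^ 4 + c) * C * τ ^ (κ - 1) * Q := by positivity
      simpa using this
    · have h1 : 32 * ‖fderiv ℝ φ x‖ ^ 2 * L ^ 4 + μ * ‖fderiv ℝ φ x‖ * ‖x‖ ≤
          (32 * (c / δ) ^ 2 * L ^ 4 + c) * (1 + 1 / τ) := by
        have i1 : ‖fderiv ℝ φ x‖ ^ 2 ≤ (c / δ) ^ 2 := pow_le_pow_left₀ (norm_nonneg _) hq 2
        have i2 : ‖fderiv ℝ φ x‖ * ‖x‖ ≤ c := by
          calc _ ≤ c / δ * δ := mul_le_mul hq hxδ (norm_nonneg _) hcδ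
            _ = c := div_mul_cancel₀ _ hδ.ne'
        have i3 : μ ≤ 1 / τ := by
          rw [hμdef]
          exact one_div_le_one_div_of_le hτ (by linarith)
        have i4 : μ * (‖fderiv ℝ φ x‖ * ‖x‖) ≤ 1 / τ * c :=
          mul_le_mul i3 i2 (by positivity) (by positivity)
        have i5 := mul_le_mul_of_nonneg_right i1 (show 0 ≤ 32 * L ^ 4 by positivity)
        have i6 : 0 ≤ 32 * (c / δ) ^ 2 * L ^ 4 * (1 / τ) := by positivity
        linarith
      have h2 := mul_le_mul_of_nonneg_right h1 (show 0 ≤ G * Q by positivity)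
      have h3 := mul_le_mul_of_nonneg_left (htail.2 h)
        (show 0 ≤ (32 * (c / δ) ^ 2 * L ^ 4 + c) * Q by positivity)
      linarith
  rw [e1, e2, hη]
  linarith

theorem integral_combination {f₁ f₂ f₃ : Plane → ℝ} (h₁ : Integrable f₁) (h₂ : Integrable f₂)
    (h₃ : Integrable f₃) (α β γ : ℝ) :
    ∫ x, (-(α * f₁ x) + β * f₂ x + γ * f₃ x) =
      -(α * ∫ x, f₁ x) + β * (∫ x, f₂ x) + γ * ∫ x, f₃ x := by
  have e1 : Integrable fun x => -(α * f₁ x) := (h₁.const_mul α).neg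
  have e2 : Integrable fun x => -(α * f₁ x) + β * f₂ x := e1.add (h₂.const_mul β)
  rw [integral_add e2 (h₃.const_mul γ), integral_add e1 (h₂.const_mul β),
    integral_neg, integral_const_mul, integral_const_mul, integral_const_mul]

theorem IsCutoff.heatWeight_eq_zero (hφ : IsCutoff δ c φ) {T : ℝ} {x : Plane}
    (hx : x ∉ Metric.closedBall (0 : Plane) δ) (t : ℝ) : heatWeight φ T x t = 0 := by
  rw [heatWeight, hφ.eq_zero x hx]
  simp

theorem contDiffOn_dissipation_factor {m : Plane → ℝ} {U : Set Plane} {T : ℝ}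
    {f : Plane → ℝ → Euc k} (h : IsLocalFlow a m U T f) {t : ℝ} (ht : t ∈ Ioo 0 T) (μ : ℝ) :
    ContDiffOn ℝ ∞ (fun x => deriv (f x) t - μ • radialD (fun y => f y t) x) U := by
  have hv : ContDiffOn ℝ ∞ (fun x => f x t) U := contDiffOn_slice h.smooth_Ioo ht
  have hw : ContDiffOn ℝ ∞ (fun x => deriv (f x) t) U :=
    contDiffOn_slice (contDiffOn_deriv_joint h.isOpen isOpen_Ioo h.smooth_Ioo) ht
  exact hw.sub ((contDiffOn_radialD h.isOpen hv).const_smul μ)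

/-- The differential inequality for the localized weighted energy. -/
theorem IsLocalFlow.exists_hasDerivAt_heatEnergy {U : Set Plane} {T : ℝ} {f : Plane → ℝ → Euc k}
    (h : IsLocalFlow a m U T f) (hb : CoeffBounds a m δ L) (hδ : 0 < δ)
    (hU : Metric.closedBall (0 : Plane) δ ⊆ U) (hφ : IsCutoff δ c φ) {t : ℝ} (ht : t ∈ Ioo 0 T)
    (hC : ∀ r : ℝ, 0 ≤ r → r ≤ δ →
      (r / (T - t) + r ^ 4 / (T - t) ^ 2) * Real.exp (-r ^ 2 / (4 * (T - t))) ≤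
        2 * (T - t) ^ (-5 / 8 : ℝ) * Real.exp (-r ^ 2 / (4 * (T - t))) +
          C * (T - t) ^ (κ - 1) ∧
      (δ / 2 ≤ r → (1 + 1 / (T - t)) * Real.exp (-r ^ 2 / (4 * (T - t))) ≤
        C * (T - t) ^ (κ - 1))) (hC0 : 0 < C) :
    ∃ F', HasDerivAt
        (fun τ => 1 / 2 * ∫ x, heatWeight φ T x τ * quadGrad a (fun y => f y τ) x) F' t ∧
      F' ≤ -(1 / 2 * ∫ x, heatWeight φ T x t * m x *
          ‖deriv (f x) t - (1 / (2 * (T - t))) • radialD (fun y => f y t) x‖ ^ 2) +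
        4 * (2 * L ^ 4 + L ^ 2) * (T - t) ^ (-5 / 8 : ℝ) *
          (1 / 2 * ∫ x, heatWeight φ T x t * quadGrad a (fun y => f y t) x) +
        (2 * L ^ 4 + L ^ 2 + 32 * (c / δ) ^ 2 * L ^ 4 + c) * C * (T - t) ^ (κ - 1) *
          ∫ x in Metric.closedBall (0 : Plane) δ, quadGrad a (fun y => f y t) x := by
  have hK : IsCompact (Metric.closedBall (0 : Plane) δ) := isCompact_closedBall 0 δ
  have htT : t < T := ht.2
  have hη1 : ContDiff ℝ 1 (fun x => heatWeight φ T x t) :=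
    contDiff_heatWeight (hφ.contDiff.of_le (by norm_num))
  have hη0 : ∀ x ∉ Metric.closedBall (0 : Plane) δ, ∀ t, heatWeight φ T x t = 0 :=
    fun x hx t => hφ.heatWeight_eq_zero hx t
  have hd := h.hasDerivAt_energy hK hU
    (contDiffOn_heatWeight (I := Ioo 0 T) (fun s hs => hs.2)
      (hφ.contDiff.of_le (by norm_num : (1 : ℕ∞ω) ≤ 2))) hη0 ht
  -- The multiplier `ζ = η / 2τ` is the one whose radial term completes the square with `f_t`.
  have hp := h.pohozaev hK hU (ζ := fun x => 1 / (2 * (T - t)) * heatWeight φ T x t)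
    (contDiff_const.mul hη1) (fun x hx => by simp [hη0 x hx]) ht
  refine ⟨_, hd, ?_⟩
  have hpD : ∀ x i, partialD i (fun y => 1 / (2 * (T - t)) * heatWeight φ T y t) x =
      1 / (2 * (T - t)) * partialD i (fun y => heatWeight φ T y t) x := fun x i => by
    rw [partialD, fderiv_const_mul (hη1.differentiable (by norm_num) x)]
    rfl
  simp only [radialD, hpD, smul_eq_mul] at hp
  change ∫ x, (1 / (2 * (T - t)) * heatWeight φ T x t * m x *
    inner ℝ (deriv (f x) t) (radialD (fun y => f y t) x) +
        (∑ i, 1 / (2 * (T - t)) * partialD i (fun y => heatWeight φ T y t) x *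
          inner ℝ (flux a (fun y => f y t) i x) (radialD (fun y => f y t) x)) -
        1 / 2 * (∑ i, x i * (1 / (2 * (T - t)) * partialD i (fun y => heatWeight φ T y t) x)) *
          quadGrad a (fun y => f y t) x -
        1 / 2 * (1 / (2 * (T - t)) * heatWeight φ T x t) *
          quadGrad (fun i j => radialD (a i j)) (fun y => f y t) x) = 0 at hp
  have hv : ContDiffOn ℝ ∞ (fun x => f x t) U := contDiffOn_slice h.smooth_Ioo ht
  have cw : ContinuousOn (fun x => deriv (f x) t) U :=
    (contDiffOn_slice (contDiffOn_deriv_joint h.isOpen isOpen_Ioo h.smooth_Ioo) ht).continuousOn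
  have cQ : ContinuousOn (quadGrad a fun y => f y t) U :=
    (contDiffOn_quadGrad h.isOpen h.coeff_smooth hv).continuousOn
  have cZ : ContinuousOn (quadGrad (fun i j => radialD (a i j)) fun y => f y t) U :=
    (contDiffOn_quadGrad h.isOpen (fun i j => contDiffOn_radialD h.isOpen (h.coeff_smooth i j))
      hv).continuousOn
  have cF : ∀ i, ContinuousOn (flux a (fun y => f y t) i) U := fun i =>
    (contDiffOn_flux h.isOpen h.coeff_smooth hv i).continuousOn
  have cX : ContinuousOn (radialD fun y => f y t) U :=
    (contDiffOn_radialD h.isOpen hv).continuousOn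
  have cm : ContinuousOn m U := h.density_smooth.continuousOn
  have cη : ContinuousOn (fun x => heatWeight φ T x t) U := hη1.continuous.continuousOn
  have cηi : ∀ i, ContinuousOn (partialD i fun x => heatWeight φ T x t) U := fun i =>
    ((hη1.continuous_fderiv (by norm_num)).clm_apply continuous_const).continuousOn
  have hηi0 : ∀ i, ∀ x ∉ Metric.closedBall (0 : Plane) δ,
      partialD i (fun x => heatWeight φ T x t) x = 0 := fun i x hx =>
    partialD_eq_zero_off hK (fun x hx => hη0 x hx t) i hx
  have cc : ∀ i : Fin 2, ContinuousOn (fun x : Plane => x i) U := fun i =>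
    (differentiable_coord i).continuous.continuousOn
  have cv : ContinuousOn
      (fun x => deriv (f x) t - (1 / (2 * (T - t))) • radialD (fun y => f y t) x) U :=
    (contDiffOn_dissipation_factor h ht _).continuousOn
  have hA : Integrable (fun x => 1 / 2 * deriv (heatWeight φ T x) t *
        quadGrad a (fun y => f y t) x - heatWeight φ T x t * m x * ‖deriv (f x) t‖ ^ 2 -
        ∑ i, partialD i (fun y => heatWeight φ T y t) x *
          inner ℝ (flux a (fun y => f y t) i x) (deriv (f x) t)) := by
    refine integrable_of_zero_off h.isOpen hK hU ?_ fun x hx => ?_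
    · simp only [deriv_heatWeight htT, Fin.sum_univ_two]
      exact ((((continuousOn_const.mul ((continuousOn_const.mul
        (((cc 0).pow 2).add ((cc 1).pow 2))).neg.mul cη)).mul cQ)).sub
        ((cη.mul cm).mul (cw.norm.pow 2))).sub
        (((cηi 0).mul ((cF 0).inner cw)).add ((cηi 1).mul ((cF 1).inner cw)))
    · simp [deriv_heatWeight htT, hη0 x hx, hηi0 _ x hx]
  have hB : Integrable (fun x => 1 / (2 * (T - t)) * heatWeight φ T x t * m x *
    inner ℝ (deriv (f x) t) (radialD (fun y => f y t) x) +
        (∑ i, 1 / (2 * (T - t)) * partialD i (fun y => heatWeight φ T y t) x *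
          inner ℝ (flux a (fun y => f y t) i x) (radialD (fun y => f y t) x)) -
        1 / 2 * (∑ i, x i * (1 / (2 * (T - t)) * partialD i (fun y => heatWeight φ T y t) x)) *
          quadGrad a (fun y => f y t) x -
        1 / 2 * (1 / (2 * (T - t)) * heatWeight φ T x t) *
          quadGrad (fun i j => radialD (a i j)) (fun y => f y t) x) := by
    refine integrable_of_zero_off h.isOpen hK hU ?_ fun x hx => ?_
    · simp only [Fin.sum_univ_two]
      exact (((((continuousOn_const.mul cη).mul cm).mul (cw.inner cX)).add
        (((continuousOn_const.mul (cηi 0)).mul ((cF 0).inner cX)).add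
          ((continuousOn_const.mul (cηi 1)).mul ((cF 1).inner cX)))).sub
        ((continuousOn_const.mul (((cc 0).mul (continuousOn_const.mul (cηi 0))).add
          ((cc 1).mul (continuousOn_const.mul (cηi 1))))).mul cQ)).sub
        ((continuousOn_const.mul (continuousOn_const.mul cη)).mul cZ)
    · simp [hη0 x hx, hηi0 _ x hx]
  have hD : Integrable (fun x => heatWeight φ T x t * m x *
      ‖deriv (f x) t - (1 / (2 * (T - t))) • radialD (fun y => f y t) x‖ ^ 2) :=
    integrable_of_zero_off h.isOpen hK hU ((cη.mul cm).mul (cv.norm.pow 2))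
      fun x hx => by simp [hη0 x hx]
  have hE : Integrable (fun x => heatWeight φ T x t * quadGrad a (fun y => f y t) x) :=
    integrable_of_zero_off h.isOpen hK hU (cη.mul cQ) fun x hx => by simp [hη0 x hx]
  have hI : Integrable ((Metric.closedBall (0 : Plane) δ).indicator
      (quadGrad a fun y => f y t)) :=
    ((cQ.mono hU).integrableOn_compact hK).integrable_indicator hK.measurableSet
  -- The Pohozaev integral is zero, so it can be added to the derivative before estimating
  -- pointwise.
  rw [← add_zero (∫ x, _), ← hp, ← integral_add hA hB,
    ← integral_indicator hK.measurableSet]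
  refine (integral_mono (g := fun x => -(1 / 2 * (heatWeight φ T x t * m x *
      ‖deriv (f x) t - (1 / (2 * (T - t))) • radialD (fun y => f y t) x‖ ^ 2)) +
      2 * (2 * L ^ 4 + L ^ 2) * (T - t) ^ (-5 / 8 : ℝ) *
        (heatWeight φ T x t * quadGrad a (fun y => f y t) x) +
      (2 * L ^ 4 + L ^ 2 + 32 * (c / δ) ^ 2 * L ^ 4 + c) * C * (T - t) ^ (κ - 1) *
        (Metric.closedBall (0 : Plane) δ).indicator (quadGrad a fun y => f y t) x)
    (hA.add hB) (((hD.const_mul _).neg.add (hE.const_mul _)).add (hI.const_mul _))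
    fun x => ?_).trans (le_of_eq ?_)
  · by_cases hx : x ∈ Metric.closedBall (0 : Plane) δ
    · have := hb.integrand_le hδ hφ hx htT hC hC0 (fun y => f y t) (deriv (f x) t)
      simp only [Set.indicator_of_mem hx]
      exact this
    · simp [Set.indicator_of_notMem hx, deriv_heatWeight htT, hη0 x hx, hηi0 _ x hx]
  · rw [integral_combination hD hE hI]
    ring

end EnergyInequality

/-! ### Integrating factors and dissipation bounds on the real line. -/

section RealAnalysis

/-- No measurability of `d` is required: its lower Lebesgue integral is compared with that of `-Θ'`,
which is integrable as a nonnegative derivative. -/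
theorem lintegral_Ioc_le_of_deriv_le {Θ Θ' d : ℝ → ℝ} {a b : ℝ} (hab : a ≤ b)
    (hc : ContinuousOn Θ (Icc a b)) (hd : ∀ s ∈ Ioo a b, HasDerivAt Θ (Θ' s) s)
    (hd0 : ∀ s ∈ Ioo a b, 0 ≤ d s) (hle : ∀ s ∈ Ioo a b, Θ' s ≤ -d s) :
    ∫⁻ s in Ioc a b, ENNReal.ofReal (d s) ≤ ENNReal.ofReal (Θ a - Θ b) := by
  have hn : ∀ s ∈ Ioo a b, HasDerivAt (fun s => -Θ s) (-Θ' s) s := fun s hs => (hd s hs).neg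
  have hpos : ∀ s ∈ Ioo a b, 0 ≤ -Θ' s := fun s hs => by
    linarith [hd0 s hs, hle s hs]
  have hi : IntegrableOn (fun s => -Θ' s) (Ioc a b) :=
    intervalIntegral.integrableOn_deriv_of_nonneg hc.neg hn hpos
  have hint : ∫ s in a..b, -Θ' s = Θ a - Θ b := by
    rw [intervalIntegral.integral_eq_sub_of_hasDerivAt_of_le hab hc.neg hn
      ((intervalIntegrable_iff_integrableOn_Ioc_of_le hab).2 hi)]
    simp only [Pi.neg_apply]
    ring
  rw [← hint, intervalIntegral.integral_of_le hab, ← restrict_Ioo_eq_restrict_Ioc,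
    ofReal_integral_eq_lintegral_ofReal (hi.mono_set Ioo_subset_Ioc_self)
      ((ae_restrict_iff' measurableSet_Ioo).2 (ae_of_all _ hpos))]
  refine setLIntegral_mono_ae' measurableSet_Ioo (ae_of_all _ fun s hs => ?_)
  exact ENNReal.ofReal_le_ofReal (by linarith [hle s hs])

/-- The half-line is exhausted by bounded intervals; nonnegativity of `Θ` makes the bounds
independent of the interval. -/
theorem lintegral_Ioi_le_of_deriv_le {Θ Θ' d : ℝ → ℝ} {a : ℝ}
    (hc : ContinuousOn Θ (Ici a)) (hd : ∀ s ∈ Ioi a, HasDerivAt Θ (Θ' s) s)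
    (hd0 : ∀ s ∈ Ioi a, 0 ≤ d s) (hle : ∀ s ∈ Ioi a, Θ' s ≤ -d s)
    (hΘ : ∀ s ∈ Ici a, 0 ≤ Θ s) :
    ∫⁻ s in Ioi a, ENNReal.ofReal (d s) ≤ ENNReal.ofReal (Θ a) := by
  have hU : Ioi a = ⋃ n : ℕ, Ioc a (a + n) := by
    ext s
    simp only [mem_Ioi, mem_iUnion, mem_Ioc]
    refine ⟨fun h => ?_, fun ⟨n, h⟩ => h.1⟩
    obtain ⟨n, hn⟩ := exists_nat_ge (s - a)
    exact ⟨n, h, by linarith⟩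
  have hmono : Monotone fun n : ℕ => Ioc a (a + n) := fun i j hij =>
    Ioc_subset_Ioc_right (by have : (i : ℝ) ≤ j := Nat.cast_le.2 hij; linarith)
  rw [hU, setLIntegral_iUnion_of_directed _ hmono.directed_le]
  refine iSup_le fun n => ?_
  have hn : a ≤ a + n := by have : (0 : ℝ) ≤ n := n.cast_nonneg; linarith
  refine (lintegral_Ioc_le_of_deriv_le hn (hc.mono Icc_subset_Ici_self)
    (fun s hs => hd s hs.1) (fun s hs => hd0 s hs.1) (fun s hs => hle s hs.1)).trans
    (ENNReal.ofReal_le_ofReal ?_)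
  linarith [hΘ (a + n) hn]

/-- The monotone quantity obtained from the energy by an integrating factor. -/
def correctedEnergy (A K κ T : ℝ) (F : ℝ → ℝ) (t : ℝ) : ℝ :=
  Real.exp (8 / 3 * A * (T - t) ^ (3 / 8 : ℝ)) * F t + K * (T - t) ^ κ

variable {A B K M κ T : ℝ} {F D : ℝ → ℝ}

theorem continuousOn_correctedEnergy (hκ : 0 < κ) (hF : ContinuousOn F (Ico 0 T)) :
    ContinuousOn (correctedEnergy A K κ T F) (Ico 0 T) := by
  have h1 : Continuous fun t => T - t := continuous_const.sub continuous_id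
  have h2 : Continuous fun t => (T - t) ^ (3 / 8 : ℝ) :=
    h1.rpow_const fun _ => Or.inr (by norm_num)
  have h3 : Continuous fun t => (T - t) ^ κ := h1.rpow_const fun _ => Or.inr hκ.le
  exact ((Real.continuous_exp.comp (continuous_const.mul h2)).continuousOn.mul hF).add
    (continuous_const.mul h3).continuousOn

/-- The logarithmic derivative of the exponential factor is `-A τ^{-5/8}`, since `8/3 · 3/8 = 1`,
and cancels the term in `F`. The derivative `-K κ τ^{κ-1}` of the second summand absorbs `B τ^{κ-1}`
times the exponential, which is where `B M ≤ K κ` enters. -/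
theorem exists_hasDerivAt_correctedEnergy (hA : 0 ≤ A) (hB : 0 ≤ B) (hκ : 0 < κ)
    (hK : B * M ≤ K * κ) {t F' : ℝ} (ht : t < T)
    (hM : Real.exp (8 / 3 * A * (T - t) ^ (3 / 8 : ℝ)) ≤ M) (hF : HasDerivAt F F' t)
    (hD : 0 ≤ D t)
    (hF' : F' ≤ -(1 / 2 * D t) + A * (T - t) ^ (-5 / 8 : ℝ) * F t + B * (T - t) ^ (κ - 1)) :
    ∃ Ψ', HasDerivAt (correctedEnergy A K κ T F) Ψ' t ∧ Ψ' ≤ -(1 / 2 * D t) := by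
  have hτ : 0 < T - t := by linarith
  have h1 : HasDerivAt (fun t => T - t) (-1) t := (hasDerivAt_id t).const_sub T
  have h2 := (h1.rpow_const (p := 3 / 8) (Or.inl hτ.ne')).const_mul (8 / 3 * A)
  have h3 := (h1.rpow_const (p := κ) (Or.inl hτ.ne')).const_mul K
  have h4 := (h2.exp.mul hF).add h3
  refine ⟨_, h4, ?_⟩
  set P := Real.exp (8 / 3 * A * (T - t) ^ (3 / 8 : ℝ)) with hP
  have hP1 : 1 ≤ P := Real.one_le_exp (by positivity)
  have hτ1 : (T - t) ^ ((3 / 8 : ℝ) - 1) = (T - t) ^ (-5 / 8 : ℝ) := by norm_num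
  have hτκ : 0 < (T - t) ^ (κ - 1) := Real.rpow_pos_of_pos hτ _
  rw [hτ1]
  have i1 := mul_le_mul_of_nonneg_left hF' (zero_le_one.trans hP1)
  have i2 := mul_le_mul_of_nonneg_right hP1 hD
  have i3 := mul_le_mul_of_nonneg_right hM (show 0 ≤ B * (T - t) ^ (κ - 1) by positivity)
  have i4 := mul_le_mul_of_nonneg_right hK hτκ.le
  linarith

theorem correctedEnergy_antitone (hκ : 0 < κ) (hF : ContinuousOn F (Ico 0 T)) {τ₀ : ℝ}
    (hd : ∀ t ∈ Ioo 0 T, T - t ≤ τ₀ →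
      ∃ Ψ', HasDerivAt (correctedEnergy A K κ T F) Ψ' t ∧ Ψ' ≤ -(1 / 2 * D t))
    (hD : ∀ t ∈ Ioo 0 T, 0 ≤ D t) {t' t : ℝ} (ht' : 0 ≤ t') (htt : t' ≤ t) (ht : t < T)
    (hτ : T - t' ≤ τ₀) :
    correctedEnergy A K κ T F t ≤ correctedEnergy A K κ T F t' := by
  have hsub : Icc t' t ⊆ Ico 0 T := fun s hs => ⟨ht'.trans hs.1, hs.2.trans_lt ht⟩
  refine antitoneOn_of_deriv_nonpos (convex_Icc t' t)
    ((continuousOn_correctedEnergy hκ hF).mono hsub) ?_ ?_ (left_mem_Icc.2 htt)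
    (right_mem_Icc.2 htt) htt
  all_goals
    rw [interior_Icc]
    intro s hs
    have hs' : s ∈ Ioo 0 T := ⟨ht'.trans_lt hs.1, hs.2.trans ht⟩
    obtain ⟨Ψ', h1, h2⟩ := hd s hs' (by linarith [hs.1])
  · exact h1.differentiableAt.differentiableWithinAt
  · rw [h1.deriv]
    linarith [hD s hs']

end RealAnalysis

/-! ### From the self-similar variables back to the unscaled ones. -/

section Rescaling

variable {M : Type*} [TopologicalSpace M] [ChartedSpace Plane M] [IsManifold 𝓘(ℝ, Plane) ∞ M]

/-- The localized weighted energy in unscaled coordinates. -/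
def heatEnergy {k : ℕ} (g : Metric M) (Φ : OpenPartialHomeomorph M Plane) (φ : Plane → ℝ) (T : ℝ)
    (u : M → ℝ → Euc k) (t : ℝ) : ℝ :=
  1 / 2 * ∫ x, heatWeight φ T x t *
    quadGrad (conformalCoeff g Φ) (fun y => u (Φ.symm y) t) x

/-- The localized weighted dissipation in unscaled coordinates. -/
def heatDissipation {k : ℕ} (g : Metric M) (Φ : OpenPartialHomeomorph M Plane) (φ : Plane → ℝ)
    (T : ℝ) (u : M → ℝ → Euc k) (t : ℝ) : ℝ :=
  ∫ x, heatWeight φ T x t * volDensity g Φ x *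
    ‖deriv (u (Φ.symm x)) t - (1 / (2 * (T - t))) • radialD (fun y => u (Φ.symm y) t) x‖ ^ 2

variable {k : ℕ} {g : Metric M} {Φ : OpenPartialHomeomorph M Plane} {φ : Plane → ℝ} {T : ℝ}
    {u : M → ℝ → Euc k} {N : Set (Euc k)} {p₀ : M} {δ Λ c : ℝ}

theorem exp_half_sq (s : ℝ) : Real.exp (-s / 2) ^ 2 = Real.exp (-s) := by
  rw [← Real.exp_nat_mul]
  congr 1
  push_cast
  ring

theorem gaussianWeight_mul_cutoff (φ : Plane → ℝ) (T s : ℝ) (y : Plane) :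
    gaussianWeight y * φ (Real.exp (-s / 2) • y) ^ 2 =
      heatWeight φ T (Real.exp (-s / 2) • y) (T - Real.exp (-s)) := by
  have h : -‖Real.exp (-s / 2) • y‖ ^ 2 / (4 * (T - (T - Real.exp (-s)))) = -‖y‖ ^ 2 / 4 := by
    rw [norm_smul, mul_pow, Real.norm_eq_abs, sq_abs, exp_half_sq, sub_sub_cancel]
    have := (Real.exp_pos (-s)).ne'
    field_simp
  rw [heatWeight, h, gaussianWeight]

theorem partialD_comp_smul {F : Type*} [NormedAddCommGroup F] [NormedSpace ℝ F] (h : Plane → F)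
    (r : ℝ) (i : Fin 2) (y : Plane) :
    partialD i (fun z => h (r • z)) y = r • partialD i h (r • y) := by
  rw [partialD, fderiv_comp_smul]
  rfl

theorem integral_comp_exp_smul (h : Plane → ℝ) (s : ℝ) :
    ∫ y, h (Real.exp (-s / 2) • y) = (Real.exp (-s))⁻¹ * ∫ x, h x := by
  rw [Measure.integral_comp_smul, finrank_euclideanSpace_fin, exp_half_sq, smul_eq_mul,
    abs_of_pos (inv_pos.2 (Real.exp_pos _))]

/-- Two derivatives contribute `e^{-s}` and the substitution `x = e^{-s/2} y` in the plane
contributes `e^{s}`: the energy is scale invariant in dimension two. -/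
theorem localEnergy_eq (g : Metric M) (Φ : OpenPartialHomeomorph M Plane) (φ : Plane → ℝ) (T : ℝ)
    (u : M → ℝ → Euc k) (s : ℝ) :
    localEnergy g Φ φ (rescaled Φ T u) s = heatEnergy g Φ φ T u (T - Real.exp (-s)) := by
  set H : Plane → ℝ := fun x => heatWeight φ T x (T - Real.exp (-s)) *
    quadGrad (conformalCoeff g Φ) (fun y => u (Φ.symm y) (T - Real.exp (-s))) x with hH
  have h : ∀ y : Plane, gaussianWeight y * rescaledGradSq g Φ (rescaled Φ T u) y s *
      φ (Real.exp (-s / 2) • y) ^ 2 * volDensity g Φ (Real.exp (-s / 2) • y) =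
      Real.exp (-s) * H (Real.exp (-s / 2) • y) := fun y => by
    have hd : ∀ i, partialD i (fun z => rescaled Φ T u z s) y = Real.exp (-s / 2) •
        partialD i (fun y => u (Φ.symm y) (T - Real.exp (-s))) (Real.exp (-s / 2) • y) := fun i =>
      partialD_comp_smul (fun y => u (Φ.symm y) (T - Real.exp (-s))) _ i y
    have hg : rescaledGradSq g Φ (rescaled Φ T u) y s = Real.exp (-s) *
        gradSq g Φ (fun y => u (Φ.symm y) (T - Real.exp (-s))) (Real.exp (-s / 2) • y) := by
      simp only [rescaledGradSq, gradSq, hd, inner_smul_left, inner_smul_right,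
        RCLike.conj_to_real, ← exp_half_sq, Finset.mul_sum]
      exact Finset.sum_congr rfl fun i _ => Finset.sum_congr rfl fun j _ => by ring
    rw [hg, hH]
    simp only
    rw [← volDensity_mul_gradSq, ← gaussianWeight_mul_cutoff]
    ring
  rw [localEnergy, heatEnergy]
  simp only [h]
  rw [integral_const_mul, integral_comp_exp_smul, mul_inv_cancel_left₀ (Real.exp_pos _).ne']

/-- For fixed `y` the point `(x, t)` moves with velocity `(-x/2, e^{-s})`. The derivative `w_s` is
therefore the completed square's base, up to the factor `e^{-s}`. -/
theorem IsHarmonicHeatFlow.deriv_rescaled (hu : IsHarmonicHeatFlow g N T u)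
    (hΦ : Φ ∈ IsManifold.maximalAtlas 𝓘(ℝ, Plane) ∞ M) {s : ℝ} {y : Plane}
    (hy : Real.exp (-s / 2) • y ∈ Φ.target) (hs : T - Real.exp (-s) ∈ Ioo 0 T) :
    deriv (fun σ => rescaled Φ T u y σ) s = Real.exp (-s) •
      (deriv (u (Φ.symm (Real.exp (-s / 2) • y))) (T - Real.exp (-s)) -
        (1 / (2 * Real.exp (-s))) • radialD (fun y => u (Φ.symm y) (T - Real.exp (-s)))
          (Real.exp (-s / 2) • y)) := by
  have hf := (hu.isLocalFlow hΦ).smooth_Ioo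
  set x := Real.exp (-s / 2) • y with hx
  set t := T - Real.exp (-s) with ht
  have hd : HasFDerivAt (Function.uncurry fun x t => u (Φ.symm x) t)
      (fderiv ℝ (Function.uncurry fun x t => u (Φ.symm x) t) (x, t)) (x, t) :=
    ((hf.contDiffAt ((Φ.open_target.prod isOpen_Ioo).mem_nhds ⟨hy, hs⟩)).differentiableAt
      (by simp)).hasFDerivAt
  set l := fderiv ℝ (Function.uncurry fun x t => u (Φ.symm x) t) (x, t) with hl
  have h1 : HasDerivAt (fun σ : ℝ => Real.exp (-σ / 2)) (Real.exp (-s / 2) * (-1 / 2)) s :=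
    ((hasDerivAt_id s).neg.div_const 2).exp
  have h2 : HasDerivAt (fun σ : ℝ => T - Real.exp (-σ)) (-(Real.exp (-s) * -1)) s :=
    ((hasDerivAt_id s).neg.exp).const_sub T
  have h3 : HasDerivAt (fun σ : ℝ => (Real.exp (-σ / 2) • y, T - Real.exp (-σ)))
      ((Real.exp (-s / 2) * (-1 / 2)) • y, -(Real.exp (-s) * -1)) s :=
    (h1.smul_const y).prodMk h2
  have h4 : HasDerivAt (fun σ => rescaled Φ T u y σ)
      (l ((Real.exp (-s / 2) * (-1 / 2)) • y, -(Real.exp (-s) * -1))) s :=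
    HasFDerivAt.comp_hasDerivAt (f := fun σ : ℝ => (Real.exp (-σ / 2) • y, T - Real.exp (-σ))) s hd h3
  have e1 : ((Real.exp (-s / 2) * (-1 / 2)) • y, -(Real.exp (-s) * -1)) =
      (-1 / 2 : ℝ) • ((x, 0) : Plane × ℝ) + Real.exp (-s) • ((0, 1) : Plane × ℝ) := by
    rw [hx]
    ext1
    · simp [smul_smul, mul_comm]
    · simp
  have e2 : radialD (fun y => u (Φ.symm y) t) x = l (x, 0) := by
    have h5 : fderiv ℝ (fun y => u (Φ.symm y) t) x =
      l.comp (ContinuousLinearMap.inl ℝ Plane ℝ) := hd.slice_left.fderiv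
    rw [radialD_eq, h5]
    simp
  have e3 : deriv (u (Φ.symm x)) t = l (0, 1) := hd.slice_right.deriv
  rw [h4.deriv, e1, map_add, map_smul, map_smul, e2, e3, smul_sub, smul_smul]
  have : Real.exp (-s) * (1 / (2 * Real.exp (-s))) = 1 / 2 := by
    have := (Real.exp_pos (-s)).ne'
    field_simp
  rw [this]
  module

theorem exp_neg_mem {s : ℝ} (hT : 0 < T) (hs : -Real.log T < s) :
    T - Real.exp (-s) ∈ Ioo 0 T := by
  have h1 : Real.exp (-s) < T := by
    rw [← Real.lt_log_iff_exp_lt hT]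
    linarith
  exact ⟨by linarith, by linarith [Real.exp_pos (-s)]⟩

theorem exp_neg_mem_Ico {s : ℝ} (hT : 0 < T) (hs : -Real.log T ≤ s) :
    T - Real.exp (-s) ∈ Ico 0 T := by
  have h1 : Real.exp (-s) ≤ T := by
    rw [← Real.le_log_iff_exp_le hT]
    linarith
  exact ⟨by linarith, by linarith [Real.exp_pos (-s)]⟩

theorem IsHarmonicHeatFlow.integrable_heatDissipation (hu : IsHarmonicHeatFlow g N T u)
    (hΦ : IsAdaptedChart g p₀ δ Λ Φ) (hφ : IsCutoff δ c φ) {t : ℝ} (ht : t ∈ Ioo 0 T) :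
    Continuous (fun x => heatWeight φ T x t * volDensity g Φ x *
      ‖deriv (u (Φ.symm x)) t - (1 / (2 * (T - t))) • radialD (fun y => u (Φ.symm y) t) x‖ ^ 2) ∧
    Integrable (fun x => heatWeight φ T x t * volDensity g Φ x *
      ‖deriv (u (Φ.symm x)) t -
        (1 / (2 * (T - t))) • radialD (fun y => u (Φ.symm y) t) x‖ ^ 2) := by
  have h := hu.isLocalFlow hΦ.mem_atlas
  have hc : ContinuousOn (fun x => heatWeight φ T x t * volDensity g Φ x *
      ‖deriv (u (Φ.symm x)) t - (1 / (2 * (T - t))) • radialD (fun y => u (Φ.symm y) t) x‖ ^ 2)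
      Φ.target :=
    ((contDiff_heatWeight (n := 0) (hφ.contDiff.of_le (by simp))).continuous.continuousOn.mul
      h.density_smooth.continuousOn).mul
      ((contDiffOn_dissipation_factor h ht _).continuousOn.norm.pow 2)
  have h0 : ∀ x ∉ Metric.closedBall (0 : Plane) δ, heatWeight φ T x t * volDensity g Φ x *
      ‖deriv (u (Φ.symm x)) t -
        (1 / (2 * (T - t))) • radialD (fun y => u (Φ.symm y) t) x‖ ^ 2 = 0 := fun x hx => by
    rw [hφ.heatWeight_eq_zero hx]
    simp
  exact ⟨continuous_of_zero_off Φ.open_target (isCompact_closedBall 0 δ) hΦ.ball_subset hc h0,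
    integrable_of_zero_off Φ.open_target (isCompact_closedBall 0 δ) hΦ.ball_subset hc h0⟩

theorem heatDissipation_nonneg (t : ℝ) : 0 ≤ heatDissipation g Φ φ T u t :=
  integral_nonneg fun x => mul_nonneg (mul_nonneg (heatWeight_nonneg x) (Real.sqrt_nonneg _))
    (sq_nonneg _)

/-- The square of `w_s` contributes `e^{-2s}` and `dy` contributes `e^{s}`. The remaining `e^{-s}
ds` is `dt`. -/
theorem IsHarmonicHeatFlow.localDissipation_eq (hu : IsHarmonicHeatFlow g N T u)
    (hΦ : IsAdaptedChart g p₀ δ Λ Φ) (hφ : IsCutoff δ c φ) (hT : 0 < T) :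
    localDissipation g Φ φ (rescaled Φ T u) (-Real.log T) =
      ∫⁻ s in Ioi (-Real.log T),
        ENNReal.ofReal (Real.exp (-s) * heatDissipation g Φ φ T u (T - Real.exp (-s))) := by
  refine setLIntegral_congr_fun measurableSet_Ioi fun s hs => ?_
  have ht := exp_neg_mem hT hs
  have hp := Real.exp_pos (-s)
  set H : Plane → ℝ := fun x => heatWeight φ T x (T - Real.exp (-s)) * volDensity g Φ x *
      ‖deriv (u (Φ.symm x)) (T - Real.exp (-s)) - (1 / (2 * (T - (T - Real.exp (-s))))) •
        radialD (fun y => u (Φ.symm y) (T - Real.exp (-s))) x‖ ^ 2 with hH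
  have hi : Continuous H ∧ Integrable H := hu.integrable_heatDissipation hΦ hφ ht
  have h0 : ∀ x, 0 ≤ H x := fun x =>
    mul_nonneg (mul_nonneg (heatWeight_nonneg x) (Real.sqrt_nonneg _)) (sq_nonneg _)
  have h : ∀ y : Plane, gaussianWeight y * ‖deriv (fun σ => rescaled Φ T u y σ) s‖ ^ 2 *
      φ (Real.exp (-s / 2) • y) ^ 2 * volDensity g Φ (Real.exp (-s / 2) • y) =
      Real.exp (-s) ^ 2 * H (Real.exp (-s / 2) • y) := fun y => by
    by_cases hy : Real.exp (-s / 2) • y ∈ Metric.closedBall (0 : Plane) δ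
    · rw [hu.deriv_rescaled hΦ.mem_atlas (hΦ.ball_subset hy) ht, norm_smul, hH]
      simp only
      rw [← gaussianWeight_mul_cutoff, Real.norm_eq_abs, abs_of_pos hp, sub_sub_cancel]
      ring
    · simp [hH, hφ.heatWeight_eq_zero hy, hφ.eq_zero _ hy]
  simp only [h]
  have hi' : Integrable fun y => Real.exp (-s) ^ 2 * H (Real.exp (-s / 2) • y) :=
    ((integrable_comp_smul_iff volume H (Real.exp_pos (-s / 2)).ne').2 hi.2).const_mul _
  rw [← ofReal_integral_eq_lintegral_ofReal hi'
    (ae_of_all _ fun y => mul_nonneg (sq_nonneg _) (h0 _)), integral_const_mul,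
    integral_comp_exp_smul]
  congr 1
  rw [heatDissipation, ← mul_assoc, sq, mul_assoc, mul_assoc, mul_inv_cancel_left₀ hp.ne']

end Rescaling

/-! ### Local quantities bounded by the global energy. -/

section LocalBounds

variable {M : Type*} [TopologicalSpace M] [ChartedSpace Plane M] [IsManifold 𝓘(ℝ, Plane) ∞ M]
  [CompactSpace M] [T2Space M] [MeasurableSpace M] [BorelSpace M] [SecondCountableTopology M]

variable {k : ℕ} {g : Metric M} {Φ : OpenPartialHomeomorph M Plane} {φ : Plane → ℝ} {T : ℝ}
    {u : M → ℝ → Euc k} {N : Set (Euc k)} {p₀ : M} {δ Λ c : ℝ}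

theorem setIntegral_subset_chart_le (g : Metric M) {Φ : OpenPartialHomeomorph M Plane}
    (hΦ : Φ ∈ IsManifold.maximalAtlas 𝓘(ℝ, Plane) ∞ M) {h : M → ℝ} (hh : Continuous h)
    (h0 : ∀ p, 0 ≤ h p) {K : Set Plane} (hK : K ⊆ Φ.target) :
    ∫ x in K, volDensity g Φ x * h (Φ.symm x) ≤ ∫ p, h p ∂(riemannianVolume g) :=
  (setIntegral_mono_set (integrableOn_chart g hΦ hh)
    (ae_of_all _ fun x => mul_nonneg (Real.sqrt_nonneg _) (h0 _))
    hK.eventuallyLE).trans (setIntegral_chart_le g hΦ hh h0)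

namespace IsHarmonicHeatFlow

theorem energy_le (hu : IsHarmonicHeatFlow g N T u) (hT : 0 < T) {t : ℝ} (ht : t ∈ Ico 0 T) :
    energy g (fun p => u p t) ≤ energy g (fun p => u p 0) :=
  hu.energy_antitoneOn ⟨le_rfl, hT⟩ ht ht.1

theorem setIntegral_quadGrad_le (hu : IsHarmonicHeatFlow g N T u)
    (hΦ : Φ ∈ IsManifold.maximalAtlas 𝓘(ℝ, Plane) ∞ M) {K : Set Plane} (hK : K ⊆ Φ.target)
    (hKm : MeasurableSet K) {t : ℝ} (ht : t ∈ Ico 0 T) :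
    ∫ x in K, quadGrad (conformalCoeff g Φ) (fun y => u (Φ.symm y) t) x ≤
      2 * energy g (fun p => u p t) := by
  have hs := hu.contMDiff_slice ht
  have h := setIntegral_subset_chart_le g hΦ (continuous_energyDensity g hs)
    (energyDensity_nonneg g _) hK
  have h2 : 2 * energy g (fun p => u p t) =
      ∫ p, energyDensity g (fun p => u p t) p ∂(riemannianVolume g) := by
    rw [energy]
    ring
  rw [h2]
  refine (le_of_eq (setIntegral_congr_fun hKm fun x hx => ?_)).trans h
  rw [energyDensity_symm_apply g hs hΦ (hK hx), volDensity_mul_gradSq]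
  rfl

theorem integrableOn_quadGrad (hu : IsHarmonicHeatFlow g N T u)
    (hΦ : Φ ∈ IsManifold.maximalAtlas 𝓘(ℝ, Plane) ∞ M) {K : Set Plane} (hK : K ⊆ Φ.target)
    (hKc : IsCompact K) {t : ℝ} (ht : t ∈ Ico 0 T) :
    IntegrableOn (quadGrad (conformalCoeff g Φ) (fun y => u (Φ.symm y) t)) K := by
  have h := hu.isLocalFlow hΦ
  have hs : ContinuousOn (quadGrad (conformalCoeff g Φ) (fun y => u (Φ.symm y) t)) Φ.target :=
    (contDiffOn_quadGrad h.isOpen h.coeff_smooth (contDiffOn_slice h.smooth ht)).continuousOn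
  exact (hs.mono hK).integrableOn_compact hKc

theorem continuousOn_heatEnergy (hu : IsHarmonicHeatFlow g N T u)
    (hΦ : IsAdaptedChart g p₀ δ Λ Φ) (hφ : IsCutoff δ c φ) :
    ContinuousOn (heatEnergy g Φ φ T u) (Ico 0 T) :=
  continuousOn_const.mul ((hu.isLocalFlow hΦ.mem_atlas).continuousOn_energy
    (isCompact_closedBall 0 δ) hΦ.ball_subset
    (contDiffOn_heatWeight (n := 0) (fun t ht => ht.2)
      (hφ.contDiff.of_le (by simp))).continuousOn fun _ hx t => hφ.heatWeight_eq_zero hx t)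

theorem heatEnergy_nonneg (hδ : 0 < δ) (hΛ : 0 < Λ) (hΦ : IsAdaptedChart g p₀ δ Λ Φ)
    (hφ : IsCutoff δ c φ) (t : ℝ) : 0 ≤ heatEnergy g Φ φ T u t := by
  refine mul_nonneg (by norm_num) (integral_nonneg fun x => ?_)
  by_cases hx : x ∈ Metric.closedBall (0 : Plane) δ
  · exact mul_nonneg (heatWeight_nonneg x) ((hΦ.coeffBounds hδ hΛ).quadGrad_nonneg hx _)
  · simp [hφ.heatWeight_eq_zero hx]

theorem heatWeight_le_one (hφ : IsCutoff δ c φ) {t : ℝ} (ht : t < T) (x : Plane) :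
    heatWeight φ T x t ≤ 1 := by
  have h1 : Real.exp (-‖x‖ ^ 2 / (4 * (T - t))) ≤ 1 := by
    rw [Real.exp_le_one_iff]
    have : 0 < T - t := by linarith
    exact div_nonpos_of_nonpos_of_nonneg (neg_nonpos.2 (sq_nonneg _)) (by positivity)
  exact mul_le_one₀ h1 (sq_nonneg _) (pow_le_one₀ (hφ.mem_Icc x).1 (hφ.mem_Icc x).2)

theorem heatEnergy_le (hu : IsHarmonicHeatFlow g N T u) (hδ : 0 < δ) (hΛ : 0 < Λ)
    (hΦ : IsAdaptedChart g p₀ δ Λ Φ) (hφ : IsCutoff δ c φ) {t : ℝ} (ht : t ∈ Ico 0 T) :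
    heatEnergy g Φ φ T u t ≤ energy g (fun p => u p t) := by
  have hK : IsCompact (Metric.closedBall (0 : Plane) δ) := isCompact_closedBall 0 δ
  have h1 := hu.setIntegral_quadGrad_le hΦ.mem_atlas hΦ.ball_subset hK.measurableSet ht
  have h2 : ∫ x, heatWeight φ T x t * quadGrad (conformalCoeff g Φ) (fun y => u (Φ.symm y) t) x ≤
      ∫ x in Metric.closedBall (0 : Plane) δ,
        quadGrad (conformalCoeff g Φ) (fun y => u (Φ.symm y) t) x := by
    rw [← integral_indicator hK.measurableSet]
    have hb := hΦ.coeffBounds hδ hΛ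
    refine integral_mono_of_nonneg (ae_of_all _ fun x => ?_)
      ((hu.integrableOn_quadGrad hΦ.mem_atlas hΦ.ball_subset hK ht).integrable_indicator
        hK.measurableSet) (ae_of_all _ fun x => ?_)
    · by_cases hx : x ∈ Metric.closedBall (0 : Plane) δ
      · exact mul_nonneg (heatWeight_nonneg x) (hb.quadGrad_nonneg hx _)
      · simp [hφ.heatWeight_eq_zero hx]
    · by_cases hx : x ∈ Metric.closedBall (0 : Plane) δ
      · simp only [indicator_of_mem hx]
        exact mul_le_of_le_one_left (hb.quadGrad_nonneg hx _) (heatWeight_le_one hφ ht.2 x)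
      · simp [hφ.heatWeight_eq_zero hx, indicator_of_notMem hx]
  rw [heatEnergy]
  linarith

/-- A crude bound, splitting the square and using `|x·∇u|² ≤ 2 L δ² Q`. It degenerates like `(T -
t)⁻²` and serves only for times bounded away from `T`. -/
theorem heatDissipation_le (hu : IsHarmonicHeatFlow g N T u) (hδ : 0 < δ)
    (hΦ : IsAdaptedChart g p₀ δ Λ Φ) (hφ : IsCutoff δ c φ) {L : ℝ}
    (hb : CoeffBounds (conformalCoeff g Φ) (volDensity g Φ) δ L) {t : ℝ} (ht : t ∈ Ioo 0 T) :
    heatDissipation g Φ φ T u t ≤ 2 * (∫ p, ‖deriv (u p) t‖ ^ 2 ∂(riemannianVolume g)) +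
      2 * L ^ 2 * δ ^ 2 / (T - t) ^ 2 * energy g (fun p => u p t) := by
  have hK : IsCompact (Metric.closedBall (0 : Plane) δ) := isCompact_closedBall 0 δ
  have hτ : 0 < T - t := by linarith [ht.2]
  have ht' : t ∈ Ico 0 T := ⟨ht.1.le, ht.2⟩
  have hQ := hu.setIntegral_quadGrad_le hΦ.mem_atlas hΦ.ball_subset hK.measurableSet ht'
  have hcont : Continuous fun p => ‖deriv (u p) t‖ ^ 2 := (hu.continuous_deriv ht).norm.pow 2
  have hI := setIntegral_subset_chart_le g hΦ.mem_atlas hcont (fun p => sq_nonneg _)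
    hΦ.ball_subset
  have hiQ := hu.integrableOn_quadGrad hΦ.mem_atlas hΦ.ball_subset hK ht'
  have hiI := (integrableOn_chart g hΦ.mem_atlas hcont).mono_set hΦ.ball_subset
  have hL := hb.pos
  have hsum : IntegrableOn (fun x => 2 * (volDensity g Φ x * ‖deriv (u (Φ.symm x)) t‖ ^ 2) +
      L ^ 2 * δ ^ 2 / (T - t) ^ 2 * quadGrad (conformalCoeff g Φ) (fun y => u (Φ.symm y) t) x)
      (Metric.closedBall (0 : Plane) δ) := (hiI.const_mul 2).add (hiQ.const_mul _)
  have hmain : heatDissipation g Φ φ T u t ≤ ∫ x in Metric.closedBall (0 : Plane) δ,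
      (2 * (volDensity g Φ x * ‖deriv (u (Φ.symm x)) t‖ ^ 2) + L ^ 2 * δ ^ 2 / (T - t) ^ 2 *
        quadGrad (conformalCoeff g Φ) (fun y => u (Φ.symm y) t) x) := by
    rw [← integral_indicator hK.measurableSet]
    refine integral_mono (hu.integrable_heatDissipation hΦ hφ ht).2
      (hsum.integrable_indicator hK.measurableSet)
      fun x => ?_
    by_cases hx : x ∈ Metric.closedBall (0 : Plane) δ
    · simp only [indicator_of_mem hx]
      set X := radialD (fun y => u (Φ.symm y) t) x with hX
      set w := deriv (u (Φ.symm x)) t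
      set Q := quadGrad (conformalCoeff g Φ) (fun y => u (Φ.symm y) t) x with hQdef
      have hxδ : ‖x‖ ≤ δ := mem_closedBall_zero_iff.1 hx
      have h1 : ‖w - (1 / (2 * (T - t))) • X‖ ^ 2 ≤
          2 * ‖w‖ ^ 2 + 1 / (2 * (T - t) ^ 2) * ‖X‖ ^ 2 := by
        have h2 : ‖w - (1 / (2 * (T - t))) • X‖ ≤ ‖w‖ + 1 / (2 * (T - t)) * ‖X‖ := by
          refine (norm_sub_le _ _).trans (le_of_eq ?_)
          rw [norm_smul, Real.norm_eq_abs, abs_of_pos (by positivity)]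
        have h3 := pow_le_pow_left₀ (norm_nonneg _) h2 2
        have h4 : 2 * (1 / (2 * (T - t)) * ‖X‖) ^ 2 = 1 / (2 * (T - t) ^ 2) * ‖X‖ ^ 2 := by
          field_simp
        nlinarith [sq_nonneg (‖w‖ - 1 / (2 * (T - t)) * ‖X‖)]
      have h2 : ‖X‖ ^ 2 ≤ δ ^ 2 * (2 * L * Q) := by
        have h3 : ‖X‖ ≤ ‖x‖ * (‖partialD 0 (fun y => u (Φ.symm y) t) x‖ +
            ‖partialD 1 (fun y => u (Φ.symm y) t) x‖) := by
          rw [hX, radialD, Fin.sum_univ_two, mul_add]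
          refine (norm_add_le _ _).trans (add_le_add ?_ ?_) <;>
          · rw [norm_smul]
            exact mul_le_mul_of_nonneg_right (abs_coord_le x _) (norm_nonneg _)
        have h4 := pow_le_pow_left₀ (norm_nonneg _) h3 2
        rw [mul_pow] at h4
        exact h4.trans (mul_le_mul (pow_le_pow_left₀ (norm_nonneg _) hxδ 2)
          (hb.sq_le_quadGrad hx _) (sq_nonneg _) (sq_nonneg _))
      have hQ0 : 0 ≤ Q := hb.quadGrad_nonneg hx _
      have hm := hb.density_upper x hx
      have hm0 : 0 ≤ volDensity g Φ x := Real.sqrt_nonneg _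
      have h5 : heatWeight φ T x t * volDensity g Φ x * ‖w - (1 / (2 * (T - t))) • X‖ ^ 2 ≤
          volDensity g Φ x * (2 * ‖w‖ ^ 2 + 1 / (2 * (T - t) ^ 2) * ‖X‖ ^ 2) := by
        refine mul_le_mul ?_ h1 (sq_nonneg _) hm0
        exact mul_le_of_le_one_left hm0 (heatWeight_le_one hφ ht.2 x)
      have h6 : volDensity g Φ x * (1 / (2 * (T - t) ^ 2) * ‖X‖ ^ 2) ≤
          L * (1 / (2 * (T - t) ^ 2) * (δ ^ 2 * (2 * L * Q))) :=
        mul_le_mul hm (mul_le_mul_of_nonneg_left h2 (by positivity)) (by positivity) hL.le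
      have h7 : L * (1 / (2 * (T - t) ^ 2) * (δ ^ 2 * (2 * L * Q))) =
          L ^ 2 * δ ^ 2 / (T - t) ^ 2 * Q := by
        field_simp
      linarith
    · simp [hφ.heatWeight_eq_zero hx, indicator_of_notMem hx]
  refine hmain.trans ?_
  rw [integral_add (hiI.const_mul 2) (hiQ.const_mul _), integral_const_mul, integral_const_mul]
  have h8 := mul_le_mul_of_nonneg_left hQ (show 0 ≤ L ^ 2 * δ ^ 2 / (T - t) ^ 2 by positivity)
  have h9 : L ^ 2 * δ ^ 2 / (T - t) ^ 2 * (2 * energy g fun p => u p t) =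
      2 * L ^ 2 * δ ^ 2 / (T - t) ^ 2 * energy g (fun p => u p t) := by ring
  linarith

end IsHarmonicHeatFlow

end LocalBounds

/-! ### The monotonicity formula and the dissipation bound. -/

section MonotonicityFormula

variable {M : Type*} [TopologicalSpace M] [ChartedSpace Plane M] [IsManifold 𝓘(ℝ, Plane) ∞ M]
  [CompactSpace M] [T2Space M] [MeasurableSpace M] [BorelSpace M] [SecondCountableTopology M]

theorem hasDerivAt_time (T s : ℝ) :
    HasDerivAt (fun s : ℝ => T - Real.exp (-s)) (Real.exp (-s)) s := by
  have := ((hasDerivAt_id s).neg.exp).const_sub T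
  simpa using this

theorem hasDerivAt_comp_time {h : ℝ → ℝ} {h' T s : ℝ} (hh : HasDerivAt h h' (T - Real.exp (-s))) :
    HasDerivAt (fun s => h (T - Real.exp (-s))) (h' * Real.exp (-s)) s :=
  HasDerivAt.comp s hh (hasDerivAt_time T s)

/-- The number `β^{8/3}` solves `(8/3) A τ^{3/8} = log m`. -/
theorem exists_exp_rpow_le {A m : ℝ} (hA : 0 < A) (hm : 1 < m) :
    ∃ τ₀ : ℝ, 0 < τ₀ ∧ τ₀ ≤ 1 ∧ ∀ τ : ℝ, 0 ≤ τ → τ ≤ τ₀ →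
      Real.exp (8 / 3 * A * τ ^ (3 / 8 : ℝ)) ≤ m := by
  have hl : 0 < Real.log m := Real.log_pos hm
  set β := Real.log m / (8 / 3 * A) with hβ
  have hβ0 : 0 < β := by positivity
  refine ⟨min 1 (β ^ (8 / 3 : ℝ)), lt_min one_pos (Real.rpow_pos_of_pos hβ0 _), min_le_left _ _,
    fun τ h0 h => ?_⟩
  have h1 : τ ^ (3 / 8 : ℝ) ≤ β := by
    calc τ ^ (3 / 8 : ℝ) ≤ (β ^ (8 / 3 : ℝ)) ^ (3 / 8 : ℝ) :=
          Real.rpow_le_rpow h0 (h.trans (min_le_right _ _)) (by norm_num)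
      _ = β := by rw [← Real.rpow_mul hβ0.le]; norm_num
  rw [← Real.le_log_iff_exp_le (by linarith)]
  calc 8 / 3 * A * τ ^ (3 / 8 : ℝ) ≤ 8 / 3 * A * β := mul_le_mul_of_nonneg_left h1 (by positivity)
    _ = Real.log m := by rw [hβ]; field_simp

variable {k : ℕ} {g : Metric M} {Φ : OpenPartialHomeomorph M Plane} {φ : Plane → ℝ} {T : ℝ}
    {u : M → ℝ → Euc k} {N : Set (Euc k)} {p₀ : M} {δ Λ c : ℝ}

/-- The dissipation on a bounded range of rescaled times is controlled by the energy identity. -/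
theorem IsHarmonicHeatFlow.lintegral_Ioc_dissipation_le (hu : IsHarmonicHeatFlow g N T u)
    (hT : 0 < T) (hδ : 0 < δ) (hΛ : 0 < Λ) (hΦ : IsAdaptedChart g p₀ δ Λ Φ) (hφ : IsCutoff δ c φ)
    {L : ℝ} (hb : CoeffBounds (conformalCoeff g Φ) (volDensity g Φ) δ L) {a : ℝ}
    (ha : -Real.log T ≤ a) :
    ∫⁻ s in Ioc (-Real.log T) a,
        ENNReal.ofReal (Real.exp (-s) * heatDissipation g Φ φ T u (T - Real.exp (-s))) ≤
      ENNReal.ofReal ((2 + 2 * L ^ 2 * δ ^ 2 * (Real.exp a - Real.exp (-Real.log T))) *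
        energy g (fun p => u p 0)) := by
  set E₀ := energy g (fun p => u p 0) with hE
  obtain ⟨hcont, hder⟩ := hu.energy_continuousOn_and_hasDerivAt
  have hct : Continuous fun s : ℝ => T - Real.exp (-s) := by fun_prop
  -- The comparison function is built so that `2E` pays for the part with `u_t`, while `e^s` pays
  -- for the radial part, because `e^{-s} (T - t)⁻² = e^{s}`.
  have hc : ContinuousOn (fun s : ℝ => 2 * energy g (fun p => u p (T - Real.exp (-s))) -
      2 * L ^ 2 * δ ^ 2 * E₀ * Real.exp s) (Icc (-Real.log T) a) := by
    refine (continuousOn_const.mul (hcont.comp hct.continuousOn fun s hs =>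
      exp_neg_mem_Ico hT hs.1)).sub ?_
    fun_prop
  have hd : ∀ s ∈ Ioo (-Real.log T) a, HasDerivAt
      (fun s : ℝ => 2 * energy g (fun p => u p (T - Real.exp (-s))) -
        2 * L ^ 2 * δ ^ 2 * E₀ * Real.exp s)
      (2 * (-(∫ p, ‖deriv (u p) (T - Real.exp (-s))‖ ^ 2 ∂(riemannianVolume g)) *
        Real.exp (-s)) - 2 * L ^ 2 * δ ^ 2 * E₀ * Real.exp s) s := fun s hs => by
    have h1 := hder _ (exp_neg_mem hT hs.1)
    exact ((hasDerivAt_comp_time h1).const_mul 2).sub ((Real.hasDerivAt_exp s).const_mul _)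
  refine (lintegral_Ioc_le_of_deriv_le ha hc hd
    (fun s _ => mul_nonneg (Real.exp_pos _).le (heatDissipation_nonneg _))
    fun s hs => ?_).trans (ENNReal.ofReal_le_ofReal ?_)
  · have ht := exp_neg_mem hT hs.1
    have h1 := hu.heatDissipation_le hδ hΦ hφ hb ht
    have h2 := hu.energy_le hT ⟨ht.1.le, ht.2⟩
    rw [sub_sub_cancel] at h1
    have h3 := mul_le_mul_of_nonneg_left h2
      (show 0 ≤ 2 * L ^ 2 * δ ^ 2 / Real.exp (-s) ^ 2 by positivity)
    have h4 := mul_le_mul_of_nonneg_left (h1.trans (add_le_add_right h3 _))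
      (Real.exp_pos (-s)).le
    have h5 : Real.exp (-s) * (2 * L ^ 2 * δ ^ 2 / Real.exp (-s) ^ 2 * E₀) =
        2 * L ^ 2 * δ ^ 2 * E₀ * Real.exp s := by
      rw [Real.exp_neg]
      have := (Real.exp_pos s).ne'
      field_simp
    rw [mul_add] at h4
    linarith
  · have h1 := hu.energy_le hT (exp_neg_mem_Ico hT le_rfl)
    have h2 := energy_nonneg g (fun p => u p (T - Real.exp (-a)))
    linarith

/-- All constants are built from `δ`, `Λ`, `c` and `κ` before a chart, a cut-off function or a
solution is introduced. -/
theorem exists_monotonicity_constants (g : Metric M) {δ Λ c κ : ℝ} (hδ : 0 < δ) (hΛ : 0 < Λ)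
    (hc : 0 < c) (hκ : 1 < κ) :
    ∃ C : ℝ, 0 < C ∧ ∃ s₀ : ℝ, ∀ (p₀ : M) (Φ : OpenPartialHomeomorph M Plane),
      IsAdaptedChart g p₀ δ Λ Φ → ∀ φ : Plane → ℝ, IsCutoff δ c φ →
      ∀ (k : ℕ) (N : Set (Euc k)) (T : ℝ), 0 < T → ∀ u : M → ℝ → Euc k,
        IsHarmonicHeatFlow g N T u →
        (∀ s' s : ℝ, s₀ ≤ s' → -Real.log T ≤ s' → s' < s →
          localEnergy g Φ φ (rescaled Φ T u) s ≤
            (1 + κ⁻¹) * localEnergy g Φ φ (rescaled Φ T u) s' +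
              C * Real.exp (-κ * s') * energy g (fun p => u p 0)) ∧
        localDissipation g Φ φ (rescaled Φ T u) (-Real.log T) ≤
          ENNReal.ofReal (C * energy g (fun p => u p 0)) := by
  obtain ⟨C₀, hC₀, htail⟩ := gaussian_tail_bounds hδ hκ
  have hκ0 : 0 < κ := by linarith
  set L := 5 * (1 + Λ) ^ 6 with hL
  have hL0 : 0 < L := by positivity
  set A := 4 * (2 * L ^ 4 + L ^ 2) with hA
  have hA0 : 0 < A := by positivity
  set B := (2 * L ^ 4 + L ^ 2 + 32 * (c / δ) ^ 2 * L ^ 4 + c) * C₀ with hB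
  have hB0 : 0 < B := by positivity
  set m := 1 + κ⁻¹ with hm
  have hm1 : 1 < m := by
    have : 0 < κ⁻¹ := by positivity
    linarith
  obtain ⟨τ₀, hτ₀, hτ₀1, hexp⟩ := exists_exp_rpow_le hA0 hm1
  -- So that `K κ = 2 B m`: the unweighted integral of `Q` over the ball is at most `2 E(u_0)`, and
  -- `m` bounds the integrating factor.
  set K := 2 * B * m / κ with hK
  have hK0 : 0 < K := by
    have : 0 < m := by linarith
    positivity
  have hm0 : 0 < m := by linarith
  -- The first summand serves the monotonicity inequality, the second the dissipation up to `s =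
  -- -log τ₀`, the third the later dissipation. Both claims share one constant.
  refine ⟨K + (2 + 2 * L ^ 2 * δ ^ 2 * Real.exp (-Real.log τ₀)) + 2 * (m + K), by positivity,
    -Real.log τ₀, fun p₀ Φ hΦ φ hφ k N T hT u hu => ?_⟩
  have hb := hΦ.coeffBounds hδ hΛ
  set E₀ := energy g (fun p => u p 0) with hE
  have hE0 : 0 ≤ E₀ := energy_nonneg g _
  set F := heatEnergy g Φ φ T u with hF
  set D := heatDissipation g Φ φ T u with hD
  have hFc : ContinuousOn F (Ico 0 T) := hu.continuousOn_heatEnergy hΦ hφ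
  have hF0 : ∀ t, 0 ≤ F t := IsHarmonicHeatFlow.heatEnergy_nonneg hδ hΛ hΦ hφ
  have hD0 : ∀ t, 0 ≤ D t := fun t => heatDissipation_nonneg t
  have hFE : ∀ t ∈ Ico 0 T, F t ≤ E₀ := fun t ht =>
    (hu.heatEnergy_le hδ hΛ hΦ hφ ht).trans (hu.energy_le hT ht)
  set Ψ := correctedEnergy A (K * E₀) κ T F with hΨ
  have hd : ∀ t ∈ Ioo 0 T, T - t ≤ τ₀ →
      ∃ Ψ', HasDerivAt Ψ Ψ' t ∧ Ψ' ≤ -(1 / 2 * D t) := fun t ht hτ => by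
    have hτ0 : 0 < T - t := by linarith [ht.2]
    obtain ⟨F', h1, h2⟩ := (hu.isLocalFlow hΦ.mem_atlas).exists_hasDerivAt_heatEnergy hb hδ
      hΦ.ball_subset hφ ht (htail (T - t) hτ0 (hτ.trans hτ₀1)) hC₀
    refine exists_hasDerivAt_correctedEnergy (B := 2 * B * E₀) (M := m) (D := D) hA0.le
      (by positivity) hκ0 (le_of_eq (by rw [hK]; field_simp)) ht.2
      (hexp _ hτ0.le hτ) h1 (hD0 t) (h2.trans ?_)
    have h3 := (hu.setIntegral_quadGrad_le hΦ.mem_atlas hΦ.ball_subset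
      (isCompact_closedBall 0 δ).measurableSet ⟨ht.1.le, ht.2⟩).trans
      (mul_le_mul_of_nonneg_left (hu.energy_le hT ⟨ht.1.le, ht.2⟩) zero_le_two)
    have h4 := mul_le_mul_of_nonneg_left h3
      (show 0 ≤ B * (T - t) ^ (κ - 1) from mul_nonneg hB0.le (Real.rpow_nonneg hτ0.le _))
    have h5 : B * (T - t) ^ (κ - 1) * (2 * E₀) = 2 * B * E₀ * (T - t) ^ (κ - 1) := by ring
    rw [hD, heatDissipation]
    exact add_le_add le_rfl (h4.trans_eq h5)
  have hτ : ∀ s, -Real.log τ₀ ≤ s → T - (T - Real.exp (-s)) ≤ τ₀ := fun s hs => by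
    rw [sub_sub_cancel, ← Real.le_log_iff_exp_le hτ₀]
    linarith
  have hFΨ : ∀ t < T, F t ≤ Ψ t := fun t ht => by
    have hτ0 : 0 < T - t := by linarith
    have h1 : 1 ≤ Real.exp (8 / 3 * A * (T - t) ^ (3 / 8 : ℝ)) := Real.one_le_exp
      (mul_nonneg (by positivity) (Real.rpow_nonneg hτ0.le _))
    have h2 : 0 ≤ K * E₀ * (T - t) ^ κ :=
      mul_nonneg (by positivity) (Real.rpow_nonneg hτ0.le _)
    have h3 := mul_le_mul_of_nonneg_right h1 (hF0 t)
    simp only [hΨ, correctedEnergy]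
    linarith
  have hΨF : ∀ s, -Real.log τ₀ ≤ s → Ψ (T - Real.exp (-s)) ≤
      m * F (T - Real.exp (-s)) + K * E₀ * Real.exp (-κ * s) := fun s hs => by
    have h1 := hexp (Real.exp (-s)) (Real.exp_pos _).le (by simpa using hτ s hs)
    have h2 := mul_le_mul_of_nonneg_right h1 (hF0 (T - Real.exp (-s)))
    have h3 : Real.exp (-s) ^ κ = Real.exp (-κ * s) := by
      rw [← Real.exp_mul]
      congr 1
      ring
    simp only [hΨ, correctedEnergy, sub_sub_cancel, h3]
    linarith
  refine ⟨fun s' s hs₀ hsT hss => ?_, ?_⟩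
  · rw [localEnergy_eq, localEnergy_eq]
    have ht' := exp_neg_mem_Ico hT hsT
    have ht := exp_neg_mem_Ico hT (hsT.trans hss.le)
    have h1 : T - Real.exp (-s') ≤ T - Real.exp (-s) := by
      have := Real.exp_le_exp.2 (neg_le_neg hss.le)
      linarith
    have h2 := correctedEnergy_antitone hκ0 hFc hd (fun t _ => hD0 t) ht'.1 h1 ht.2 (hτ s' hs₀)
    have h3 : K * E₀ * Real.exp (-κ * s') ≤
        (K + (2 + 2 * L ^ 2 * δ ^ 2 * Real.exp (-Real.log τ₀)) + 2 * (m + K)) *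
          Real.exp (-κ * s') * E₀ := by
      rw [mul_right_comm]
      refine mul_le_mul_of_nonneg_right (mul_le_mul_of_nonneg_right ?_ (Real.exp_pos _).le) hE0
      have : 0 ≤ (2 + 2 * L ^ 2 * δ ^ 2 * Real.exp (-Real.log τ₀)) + 2 * (m + K) := by
        positivity
      linarith
    exact (hFΨ _ ht.2).trans (h2.trans ((hΨF s' hs₀).trans (add_le_add le_rfl h3)))
  · rw [hu.localDissipation_eq hΦ hφ hT]
    -- If `T ≤ τ₀`, the early interval is empty and the corrected energy controls all times.
    set a := max (-Real.log T) (-Real.log τ₀) with ha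
    have haT : -Real.log T ≤ a := le_max_left _ _
    have haτ : -Real.log τ₀ ≤ a := le_max_right _ _
    rw [← Ioc_union_Ioi_eq_Ioi haT]
    have hearly := hu.lintegral_Ioc_dissipation_le hT hδ hΛ hΦ hφ hb haT
    have hct : Continuous fun s : ℝ => T - Real.exp (-s) := by fun_prop
    -- The corrected energy decreases at least at the rate `½ D`, hence the factor 2.
    have hlate : ∫⁻ s in Ioi a, ENNReal.ofReal (Real.exp (-s) * D (T - Real.exp (-s))) ≤
        ENNReal.ofReal (2 * Ψ (T - Real.exp (-a))) := by
      refine lintegral_Ioi_le_of_deriv_le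
        (Θ := fun s => 2 * Ψ (T - Real.exp (-s)))
        (Θ' := fun s => 2 * (deriv Ψ (T - Real.exp (-s)) * Real.exp (-s)))
        (continuousOn_const.mul ((continuousOn_correctedEnergy hκ0 hFc).comp hct.continuousOn
          fun s hs => exp_neg_mem_Ico hT (haT.trans hs))) (fun s hs => ?_)
        (fun s _ => mul_nonneg (Real.exp_pos _).le (hD0 _)) (fun s hs => ?_)
        (fun s hs => ?_)
      · obtain ⟨Ψ', h1, h2⟩ := hd _ (exp_neg_mem hT (haT.trans_lt hs)) (hτ s (haτ.trans hs.le))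
        rw [h1.deriv]
        exact (hasDerivAt_comp_time h1).const_mul 2
      · obtain ⟨Ψ', h1, h2⟩ := hd _ (exp_neg_mem hT (haT.trans_lt hs)) (hτ s (haτ.trans hs.le))
        rw [h1.deriv]
        have := mul_le_mul_of_nonneg_right h2 (Real.exp_pos (-s)).le
        linarith
      · have := (hF0 _).trans (hFΨ _ (exp_neg_mem_Ico hT (haT.trans hs)).2)
        linarith
    refine (lintegral_union_le _ _ _).trans ((add_le_add hearly hlate).trans ?_)
    have h1 := (hΨF a haτ).trans (add_le_add
      (mul_le_mul_of_nonneg_left (hFE _ (exp_neg_mem_Ico hT haT)) hm0.le)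
      (mul_le_of_le_one_right (by positivity) (b := Real.exp (-κ * a)) (by
        rw [Real.exp_le_one_iff]
        have : 0 ≤ a := le_trans (by
          have := Real.log_nonpos hτ₀.le hτ₀1
          linarith) haτ
        nlinarith)))
    -- This removes the dependence on `T`: the early part costs at most `e^{-log τ₀}`, or nothing
    -- when the interval is empty.
    have h2 : Real.exp a - Real.exp (-Real.log T) ≤ Real.exp (-Real.log τ₀) := by
      rcases max_choice (-Real.log T) (-Real.log τ₀) with h | h
      · rw [ha, h, sub_self]
        exact (Real.exp_pos _).le
      · rw [ha, h]
        linarith [Real.exp_pos (-Real.log T)]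
    have h3 : 0 ≤ Real.exp a - Real.exp (-Real.log T) := by
      have := Real.exp_le_exp.2 haT
      linarith
    have h4 : 0 ≤ Ψ (T - Real.exp (-a)) := (hF0 _).trans (hFΨ _ (exp_neg_mem_Ico hT haT).2)
    rw [← ENNReal.ofReal_add (mul_nonneg (by positivity) hE0) (by linarith)]
    refine ENNReal.ofReal_le_ofReal ?_
    have h5 := mul_le_mul_of_nonneg_left h2 (show 0 ≤ 2 * L ^ 2 * δ ^ 2 * E₀ by positivity)
    have h6 : 0 ≤ K * E₀ := by positivity
    linarith

end MonotonicityFormula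

/-! ### Quadratic coordinates that make a metric Euclidean to first order. -/

section QuadraticCoordinates

/-- The matrix of partial derivatives of a matrix-valued function. -/
def matrixD (m : Fin 2) (A : Plane → Matrix (Fin 2) (Fin 2) ℝ) (x : Plane) :
    Matrix (Fin 2) (Fin 2) ℝ :=
  Matrix.of fun i j => partialD m (fun y => A y i j) x

theorem matrixD_mul {A C : Plane → Matrix (Fin 2) (Fin 2) ℝ} {x : Plane}
    (hA : ∀ i j, DifferentiableAt ℝ (fun y => A y i j) x)
    (hC : ∀ i j, DifferentiableAt ℝ (fun y => C y i j) x) (m : Fin 2) :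
    matrixD m (fun y => A y * C y) x = matrixD m A x * C x + A x * matrixD m C x := by
  ext i j
  simp only [matrixD, Matrix.of_apply, Matrix.mul_apply, Matrix.add_apply]
  have hd : ∀ l, DifferentiableAt ℝ (fun y => A y i l * C y l j) x := fun l =>
    (hA i l).mul (hC l j)
  rw [partialD_sum (f := fun l y => A y i l * C y l j) hd, ← Finset.sum_add_distrib]
  exact Finset.sum_congr rfl fun l _ => partialD_mul (hA i l) (hC l j) m

theorem matrixD_const (A : Matrix (Fin 2) (Fin 2) ℝ) (m : Fin 2) (x : Plane) :
    matrixD m (fun _ => A) x = 0 := by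
  ext i j
  simp [matrixD, partialD]

theorem differentiableAt_matrix_mul {A C : Plane → Matrix (Fin 2) (Fin 2) ℝ} {x : Plane}
    (hA : ∀ i j, DifferentiableAt ℝ (fun y => A y i j) x)
    (hC : ∀ i j, DifferentiableAt ℝ (fun y => C y i j) x) (i j : Fin 2) :
    DifferentiableAt ℝ (fun y => (A y * C y) i j) x := by
  simp only [Matrix.mul_apply, Fin.sum_univ_two]
  exact ((hA i 0).mul (hC 0 j)).add ((hA i 1).mul (hC 1 j))

/-- The quadratic change of coordinates `x ↦ z + B (x - ½ Γ(x, x))`. -/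
def quadMap (z : Plane) (B : Matrix (Fin 2) (Fin 2) ℝ) (Γ : Fin 2 → Fin 2 → Fin 2 → ℝ)
    (x : Plane) : Plane :=
  WithLp.toLp 2 fun a => z a + ∑ l, B a l * (x l - 1 / 2 * ∑ j, ∑ k, Γ l j k * (x j * x k))

/-- The Jacobian matrix of `x ↦ x - ½ Γ(x, x)`. -/
def quadJac (Γ : Fin 2 → Fin 2 → Fin 2 → ℝ) (x : Plane) : Matrix (Fin 2) (Fin 2) ℝ :=
  Matrix.of fun l i => (if l = i then 1 else 0) - ∑ j, Γ l j i * x j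

variable {z : Plane} {B : Matrix (Fin 2) (Fin 2) ℝ} {Γ : Fin 2 → Fin 2 → Fin 2 → ℝ}

theorem quadMap_apply (x : Plane) (a : Fin 2) : quadMap z B Γ x a =
    z a + ∑ l, B a l * (x l - 1 / 2 * ∑ j, ∑ k, Γ l j k * (x j * x k)) := rfl

theorem quadMap_zero : quadMap z B Γ 0 = z := by
  ext a
  simp [quadMap_apply]

theorem contDiff_quadMap {n : ℕ∞ω} : ContDiff ℝ n (quadMap z B Γ) := by
  rw [contDiff_euclidean]
  intro a
  simp only [quadMap_apply]
  have h : ∀ i, ContDiff ℝ n fun x : Plane => x i := fun i => contDiff_coord i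
  fun_prop

theorem partialD_const_mul {f : Plane → ℝ} {x : Plane} (hf : DifferentiableAt ℝ f x) (r : ℝ)
    (i : Fin 2) : partialD i (fun y => r * f y) x = r * partialD i f x := by
  rw [partialD, fderiv_const_mul hf]
  rfl

theorem partialD_const_add {f : Plane → ℝ} {x : Plane} (r : ℝ)
    (i : Fin 2) : partialD i (fun y => r + f y) x = partialD i f x := by
  rw [partialD, fderiv_const_add]
  rfl

theorem differentiableAt_quadForm (c : Fin 2 → Fin 2 → ℝ) (x : Plane) :
    DifferentiableAt ℝ (fun y : Plane => ∑ j, ∑ k, c j k * (y j * y k)) x := by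
  have h : ∀ i, DifferentiableAt ℝ (fun y : Plane => y i) x := fun i => differentiable_coord i x
  fun_prop

theorem partialD_quadForm (c : Fin 2 → Fin 2 → ℝ) (x : Plane) (i : Fin 2) :
    partialD i (fun y : Plane => ∑ j, ∑ k, c j k * (y j * y k)) x = ∑ j, (c i j + c j i) * x j := by
  have hc : ∀ j, DifferentiableAt ℝ (fun y : Plane => y j) x := fun j => differentiable_coord j x
  have d2 : ∀ j k, DifferentiableAt ℝ (fun y : Plane => c j k * (y j * y k)) x :=
    fun j k => ((hc j).mul (hc k)).const_mul _
  have d3 : ∀ j, DifferentiableAt ℝ (fun y : Plane => ∑ k, c j k * (y j * y k)) x :=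
    fun j => by fun_prop
  have e2 : ∀ j k, partialD i (fun y : Plane => c j k * (y j * y k)) x =
      c j k * ((if i = j then 1 else 0) * x k + x j * (if i = k then 1 else 0)) :=
    fun j k => by
      have hd : DifferentiableAt ℝ (fun y : Plane => y j * y k) x := (hc j).mul (hc k)
      rw [partialD_const_mul hd, partialD_mul (hc j) (hc k), partialD_coord, partialD_coord]
  rw [partialD_sum d3]
  have e3 : ∀ j, partialD i (fun y : Plane => ∑ k, c j k * (y j * y k)) x =
      ∑ k, c j k * ((if i = j then 1 else 0) * x k + x j * (if i = k then 1 else 0)) := fun j => by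
    rw [partialD_sum (d2 j)]
    exact Finset.sum_congr rfl fun k _ => e2 j k
  simp only [e3]
  simp only [Fin.sum_univ_two]
  fin_cases i <;> simp <;> ring

theorem jacobian_quadMap (hΓ : ∀ l j k, Γ l j k = Γ l k j) (x : Plane) :
    jacobian (quadMap z B Γ) x = B * quadJac Γ x := by
  ext a i
  have hc : ∀ j, DifferentiableAt ℝ (fun y : Plane => y j) x := fun j => differentiable_coord j x
  have e1 : jacobian (quadMap z B Γ) x a i = partialD i (fun y => quadMap z B Γ y a) x :=
    (partialD_apply ((contDiff_quadMap (n := 1)).differentiable (by norm_num) x) i a).symm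
  have d4 : ∀ l, DifferentiableAt ℝ
      (fun y : Plane => 1 / 2 * ∑ j, ∑ k, Γ l j k * (y j * y k)) x :=
    fun l => (differentiableAt_quadForm (Γ l) x).const_mul _
  have d5 : ∀ l, DifferentiableAt ℝ
      (fun y : Plane => y l - 1 / 2 * ∑ j, ∑ k, Γ l j k * (y j * y k)) x :=
    fun l => (hc l).sub (d4 l)
  have d6 : ∀ l, DifferentiableAt ℝ
      (fun y : Plane => B a l * (y l - 1 / 2 * ∑ j, ∑ k, Γ l j k * (y j * y k))) x :=
    fun l => (d5 l).const_mul _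
  rw [e1]
  simp only [quadMap_apply]
  rw [partialD_const_add, partialD_sum d6, Matrix.mul_apply]
  refine Finset.sum_congr rfl fun l _ => ?_
  rw [partialD_const_mul (d5 l), partialD_sub (hc l) (d4 l),
    partialD_const_mul (differentiableAt_quadForm (Γ l) x), partialD_quadForm, partialD_coord]
  simp only [quadJac, Matrix.of_apply, Fin.sum_univ_two, hΓ l _ i, eq_comm (a := i)]
  ring

theorem quadJac_zero : quadJac Γ 0 = 1 := by
  ext l i
  simp [quadJac, Matrix.one_apply]

theorem differentiableAt_quadJac (x : Plane) (l i : Fin 2) :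
    DifferentiableAt ℝ (fun y => quadJac Γ y l i) x := by
  have hc : ∀ j, DifferentiableAt ℝ (fun y : Plane => y j) x := fun j => differentiable_coord j x
  simp only [quadJac, Matrix.of_apply, Fin.sum_univ_two]
  exact (((hc 0).const_mul _).add ((hc 1).const_mul _)).const_sub _

theorem matrixD_quadJac (m : Fin 2) (x : Plane) :
    matrixD m (quadJac Γ) x = -Matrix.of fun l i => Γ l m i := by
  ext l i
  have hc : ∀ j, DifferentiableAt ℝ (fun y : Plane => y j) x := fun j => differentiable_coord j x
  simp only [matrixD, quadJac, Matrix.of_apply, Matrix.neg_apply, Fin.sum_univ_two]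
  have d0 : ∀ j, DifferentiableAt ℝ (fun y : Plane => Γ l j i * y j) x :=
    fun j => (hc j).const_mul _
  have d1 : DifferentiableAt ℝ (fun y : Plane => Γ l 0 i * y 0 + Γ l 1 i * y 1) x :=
    (d0 0).add (d0 1)
  rw [partialD_sub (differentiableAt_const _) d1, partialD_add (d0 0) (d0 1), partialD_const_mul (hc 0),
    partialD_const_mul (hc 1), partialD_coord, partialD_coord]
  fin_cases m <;> simp [partialD]

/-- The first derivatives of the metric in the linear coordinates given by `B`. -/
def linearD (G : Plane → Matrix (Fin 2) (Fin 2) ℝ) (B : Matrix (Fin 2) (Fin 2) ℝ) (z : Plane)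
    (i j k : Fin 2) : ℝ :=
  ∑ c, B c k * (B.transpose * matrixD c G z * B) i j

/-- The Christoffel symbols of a metric with first derivatives `h` and with `g_ij = δ_ij`. -/
def christoffel (h : Fin 2 → Fin 2 → Fin 2 → ℝ) (l j k : Fin 2) : ℝ :=
  1 / 2 * (h l j k + h l k j - h j k l)

/-- The coefficients of the metric in the coordinates `quadMap`. -/
def quadPull (G : Plane → Matrix (Fin 2) (Fin 2) ℝ) (z : Plane) (B : Matrix (Fin 2) (Fin 2) ℝ)
    (Γ : Fin 2 → Fin 2 → Fin 2 → ℝ) (x : Plane) : Matrix (Fin 2) (Fin 2) ℝ :=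
  (B * quadJac Γ x).transpose * G (quadMap z B Γ x) * (B * quadJac Γ x)

variable {G : Plane → Matrix (Fin 2) (Fin 2) ℝ}

theorem quadPull_zero (hB : B.transpose * G z * B = 1) : quadPull G z B Γ 0 = 1 := by
  rw [quadPull, quadMap_zero, quadJac_zero, mul_one, hB]

theorem linearD_symm (hG : ∀ w i j, G w i j = G w j i) (i j k : Fin 2) :
    linearD G B z i j k = linearD G B z j i k := by
  have h : ∀ c, matrixD c G z 0 1 = matrixD c G z 1 0 := fun c => by
    simp only [matrixD, Matrix.of_apply, hG _ 0 1]
  simp only [linearD, Matrix.mul_apply, Matrix.transpose_apply, Fin.sum_univ_two]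
  rw [h 0, h 1]
  ring

theorem christoffel_symm {h : Fin 2 → Fin 2 → Fin 2 → ℝ} (hh : ∀ i j k, h i j k = h j i k)
    (l j k : Fin 2) : christoffel h l j k = christoffel h l k j := by
  simp only [christoffel]
  rw [hh j k l]
  ring

/-- The derivative at the origin is `h_{ij,m} - Γ_{jmi} - Γ_{imj}`, and the Christoffel symbols are
the symmetric solution of `Γ_{jmi} + Γ_{imj} = h_{ij,m}`. -/
theorem matrixD_quadPull_zero (hB : B.transpose * G z * B = 1)
    (hG : ∀ w i j, G w i j = G w j i) (hGd : ∀ i j, DifferentiableAt ℝ (fun w => G w i j) z)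
    (m : Fin 2) :
    matrixD m (quadPull G z B (christoffel (linearD G B z))) 0 = 0 := by
  set h := linearD G B z with hh
  have hsym : ∀ i j k, h i j k = h j i k := linearD_symm hG
  set Γ := christoffel h with hΓ
  set ψ := quadMap z B Γ with hψ
  have hψ0 : ψ 0 = z := quadMap_zero
  have hψd : DifferentiableAt ℝ ψ 0 := (contDiff_quadMap (n := 1)).differentiable (by norm_num) 0
  have hJ : jacobian ψ 0 = B := by
    rw [hψ, jacobian_quadMap (christoffel_symm hsym), quadJac_zero, mul_one]
  have hGψd : ∀ i j, DifferentiableAt ℝ (fun x => G (ψ x) i j) 0 := fun i j =>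
    DifferentiableAt.comp (g := fun w => G w i j) 0 (by rw [hψ0]; exact hGd i j) hψd
  have hGψ : matrixD m (fun x => G (ψ x)) 0 = ∑ c, B c m • matrixD c G z := by
    ext i j
    have h1 : fderiv ℝ (fun x => G (ψ x) i j) 0 =
        (fderiv ℝ (fun w => G w i j) z).comp (fderiv ℝ ψ 0) := by
      have h2 := fderiv_comp (𝕜 := ℝ) (g := fun w => G w i j) 0
        (by rw [hψ0]; exact hGd i j) hψd
      rw [hψ0] at h2
      exact h2
    have h2 : fderiv ℝ ψ 0 (basisVec m) = ∑ c, B c m • basisVec c := by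
      rw [plane_eq_sum (fderiv ℝ ψ 0 (basisVec m))]
      refine Finset.sum_congr rfl fun c _ => ?_
      rw [← hJ]
      rfl
    simp only [matrixD, Matrix.of_apply, partialD, h1, ContinuousLinearMap.comp_apply, h2,
      map_sum, map_smul, Matrix.sum_apply, Matrix.smul_apply]
  have hN : ∀ i j, DifferentiableAt ℝ (fun y => quadJac Γ y i j) 0 := differentiableAt_quadJac 0
  have hcd : ∀ (A : Matrix (Fin 2) (Fin 2) ℝ) (i j : Fin 2),
      DifferentiableAt ℝ (fun _ : Plane => A i j) 0 := fun A i j => differentiableAt_const _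
  have hd1 := differentiableAt_matrix_mul (hcd B.transpose) hGψd
  have hd2 := differentiableAt_matrix_mul hd1 (hcd B)
  have hNt : ∀ i j, DifferentiableAt ℝ (fun y => (quadJac Γ y).transpose i j) 0 :=
    fun i j => hN j i
  have hd3 := differentiableAt_matrix_mul hNt hd2
  have hQ : quadPull G z B Γ = fun x =>
      (quadJac Γ x).transpose * (B.transpose * G (ψ x) * B) * quadJac Γ x := by
    funext x
    rw [quadPull, Matrix.transpose_mul]
    simp only [Matrix.mul_assoc]
    rfl
  have hNtD : matrixD m (fun y => (quadJac Γ y).transpose) 0 =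
      (matrixD m (quadJac Γ) 0).transpose := rfl
  have hK : matrixD m (fun x => B.transpose * G (ψ x) * B) 0 = Matrix.of fun i j => h i j m := by
    rw [matrixD_mul hd1 (hcd B), matrixD_mul (hcd _) hGψd, matrixD_const, matrixD_const, hGψ]
    ext i j
    simp only [Matrix.zero_mul, Matrix.mul_zero, zero_add, add_zero, Finset.mul_sum,
      Finset.sum_mul, Matrix.mul_smul, Matrix.smul_mul, hh, linearD, Matrix.of_apply,
      Matrix.sum_apply, Matrix.smul_apply, smul_eq_mul]
  rw [hQ, matrixD_mul hd3 hN, matrixD_mul hNt hd2, hNtD, hK, matrixD_quadJac, quadJac_zero, hψ0,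
    hB]
  ext i j
  simp only [Matrix.transpose_one, one_mul, mul_one, Matrix.add_apply, Matrix.transpose_apply,
    Matrix.neg_apply, Matrix.of_apply, Matrix.zero_apply, hΓ, christoffel]
  have s1 := hsym i j m
  have s2 := hsym j m i
  have s3 := hsym i m j
  linarith

/-- The Gram-Schmidt frame of a symmetric positive definite matrix. -/
def gramFrame (A : Matrix (Fin 2) (Fin 2) ℝ) : Matrix (Fin 2) (Fin 2) ℝ :=
  !![(Real.sqrt (A 0 0))⁻¹, -A 0 1 * (Real.sqrt (A 0 0 * A.det))⁻¹;
    0, A 0 0 * (Real.sqrt (A 0 0 * A.det))⁻¹]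

theorem gramFrame_spec {A : Matrix (Fin 2) (Fin 2) ℝ} (hs : A 0 1 = A 1 0) (h0 : 0 < A 0 0)
    (hd : 0 < A.det) : (gramFrame A).transpose * A * gramFrame A = 1 := by
  have h1 : (Real.sqrt (A 0 0))⁻¹ ^ 2 * A 0 0 = 1 := by
    rw [inv_pow, Real.sq_sqrt h0.le, inv_mul_cancel₀ h0.ne']
  have h2 : (Real.sqrt (A 0 0 * A.det))⁻¹ ^ 2 * (A 0 0 * A.det) = 1 := by
    have : 0 < A 0 0 * A.det := by positivity
    rw [inv_pow, Real.sq_sqrt this.le, inv_mul_cancel₀ this.ne']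
  rw [Matrix.det_fin_two, ← hs] at h2
  ext i j
  fin_cases i <;> fin_cases j <;>
    simp [gramFrame, Matrix.mul_apply, Fin.sum_univ_two, ← hs]
  · linarith
  · ring
  · exact Or.inl (by ring)
  · rw [Matrix.det_fin_two, ← hs]
    linear_combination h2

end QuadraticCoordinates

/-! ### Smooth dependence of the quadratic coordinates on their centre. -/

section NormalCoordinates

/-- Joint continuity in the centre and the coordinate is what later gives one radius for all nearby
centres. -/
theorem continuousAt_fderiv_right {F : Type*} [NormedAddCommGroup F] [NormedSpace ℝ F]
    {H : Plane × Plane → F} {p : Plane × Plane} (h : ContDiffAt ℝ 2 H p) :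
    ContinuousAt (fun q : Plane × Plane => fderiv ℝ (fun x => H (q.1, x)) q.2) p := by
  have h1 : ContinuousAt (fun q => (fderiv ℝ H q).comp (ContinuousLinearMap.inr ℝ Plane Plane)) p :=
    ((h.fderiv_right (m := 1) (by norm_num)).continuousAt).clm_comp continuousAt_const
  refine h1.congr ?_
  filter_upwards [h.eventually (by simp)] with q hq
  have h2 : HasFDerivAt H (fderiv ℝ H q) (q.1, q.2) :=
    (hq.differentiableAt (by norm_num)).hasFDerivAt
  have h3 : HasFDerivAt (fun x => H (q.1, x))
      ((fderiv ℝ H q).comp (ContinuousLinearMap.inr ℝ Plane Plane)) q.2 :=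
    h2.comp q.2 (hasFDerivAt_prodMk_right q.1 q.2)
  exact h3.fderiv.symm

/-- The Christoffel symbols of `G` at `z` in the Gram-Schmidt frame. -/
def frameSymbol (G : Plane → Matrix (Fin 2) (Fin 2) ℝ) (z : Plane) :
    Fin 2 → Fin 2 → Fin 2 → ℝ :=
  christoffel (linearD G (gramFrame (G z)) z)

/-- Quadratic coordinates which are normal to first order at `z`. -/
def normalMap (G : Plane → Matrix (Fin 2) (Fin 2) ℝ) (z x : Plane) : Plane :=
  quadMap z (gramFrame (G z)) (frameSymbol G z) x

/-- The metric `G` in the coordinates `normalMap G z`. -/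
def normalPull (G : Plane → Matrix (Fin 2) (Fin 2) ℝ) (z x : Plane) : Matrix (Fin 2) (Fin 2) ℝ :=
  quadPull G z (gramFrame (G z)) (frameSymbol G z) x

variable {G : Plane → Matrix (Fin 2) (Fin 2) ℝ} {U : Set Plane}

theorem normalMap_zero (z : Plane) : normalMap G z 0 = z := quadMap_zero

theorem contDiff_normalMap {n : ℕ∞ω} (z : Plane) : ContDiff ℝ n (normalMap G z) :=
  contDiff_quadMap

theorem jacobian_normalMap (hsym : ∀ w i j, G w i j = G w j i) (z x : Plane) :
    normalPull G z x = (jacobian (normalMap G z) x).transpose * G (normalMap G z x) *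
      jacobian (normalMap G z) x := by
  have : jacobian (normalMap G z) x = gramFrame (G z) * quadJac (frameSymbol G z) x :=
    jacobian_quadMap (christoffel_symm (linearD_symm hsym)) x
  rw [this]
  rfl

/-- `G` is a smooth Riemannian metric on the open subset `U` of the plane. -/
structure IsPlanarMetric (G : Plane → Matrix (Fin 2) (Fin 2) ℝ) (U : Set Plane) : Prop where
  isOpen : IsOpen U
  smooth : ∀ i j, ContDiffOn ℝ ∞ (fun w => G w i j) U
  symm : ∀ w i j, G w i j = G w j i
  pos : ∀ w ∈ U, 0 < G w 0 0
  det_pos : ∀ w ∈ U, 0 < (G w).det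

namespace IsPlanarMetric

theorem contDiffOn_gramFrame (hG : IsPlanarMetric G U) (i j : Fin 2) :
    ContDiffOn ℝ ∞ (fun z => gramFrame (G z) i j) U := by
  have h1 : ContDiffOn ℝ ∞ (fun z => (Real.sqrt (G z 0 0))⁻¹) U :=
    ((hG.smooth 0 0).sqrt fun z hz => (hG.pos z hz).ne').inv
      fun z hz => (Real.sqrt_pos.2 (hG.pos z hz)).ne'
  have h2 : ContDiffOn ℝ ∞ (fun z => (G z).det) U := by
    simp only [Matrix.det_fin_two]
    exact ((hG.smooth 0 0).mul (hG.smooth 1 1)).sub ((hG.smooth 0 1).mul (hG.smooth 1 0))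
  have h3 : ContDiffOn ℝ ∞ (fun z => (Real.sqrt (G z 0 0 * (G z).det))⁻¹) U :=
    (((hG.smooth 0 0).mul h2).sqrt fun z hz => (mul_pos (hG.pos z hz) (hG.det_pos z hz)).ne').inv
      fun z hz => (Real.sqrt_pos.2 (mul_pos (hG.pos z hz) (hG.det_pos z hz))).ne'
  fin_cases i <;> fin_cases j <;> simp [gramFrame]
  · exact h1
  · exact ((hG.smooth 0 1).mul h3).neg
  · exact contDiffOn_const
  · exact (hG.smooth 0 0).mul h3

theorem contDiffOn_frameSymbol (hG : IsPlanarMetric G U) (l j k : Fin 2) :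
    ContDiffOn ℝ ∞ (fun z => frameSymbol G z l j k) U := by
  have hB := hG.contDiffOn_gramFrame
  have hD : ∀ c i j, ContDiffOn ℝ ∞ (fun z => matrixD c G z i j) U := fun c i j =>
    contDiffOn_partialD hG.isOpen (hG.smooth i j) (by simp) c
  have hh : ∀ i j k, ContDiffOn ℝ ∞ (fun z => linearD G (gramFrame (G z)) z i j k) U := by
    intro i j k
    simp only [linearD, Matrix.mul_apply, Matrix.transpose_apply]
    exact ContDiffOn.sum fun c _ => (hB c k).mul (ContDiffOn.sum fun a _ =>
      (ContDiffOn.sum fun b _ => (hB b i).mul (hD c b a)).mul (hB a j))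
  simp only [frameSymbol, christoffel]
  exact contDiffOn_const.mul (((hh l j k).add (hh l k j)).sub (hh j k l))

theorem contDiffAt_normalMap (hG : IsPlanarMetric G U) {p : Plane × Plane} (hp : p.1 ∈ U) :
    ContDiffAt ℝ ∞ (fun q : Plane × Plane => normalMap G q.1 q.2) p := by
  have hB : ∀ i j, ContDiffAt ℝ ∞ (fun q : Plane × Plane => gramFrame (G q.1) i j) p := fun i j =>
    ((hG.contDiffOn_gramFrame i j).contDiffAt (hG.isOpen.mem_nhds hp)).comp p contDiffAt_fst
  have hΓ : ∀ l j k, ContDiffAt ℝ ∞ (fun q : Plane × Plane => frameSymbol G q.1 l j k) p :=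
    fun l j k => ((hG.contDiffOn_frameSymbol l j k).contDiffAt
      (hG.isOpen.mem_nhds hp)).comp p contDiffAt_fst
  have hx : ∀ i, ContDiffAt ℝ ∞ (fun q : Plane × Plane => q.2 i) p := fun i =>
    (contDiff_coord i).contDiffAt.comp p contDiffAt_snd
  have hz : ∀ i, ContDiffAt ℝ ∞ (fun q : Plane × Plane => q.1 i) p := fun i =>
    (contDiff_coord i).contDiffAt.comp p contDiffAt_fst
  rw [contDiffAt_euclidean]
  intro a
  simp only [normalMap, quadMap_apply]
  exact (hz a).add (ContDiffAt.sum fun l _ => (hB a l).mul ((hx l).sub (contDiffAt_const.mul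
    (ContDiffAt.sum fun j _ => ContDiffAt.sum fun k _ => (hΓ l j k).mul ((hx j).mul (hx k))))))

theorem contDiffAt_normalPull (hG : IsPlanarMetric G U) {p : Plane × Plane} (hp : p.1 ∈ U)
    (hp' : normalMap G p.1 p.2 ∈ U)
    (i j : Fin 2) :
    ContDiffAt ℝ ∞ (fun q : Plane × Plane => normalPull G q.1 q.2 i j) p := by
  have hB : ∀ i j, ContDiffAt ℝ ∞ (fun q : Plane × Plane => gramFrame (G q.1) i j) p := fun i j =>
    ((hG.contDiffOn_gramFrame i j).contDiffAt (hG.isOpen.mem_nhds hp)).comp p contDiffAt_fst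
  have hΓ : ∀ l j k, ContDiffAt ℝ ∞ (fun q : Plane × Plane => frameSymbol G q.1 l j k) p :=
    fun l j k => ((hG.contDiffOn_frameSymbol l j k).contDiffAt
      (hG.isOpen.mem_nhds hp)).comp p contDiffAt_fst
  have hx : ∀ i, ContDiffAt ℝ ∞ (fun q : Plane × Plane => q.2 i) p := fun i =>
    (contDiff_coord i).contDiffAt.comp p contDiffAt_snd
  have hGψ : ∀ a b, ContDiffAt ℝ ∞ (fun q : Plane × Plane => G (normalMap G q.1 q.2) a b) p :=
    fun a b => ContDiffAt.comp (g := fun w => G w a b) p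
      ((hG.smooth a b).contDiffAt (hG.isOpen.mem_nhds hp')) (hG.contDiffAt_normalMap hp)
  have hJ : ∀ a i, ContDiffAt ℝ ∞ (fun q : Plane × Plane =>
      (gramFrame (G q.1) * quadJac (frameSymbol G q.1) q.2) a i) p := fun a i => by
    simp only [Matrix.mul_apply, quadJac, Matrix.of_apply]
    exact ContDiffAt.sum fun l _ => (hB a l).mul (contDiffAt_const.sub
      (ContDiffAt.sum fun j _ => (hΓ l j i).mul (hx j)))
  have hGJ : normalPull G = fun z x =>
      (gramFrame (G z) * quadJac (frameSymbol G z) x).transpose * G (normalMap G z x) *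
      (gramFrame (G z) * quadJac (frameSymbol G z) x) := rfl
  rw [hGJ]
  simp only [Matrix.mul_apply (M := _ * _) (N := gramFrame _ * _),
    Matrix.mul_apply (M := Matrix.transpose _), Matrix.transpose_apply]
  exact ContDiffAt.sum fun b _ => (ContDiffAt.sum fun a _ => (hJ a i).mul (hGψ a b)).mul (hJ b j)

theorem normalPull_zero (hG : IsPlanarMetric G U) {z : Plane} (hz : z ∈ U) : normalPull G z 0 = 1 :=
  quadPull_zero (gramFrame_spec (hG.symm z 0 1) (hG.pos z hz) (hG.det_pos z hz))

theorem fderiv_normalPull_zero (hG : IsPlanarMetric G U) {z : Plane} (hz : z ∈ U) (i j : Fin 2) :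
    fderiv ℝ (fun x => normalPull G z x i j) 0 = 0 := by
  have h := fun m => matrixD_quadPull_zero
    (gramFrame_spec (hG.symm z 0 1) (hG.pos z hz) (hG.det_pos z hz)) hG.symm
    (fun i j => ((hG.smooth i j).contDiffAt (hG.isOpen.mem_nhds hz)).differentiableAt (by simp)) m
  ext v
  rw [plane_eq_sum v, map_sum]
  refine Finset.sum_eq_zero fun m _ => ?_
  have h1 : fderiv ℝ (fun x => normalPull G z x i j) 0 (basisVec m) = 0 :=
    congrFun (congrFun (h m) i) j
  rw [map_smul, h1, smul_zero]

end IsPlanarMetric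

end NormalCoordinates

/-! ### Normal coordinates on balls of a uniform radius. -/

section UniformCoordinates

theorem two_le_infty : (2 : ℕ∞ω) ≤ ((⊤ : ℕ∞) : ℕ∞ω) := by
  change ((2 : ℕ∞) : ℕ∞ω) ≤ ((⊤ : ℕ∞) : ℕ∞ω)
  exact WithTop.coe_le_coe.2 le_top

/-- The inverse is smooth by the inverse function theorem at each point of the source. -/
theorem mem_contDiffGroupoid_of_bijective_fderiv {e : OpenPartialHomeomorph Plane Plane}
    (h : ContDiffOn ℝ ∞ e e.source)
    (hd : ∀ x ∈ e.source, ∃ l : Plane ≃L[ℝ] Plane, HasFDerivAt e (l : Plane →L[ℝ] Plane) x) :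
    e ∈ contDiffGroupoid ∞ 𝓘(ℝ, Plane) := by
  rw [contDiffGroupoid, mem_groupoid_of_pregroupoid]
  have h2 : ContDiffOn ℝ ∞ e.symm e.target := fun y hy => by
    obtain ⟨l, hl⟩ := hd _ (e.map_target hy)
    exact (e.contDiffAt_symm hy hl
      (h.contDiffAt (e.open_source.mem_nhds (e.map_target hy)))).contDiffWithinAt
  simpa [contDiffPregroupoid] using ⟨h, h2⟩

variable {G : Plane → Matrix (Fin 2) (Fin 2) ℝ} {U : Set Plane}

theorem IsPlanarMetric.exists_equiv_fderiv (hG : IsPlanarMetric G U) {z : Plane} (hz : z ∈ U) :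
    ∃ l : Plane ≃L[ℝ] Plane, (l : Plane →L[ℝ] Plane) = fderiv ℝ (normalMap G z) 0 := by
  have h1 := jacobian_normalMap hG.symm z 0
  rw [hG.normalPull_zero hz] at h1
  have h2 : (fderiv ℝ (normalMap G z) 0).det ≠ 0 := by
    rw [← det_jacobian]
    intro h
    have h3 := congrArg Matrix.det h1
    rw [Matrix.det_one, Matrix.det_mul, h, mul_zero] at h3
    exact one_ne_zero h3
  exact ⟨(fderiv ℝ (normalMap G z) 0).toContinuousLinearEquivOfDetNeZero h2,
    ContinuousLinearMap.coe_toContinuousLinearEquivOfDetNeZero _ h2⟩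

/-- First-order normal coordinates on balls of a uniform size. -/
theorem IsPlanarMetric.exists_uniform_coordinates (hG : IsPlanarMetric G U) {zp : Plane}
    (hzp : zp ∈ U) :
    ∃ ε > 0, ∀ z ∈ Metric.ball zp ε, z ∈ U ∧ ∃ e ∈ contDiffGroupoid ∞ 𝓘(ℝ, Plane),
      e.source = Metric.ball 0 ε ∧ (e : Plane → Plane) = normalMap G z ∧
      ∀ x ∈ Metric.ball 0 ε, normalMap G z x ∈ U ∧
        (∀ i j, |normalPull G z x i j - (1 : Matrix (Fin 2) (Fin 2) ℝ) i j| ≤ 1 / 8) ∧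
        ∀ i j, ‖fderiv ℝ (fun x => normalPull G z x i j) x‖ ≤ 1 := by
  obtain ⟨l, hl⟩ := hG.exists_equiv_fderiv hzp
  -- Maps whose difference from `l` is `c`-Lipschitz with `c < ‖l⁻¹‖⁻¹` are injective and open; half
  -- of the threshold leaves a strict inequality.
  set c : NNReal := ‖(l.symm : Plane →L[ℝ] Plane)‖₊⁻¹ / 2 with hc
  have hne : ‖(l.symm : Plane →L[ℝ] Plane)‖₊ ≠ 0 := by
    rw [nnnorm_ne_zero_iff]
    intro h
    have h1 := l.symm_apply_apply (basisVec 0)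
    have h2 : l.symm (l (basisVec 0)) = (l.symm : Plane →L[ℝ] Plane) (l (basisVec 0)) := rfl
    rw [h2, h] at h1
    have h3 := congrFun (congrArg WithLp.ofLp h1) 0
    simp [basisVec] at h3
  have hc0 : 0 < c := by positivity
  have hcl : c < ‖(l.symm : Plane →L[ℝ] Plane)‖₊⁻¹ := NNReal.half_lt_self (inv_ne_zero hne)
  have hp' : normalMap G zp 0 ∈ U := by rwa [normalMap_zero]
  have hm := hG.contDiffAt_normalMap (p := (zp, 0)) hzp
  have hH := hG.contDiffAt_normalPull (p := (zp, 0)) hzp hp'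
  have hcont := continuousAt_fderiv_right (hm.of_le two_le_infty)
  have ev1 : ∀ᶠ q : Plane × Plane in nhds (zp, 0), q.1 ∈ U :=
    continuousAt_fst.eventually (hG.isOpen.mem_nhds hzp)
  have ev2 : ∀ᶠ q : Plane × Plane in nhds (zp, 0), normalMap G q.1 q.2 ∈ U :=
    hm.continuousAt.eventually (hG.isOpen.mem_nhds hp')
  have ev3 : ∀ᶠ q : Plane × Plane in nhds (zp, 0),
      ‖fderiv ℝ (normalMap G q.1) q.2 - (l : Plane →L[ℝ] Plane)‖ < c := by
    have h := hcont.eventually (Metric.ball_mem_nhds _ (NNReal.coe_pos.2 hc0))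
    filter_upwards [h] with q hq
    rw [hl, ← dist_eq_norm]
    exact hq
  -- Invertible linear maps form an open set. Invertibility on the whole ball is needed for the
  -- smoothness of the inverse.
  have ev4 : ∀ᶠ q : Plane × Plane in nhds (zp, 0),
      fderiv ℝ (normalMap G q.1) q.2 ∈ range ((↑) : (Plane ≃L[ℝ] Plane) → Plane →L[ℝ] Plane) := by
    refine hcont.eventually ?_
    have h := ContinuousLinearEquiv.nhds l
    rw [hl] at h
    exact h
  have ev5 : ∀ i j, ∀ᶠ q : Plane × Plane in nhds (zp, 0),
      |normalPull G q.1 q.2 i j - (1 : Matrix (Fin 2) (Fin 2) ℝ) i j| < 1 / 8 := fun i j => by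
    have h := (hH i j).continuousAt.eventually
      (Metric.ball_mem_nhds _ (show (0 : ℝ) < 1 / 8 by norm_num))
    filter_upwards [h] with q hq
    rw [Real.dist_eq] at hq
    simp only [hG.normalPull_zero hzp] at hq
    exact hq
  have ev6 : ∀ i j, ∀ᶠ q : Plane × Plane in nhds (zp, 0),
      ‖fderiv ℝ (fun x => normalPull G q.1 x i j) q.2‖ < 1 := fun i j => by
    have h := (continuousAt_fderiv_right ((hH i j).of_le two_le_infty)).norm
    have h' : ‖fderiv ℝ (fun x => normalPull G (zp, (0 : Plane)).1 x i j) (zp, (0 : Plane)).2‖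
        < 1 := by
      simp [hG.fderiv_normalPull_zero hzp i j]
    exact h.eventually_lt continuousAt_const h'
  have ev := ev1.and (ev2.and (ev3.and (ev4.and ((Filter.eventually_all.2 fun i =>
    Filter.eventually_all.2 fun j => ev5 i j).and (Filter.eventually_all.2 fun i =>
    Filter.eventually_all.2 fun j => ev6 i j)))))
  obtain ⟨ε, hε, hball⟩ := Metric.eventually_nhds_iff_ball.1 ev
  refine ⟨ε, hε, fun z hz => ?_⟩
  have hb : ∀ x ∈ Metric.ball (0 : Plane) ε, (z, x) ∈ Metric.ball (zp, (0 : Plane)) ε :=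
    fun x hx => by
      rw [← ball_prod_same]
      exact ⟨hz, hx⟩
  have hdiff : ∀ x, HasFDerivAt (normalMap G z) (fderiv ℝ (normalMap G z) x) x := fun x =>
    ((contDiff_normalMap (n := 1) z).differentiable (by norm_num) x).hasFDerivAt
  -- The linear map `l` belongs to the fixed centre `zp`, yet it approximates `normalMap G z` for
  -- every nearby `z`. The inverse therefore exists on the same ball for all of them.
  have happ : ApproximatesLinearOn (normalMap G z) (l : Plane →L[ℝ] Plane)
      (Metric.ball 0 ε) c := fun x hx y hy =>
    (convex_ball _ _).norm_image_sub_le_of_norm_hasFDerivWithin_le'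
      (fun w _ => (hdiff w).hasFDerivWithinAt)
      (fun w hw => (hball _ (hb w hw)).2.2.1.le) hy hx
  refine ⟨(hball _ (hb 0 (Metric.mem_ball_self hε))).1,
    happ.toOpenPartialHomeomorph (normalMap G z) (Metric.ball 0 ε) (Or.inr hcl) Metric.isOpen_ball,
    mem_contDiffGroupoid_of_bijective_fderiv (contDiff_normalMap z).contDiffOn fun x hx => ?_,
    rfl, rfl, fun x hx => ?_⟩
  · obtain ⟨l', hl'⟩ := (hball _ (hb x hx)).2.2.2.1
    refine ⟨l', ?_⟩
    rw [hl']
    exact hdiff x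
  · obtain ⟨-, h2, -, -, h5, h6⟩ := hball _ (hb x hx)
    exact ⟨h2, fun i j => (h5 i j).le, fun i j => (h6 i j).le⟩

end UniformCoordinates

/-! ### Existence of adapted charts of uniform size on a compact surface. -/

section AdaptedCharts

variable {M : Type*} [TopologicalSpace M] [ChartedSpace Plane M] [IsManifold 𝓘(ℝ, Plane) ∞ M]

theorem isPlanarMetric_metricMatrix (g : Metric M) {Ψ : OpenPartialHomeomorph M Plane}
    (hΨ : Ψ ∈ IsManifold.maximalAtlas 𝓘(ℝ, Plane) ∞ M) :
    IsPlanarMetric (metricMatrix g Ψ) Ψ.target where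
  isOpen := Ψ.open_target
  smooth := metricMatrix_contDiffOn g hΨ
  symm := metricMatrix_symm g Ψ
  pos x hx := (det_pos_of_quadratic_pos (metricMatrix_symm g Ψ x 0 1)
    fun _ hξ => metricMatrix_quadratic_pos g hΨ hx hξ).1
  det_pos x hx := metricMatrix_det_pos g hΨ hx

theorem trans_symm_mem_maximalAtlas {Ψ : OpenPartialHomeomorph M Plane}
    (hΨ : Ψ ∈ IsManifold.maximalAtlas 𝓘(ℝ, Plane) ∞ M) {e : OpenPartialHomeomorph Plane Plane}
    (he : e ∈ contDiffGroupoid ∞ 𝓘(ℝ, Plane)) :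
    Ψ.trans e.symm ∈ IsManifold.maximalAtlas 𝓘(ℝ, Plane) ∞ M := by
  have hes := (contDiffGroupoid ∞ 𝓘(ℝ, Plane)).symm he
  refine (mem_maximalAtlas_iff (G := contDiffGroupoid ∞ 𝓘(ℝ, Plane))).2 fun e' he' => ⟨?_, ?_⟩
  · rw [OpenPartialHomeomorph.trans_symm_eq_symm_trans_symm, OpenPartialHomeomorph.symm_symm,
      OpenPartialHomeomorph.trans_assoc]
    exact (contDiffGroupoid ∞ 𝓘(ℝ, Plane)).trans he
      ((mem_maximalAtlas_iff (G := contDiffGroupoid ∞ 𝓘(ℝ, Plane))).1 hΨ e' he').1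
  · rw [← OpenPartialHomeomorph.trans_assoc]
    exact (contDiffGroupoid ∞ 𝓘(ℝ, Plane)).trans
      ((mem_maximalAtlas_iff (G := contDiffGroupoid ∞ 𝓘(ℝ, Plane))).1 hΨ e' he').2 hes

/-- The diagonal and the off-diagonal deviations each change the form by at most `|ξ|²/8`, well
within the factor 2. -/
theorem quadratic_bounds_of_near_one {A : Matrix (Fin 2) (Fin 2) ℝ}
    (hA : ∀ i j, |A i j - (1 : Matrix (Fin 2) (Fin 2) ℝ) i j| ≤ 1 / 8) (ξ : Plane) :
    (2 : ℝ)⁻¹ * ‖ξ‖ ^ 2 ≤ ∑ i, ∑ j, A i j * ξ i * ξ j ∧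
      ∑ i, ∑ j, A i j * ξ i * ξ j ≤ 2 * ‖ξ‖ ^ 2 := by
  have h00 := abs_le.1 (hA 0 0)
  have h01 := abs_le.1 (hA 0 1)
  have h10 := abs_le.1 (hA 1 0)
  have h11 := abs_le.1 (hA 1 1)
  simp at h00 h01 h10 h11
  rw [norm_sq_plane]
  simp only [Fin.sum_univ_two]
  have s0 := sq_nonneg (ξ 0)
  have s1 := sq_nonneg (ξ 1)
  have sp := sq_nonneg (ξ 0 + ξ 1)
  have sm := sq_nonneg (ξ 0 - ξ 1)
  have q0 := mul_le_mul_of_nonneg_right h00.1 s0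
  have q0' := mul_le_mul_of_nonneg_right h00.2 s0
  have q1 := mul_le_mul_of_nonneg_right h11.1 s1
  have q1' := mul_le_mul_of_nonneg_right h11.2 s1
  have hx : |(A 0 1 + A 1 0) * (ξ 0 * ξ 1)| ≤ 1 / 8 * (ξ 0 ^ 2 + ξ 1 ^ 2) := by
    rw [abs_mul]
    have h1 : |A 0 1 + A 1 0| ≤ 1 / 4 := abs_le.2 ⟨by linarith, by linarith⟩
    have h2 : |ξ 0 * ξ 1| ≤ 1 / 2 * (ξ 0 ^ 2 + ξ 1 ^ 2) := abs_le.2 ⟨by linarith, by linarith⟩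
    calc _ ≤ 1 / 4 * (1 / 2 * (ξ 0 ^ 2 + ξ 1 ^ 2)) :=
          mul_le_mul h1 h2 (abs_nonneg _) (by norm_num)
      _ = _ := by ring
  obtain ⟨hx1, hx2⟩ := abs_le.1 hx
  constructor <;> linarith

/-- The chart is a fixed chart at `p` followed by the inverse of the normal coordinates centred at
the image of `p₀`. All sizes `δ' ≤ δ` are allowed so that a minimum over a finite cover can be
taken. -/
theorem exists_adapted_chart_near (g : Metric M) (p : M) :
    ∃ δ > 0, ∀ᶠ p₀ in nhds p, ∀ δ' : ℝ, δ' ≤ δ →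
      ∃ Φ : OpenPartialHomeomorph M Plane, IsAdaptedChart g p₀ δ' 2 Φ := by
  set Ψ := chartAt Plane p with hΨdef
  have hΨ : Ψ ∈ IsManifold.maximalAtlas 𝓘(ℝ, Plane) ∞ M := IsManifold.chart_mem_maximalAtlas p
  have hp : p ∈ Ψ.source := mem_chart_source Plane p
  have hG := isPlanarMetric_metricMatrix g hΨ
  obtain ⟨ε, hε, h⟩ := hG.exists_uniform_coordinates (Ψ.map_source hp)
  refine ⟨ε / 2, by positivity, ?_⟩
  have hev : ∀ᶠ p₀ in nhds p, Ψ p₀ ∈ Metric.ball (Ψ p) ε :=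
    (Ψ.continuousAt hp).eventually (Metric.ball_mem_nhds _ hε)
  filter_upwards [hev, Ψ.open_source.mem_nhds hp] with p₀ hp₀ hp₀s δ' hδ'
  obtain ⟨-, e, he, hes, hecoe, hx⟩ := h _ hp₀
  set z := Ψ p₀ with hz
  have hzU : z ∈ Ψ.target := Ψ.map_source hp₀s
  have h0s : (0 : Plane) ∈ e.source := by
    rw [hes]
    exact Metric.mem_ball_self hε
  have he0 : e 0 = z := by rw [hecoe, normalMap_zero]
  have hzt : z ∈ e.target := by
    rw [← he0]
    exact e.map_source h0s
  have htarget : (Ψ.trans e.symm).target = Metric.ball 0 ε := by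
    ext x
    rw [OpenPartialHomeomorph.trans_target]
    simp only [OpenPartialHomeomorph.symm_target, OpenPartialHomeomorph.symm_symm, mem_inter_iff,
      mem_preimage, hes, hecoe]
    exact ⟨fun h => h.1, fun h => ⟨h, (hx x h).1⟩⟩
  have hmetric : ∀ x ∈ Metric.ball (0 : Plane) ε,
      metricMatrix g (Ψ.trans e.symm) x = normalPull (metricMatrix g Ψ) z x := fun x hxb => by
    rw [jacobian_normalMap hG.symm]
    refine metricMatrix_comp g hΨ ((contDiff_normalMap (n := 1) z).differentiable (by norm_num) x)
      (hx x hxb).1 (Filter.Eventually.of_forall fun y => ?_)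
    rw [← hecoe]
    rfl
  have hball : Metric.closedBall (0 : Plane) δ' ⊆ Metric.ball 0 ε :=
    Metric.closedBall_subset_ball (by linarith)
  have hfd : ∀ x ∈ Metric.ball (0 : Plane) ε, ∀ i j,
      fderiv ℝ (fun y => metricMatrix g (Ψ.trans e.symm) y i j) x =
        fderiv ℝ (fun y => normalPull (metricMatrix g Ψ) z y i j) x := fun x hxb i j => by
    refine Filter.EventuallyEq.fderiv_eq ?_
    filter_upwards [Metric.isOpen_ball.mem_nhds hxb] with y hy
    rw [hmetric y hy]
  have h0b : (0 : Plane) ∈ Metric.ball (0 : Plane) ε := Metric.mem_ball_self hε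
  refine ⟨Ψ.trans e.symm, trans_symm_mem_maximalAtlas hΨ he, ?_, ?_, ?_, ?_, ?_, ?_, ?_⟩
  · rw [OpenPartialHomeomorph.trans_source]
    exact ⟨hp₀s, hzt⟩
  · change e.symm (Ψ p₀) = 0
    rw [← hz, ← he0, e.left_inv h0s]
  · rw [htarget]
    exact hball
  · rw [hmetric 0 h0b, hG.normalPull_zero hzU]
  · intro i j
    rw [hfd 0 h0b, hG.fderiv_normalPull_zero hzU]
  · intro x hxδ ξ
    rw [hmetric x (hball hxδ)]
    exact quadratic_bounds_of_near_one (hx x (hball hxδ)).2.1 ξ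
  · intro x hxδ i j
    rw [hfd x (hball hxδ)]
    exact ((hx x (hball hxδ)).2.2 i j).trans (by norm_num)

theorem exists_uniform_adapted_charts [CompactSpace M] (g : Metric M) :
    ∃ δ : ℝ, 0 < δ ∧ ∃ Λ : ℝ, 0 < Λ ∧ ∀ p₀ : M,
      ∃ Φ : OpenPartialHomeomorph M Plane, IsAdaptedChart g p₀ δ Λ Φ := by
  choose δ hδ h using exists_adapted_chart_near g
  obtain ⟨t, ht⟩ := CompactSpace.elim_nhds_subcover _ h
  -- The finite cover is empty when `M` is, and then any positive size serves.
  have hmin : ∃ d : ℝ, 0 < d ∧ ∀ p ∈ t, d ≤ δ p := by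
    rcases t.eq_empty_or_nonempty with rfl | hne
    · exact ⟨1, one_pos, by simp⟩
    · exact ⟨t.inf' hne δ, (Finset.lt_inf'_iff hne).2 fun p _ => hδ p,
        fun p hp => Finset.inf'_le δ hp⟩
  obtain ⟨d, hd, hdt⟩ := hmin
  refine ⟨d, hd, 2, two_pos, fun p₀ => ?_⟩
  have hp₀ : p₀ ∈ ⋃ p ∈ t, {p₀ | ∀ δ' : ℝ, δ' ≤ δ p →
      ∃ Φ : OpenPartialHomeomorph M Plane, IsAdaptedChart g p₀ δ' 2 Φ} := ht ▸ mem_univ p₀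
  simp only [mem_iUnion] at hp₀
  obtain ⟨p, hp, hpp⟩ := hp₀
  exact hpp d (hdt p hp)

end AdaptedCharts

end
end HarmonicFlow

theorem proposition2p1 {M : Type*} [TopologicalSpace M] [CompactSpace M] [T2Space M]
    [ChartedSpace HarmonicFlow.Plane M] [IsManifold 𝓘(ℝ, HarmonicFlow.Plane) ∞ M]
    [MeasurableSpace M] [BorelSpace M] (g : HarmonicFlow.Metric M) :
    (∃ δ : ℝ, 0 < δ ∧ ∃ Λ : ℝ, 0 < Λ ∧ ∀ p₀ : M,
      ∃ Φ : OpenPartialHomeomorph M HarmonicFlow.Plane,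
        HarmonicFlow.IsAdaptedChart g p₀ δ Λ Φ) ∧
    ∀ δ : ℝ, 0 < δ → ∀ Λ : ℝ, 0 < Λ → ∀ c : ℝ, 0 < c → ∀ κ : ℝ, 1 < κ →
      ∃ C : ℝ, 0 < C ∧ ∃ s₀ : ℝ,
        ∀ (p₀ : M) (Φ : OpenPartialHomeomorph M HarmonicFlow.Plane),
          HarmonicFlow.IsAdaptedChart g p₀ δ Λ Φ →
        ∀ φ : HarmonicFlow.Plane → ℝ, HarmonicFlow.IsCutoff δ c φ →
        ∀ (n k : ℕ) (N : Set (HarmonicFlow.Euc k)), HarmonicFlow.IsSubmanifold n k N →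
        ∀ T : ℝ, 0 < T → ∀ u : M → ℝ → HarmonicFlow.Euc k,
          HarmonicFlow.IsHarmonicHeatFlow g N T u →
          (∀ s' s : ℝ, s₀ ≤ s' → -Real.log T ≤ s' → s' < s →
            HarmonicFlow.localEnergy g Φ φ (HarmonicFlow.rescaled Φ T u) s ≤
              (1 + κ⁻¹) *
                  HarmonicFlow.localEnergy g Φ φ (HarmonicFlow.rescaled Φ T u) s' +
                C * Real.exp (-κ * s') * HarmonicFlow.energy g (fun p => u p 0)) ∧
          HarmonicFlow.localDissipation g Φ φ (HarmonicFlow.rescaled Φ T u) (-Real.log T) ≤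
            ENNReal.ofReal (C * HarmonicFlow.energy g (fun p => u p 0)) := by
  have : SecondCountableTopology M :=
    ChartedSpace.secondCountable_of_sigmaCompact HarmonicFlow.Plane M
  refine ⟨HarmonicFlow.exists_uniform_adapted_charts g, fun δ hδ Λ hΛ c hc κ hκ => ?_⟩
  obtain ⟨C, hC, s₀, h⟩ := HarmonicFlow.exists_monotonicity_constants g hδ hΛ hc hκ
  exact ⟨C, hC, s₀, fun p₀ Φ hΦ φ hφ n k N _ T hT u hu => h p₀ Φ hΦ φ hφ k N T hT u hu⟩
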